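/- **Model.** Fix integers $m\ge 2$, $0\le s\le n\le m$, $0\le k<n$ and rates $\lambda_e,\lambda_s>0$. A source serves $m$ receiver nodes, of which a fixed set $\mathcal S$ of $s$ nodes are subscribers and the others are nonsubscribers. The source is updated at the jump times $\tau_1<\tau_2<\dots$ of a Poisson process $N_0(t)$ with rate $\lambda_s$ ($\tau_0:=0$); the update at $\tau_\ell$ has version $\ell$. At time $\tau_\ell$ the source puts the update into $n$ distinct keys, any $k+1$ of which suffice to decrypt it, and instantly sends one key to each subscriber and one key to each node of a uniformly random set $\mathcal M^\ell$ of $n-s$ nonsubscribers; put $\mathcal K^\ell=\mathcal S\cup\mathcal M^\ell$. Every ordered pair $(i,j)$ of distinct receiver nodes is an edge, which is activated at the jump times of a Poisson process with rate $\lambda_e/(m-1)$ (scalable homogeneous network). All these Poisson processes and all the random sets $\mathcal M^\ell$ are mutually independent. Nodes are memoryless: when the edge $(i,j)$ is activated at time $t$, node $i$ sends to node $j$ only the key of the current version $\ell=N_0(t)$ that node $i$ got from the source, and sends nothing if $i\notin\mathcal K^\ell$; keys obtained from other nodes are not passed on. Node $j$ decrypts version $\ell$ once it has $k+1$ distinct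 keys of version $\ell$ (including the key that it got from the source if $j\in\mathcal K^\ell$). Let $N_j^k(t)$ be the latest version that node $j$ has decrypted by time $t$ ($0$ if there is none). The $k$-keys version age of node $j$ is $\bar A_j(k,t)=N_0(t)-N_j^k(t)$, and its version age of $k$-keys is the time average $$\bar\Delta_j(k)=\lim_{t\to\infty}\frac1t\int_0^t\bar A_j(k,\tau)\,d\tau .$$ Let $$\mathcal B(n,m,i)=\frac{n-i}{m-1},\qquad \mathcal A(n,m,j)=\prod_{i=1}^{j}\frac{\lambda_e\mathcal B(n,m,i)}{\lambda_e\mathcal B(n,m,i)+\lambda_s}\quad(j\ge1),\qquad \mathcal A(n,m,0)=1 .$$ **Statement.** For every subscriber node $j$, with probability $1$ the limit $\bar\Delta_j(k)$ exists and $$\bar\Delta_j(k)=\frac{\displaystyle\sum_{i=1}^{k}\frac{\lambda_s\,\mathcal A(n,m,i-1)}{\lambda_e\mathcal B(n,m,i)+\lambda_s}}{\mathcal A(n,m,k)} .$$ For every nonsubscriber node $j$, with probability $1$ the limit $\bar\Delta_j(k)$ exists and $$\bar\Delta_j(k)=\frac{\displaystyle (n-s)\sum_{i=1}^{k}\frac{\lambda_s\,\mathcal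 A(n,m,i-1)}{\lambda_e\mathcal B(n,m,i)+\lambda_s}}{(n-s)\mathcal A(n,m,k)+(m-n)\mathcal A(n+1,m,k+1)}+\frac{\displaystyle (m-n)\sum_{i=1}^{k+1}\frac{\lambda_s\,\mathcal A(n+1,m,i-1)}{\lambda_e\mathcal B(n+1,m,i)+\lambda_s}}{(n-s)\mathcal A(n,m,k)+(m-n)\mathcal A(n+1,m,k+1)} .$$ This covers both total key subscription ($s=n$) and partial key subscription ($s<n$). -/

import Mathlib

open MeasureTheory ProbabilityTheory Filter Topology
open scoped NNReal

namespace CodedGossip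

/-- `N` is a Poisson counter (homogeneous Poisson process) with rate `r`: a counting process
starting at `0`, with nondecreasing right-continuous paths and independent increments, the
increment over `(s, t]` being Poisson distributed with parameter `r * (t - s)`. -/
structure IsPoissonCounter {Ω : Type*} [MeasurableSpace Ω] (N : ℝ≥0 → Ω → ℕ) (r : ℝ≥0)
    (μ : Measure Ω) : Prop where
  measurable : ∀ t, Measurable (N t)
  zero : ∀ ω, N 0 ω = 0
  mono : ∀ ω, Monotone fun t => N t ω
  rightCts : ∀ ω t, ContinuousWithinAt (fun u => N u ω) (Set.Ici t) t
  indepIncrements : HasIndepIncrements N μ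
  law : ∀ s t, s ≤ t → HasLaw (fun ω => N t ω - N s ω) (poissonMeasure (r * (t - s))) μ

/-- The directed edges `e = (i, j)`, `i ≠ j`, between the `m` receiver nodes of the fully
connected network. -/
abbrev Edge (m : ℕ) : Type := {e : Fin m × Fin m // e.1 ≠ e.2}

/-- The finite collection of all sets of receiver nodes carries the discrete σ-algebra. -/
instance instMeasurableSpaceFinsetNode (m : ℕ) : MeasurableSpace (Finset (Fin m)) := ⊤

/-- A scalable homogeneous network on `m` receiver nodes with set of subscribers `S`, in which
the source puts every update into `n` distinct keys.  `N₀` is the counter of source updates (rate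
`lamS`), `N e` the activation counter of the edge `e` (rate `lamE / (m - 1)`), and `M ℓ` the set of
nonsubscribers selected by the source to get the remaining `n - |S|` keys of version `ℓ`, which is
uniform among the sets of `n - |S|` nonsubscribers.  All counters and all selections are
independent. -/
structure IsScalableHomogeneousNetwork {Ω : Type*} [MeasurableSpace Ω] {m : ℕ}
    (N₀ : ℝ≥0 → Ω → ℕ) (N : Edge m → ℝ≥0 → Ω → ℕ) (M : ℕ → Ω → Finset (Fin m))
    (S : Finset (Fin m)) (n : ℕ) (lamE lamS : ℝ≥0) (μ : Measure Ω) : Prop where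
  source : IsPoissonCounter N₀ lamS μ
  edge : ∀ e, IsPoissonCounter (N e) (lamE / ((m : ℝ≥0) - 1)) μ
  selection : ∀ ℓ, HasLaw (M ℓ) (uniformOn (Sᶜ.powersetCard (n - S.card) : Set (Finset (Fin m)))) μ
  indep_counters :
    iIndepFun (fun (c : Option (Edge m)) ω (t : ℝ≥0) => (c.elim N₀ N : ℝ≥0 → Ω → ℕ) t ω) μ
  indep_selections : iIndepFun M μ
  indep_counters_selections :
    IndepFun (fun ω (c : Option (Edge m)) (t : ℝ≥0) => (c.elim N₀ N : ℝ≥0 → Ω → ℕ) t ω)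
      (fun ω ℓ => M ℓ ω) μ

section SamplePath

/-! Throughout this section `a₀` and `a e` are sample paths of the source counter and of the edge
counters, and `K ℓ` is the set of nodes that get a key of version `ℓ` from the source. -/

/-- The counter with sample path `c` ticks at time `v`. -/
def TicksAt (c : ℝ≥0 → ℕ) (v : ℝ≥0) : Prop := 0 < v ∧ ∀ u < v, c u < c v

variable {m : ℕ} (a₀ : ℝ≥0 → ℕ) (a : Edge m → ℝ≥0 → ℕ) (K : ℕ → Finset (Fin m))

/-- Memoryless scheme: node `j` has obtained, by time `t`, the key of version `ℓ` that the source
gave to node `i`.  The source gives this key to node `i` only if `i ∈ K ℓ`.  Node `j` obtains its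
own key directly from the source as soon as version `ℓ` is generated; it obtains the key of another
node `i` when the edge `(i, j)` is activated while `ℓ` is the current version at the source. -/
def HasKey (j : Fin m) (ℓ : ℕ) (t : ℝ≥0) (i : Fin m) : Prop :=
  i ∈ K ℓ ∧
    ((i = j ∧ ℓ ≤ a₀ t) ∨
      ∃ h : i ≠ j, ∃ v ≤ t, TicksAt (a ⟨(i, j), h⟩) v ∧ a₀ v = ℓ)

/-- Node `j` has collected, by time `t`, at least `k + 1` distinct keys of version `ℓ`. -/
def HasDecrypted (k : ℕ) (j : Fin m) (ℓ : ℕ) (t : ℝ≥0) : Prop :=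
  k + 1 ≤ {i | HasKey a₀ a K j ℓ t i}.ncard

/-- The latest version that node `j` has decrypted by time `t`; it is `0` as long as nothing has
been decrypted. -/
noncomputable def latestVersion (k : ℕ) (j : Fin m) (t : ℝ≥0) : ℕ :=
  sSup {ℓ | ℓ ≤ a₀ t ∧ (ℓ = 0 ∨ HasDecrypted a₀ a K k j ℓ t)}

/-- The memoryless `k`-keys version age of node `j` at time `t`. -/
noncomputable def versionAge (k : ℕ) (j : Fin m) (t : ℝ≥0) : ℝ :=
  (a₀ t : ℝ) - (latestVersion a₀ a K k j t : ℝ)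

/-- The time average over `[0, t]` of the memoryless `k`-keys version age of node `j`. -/
noncomputable def timeAverageAge (k : ℕ) (j : Fin m) (t : ℝ) : ℝ :=
  (1 / t) * ∫ u in (0 : ℝ)..t, versionAge a₀ a K k j u.toNNReal

end SamplePath

/-- With probability `1`, the memoryless version age of `k`-keys of node `j`, which is the limit of
the time averages of its `k`-keys version age, exists and equals `x`. -/
def HasVersionAgeOfKeys {Ω : Type*} [MeasurableSpace Ω] {m : ℕ}
    (N₀ : ℝ≥0 → Ω → ℕ) (N : Edge m → ℝ≥0 → Ω → ℕ) (M : ℕ → Ω → Finset (Fin m))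
    (S : Finset (Fin m)) (μ : Measure Ω) (k : ℕ) (j : Fin m) (x : ℝ) : Prop :=
  ∀ᵐ ω ∂μ, Tendsto
    (timeAverageAge (fun t => N₀ t ω) (fun e t => N e t ω) (fun ℓ => S ∪ M ℓ ω) k j) atTop (𝓝 x)

/-- `B(n, m, i) = (n - i) / (m - 1)`. -/
noncomputable def coeffB (n m i : ℕ) : ℝ := ((n : ℝ) - i) / ((m : ℝ) - 1)

/-- `A(n, m, j) = ∏_{i = 1}^{j} lamE B(n, m, i) / (lamE B(n, m, i) + lamS)`. -/
noncomputable def coeffA (lamE lamS : ℝ) (n m j : ℕ) : ℝ :=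
  ∏ i ∈ Finset.Icc 1 j, lamE * coeffB n m i / (lamE * coeffB n m i + lamS)

end CodedGossip

open CodedGossip

/-! Keys of a version travel only while that version is current, so a version is decrypted before
the next update or never. Let `v` be the probability of missing a version. Just before an update the
age is the length of a run of independent misses, a geometric variable with mean `v / (1 - v)`;
Poisson updates see time averages, so this is the limit. A node with `r` keys races its `n - r`
useful edges against the source until it has `k + 1` keys, so its success probability is a product
of ratios of rates: `A(n, m, k)` from one key, `A(n + 1, m, k + 1)` from none. A node starts a
version with one key with probability `φ`, which makes `1 - v` a mixture of the two, and the sums in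
the numerators telescope to `1 - A`.

The rigorous argument is a martingale-type identity in discrete time. Cut time into steps of length
`1 / q`. While no step has two ticks, the chain driven by the increments follows the sample path
(`chain_eq_of_totalTicks_le_one`). Let `u r` be the probability of missing the current version from
`r` held keys. The potential `u |W| * y`, with `W` the held keys and `y` the age, has drift `π₀ * (v
- (1 - v) * y)`, whatever `W` is (`sum_gain_mul`, `potential_succ_sub`). Summing over the steps
yields the average of `y`, provided that the final potential and the accumulated noise are
negligible. The noise terms are orthogonal (`IsChainLaw.integral_noise_mul_noise`) and the age has
bounded second moments, because each unit of time resets it with a probability bounded below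
(`IsChainLaw.integral_chainAge_sq_window_le`).

For `T = (N + 1) ^ 2` and `q = (N + 1) ^ 4` the expected number of steps with two ticks is `O(T /
q)`, the variance of the noise divided by `T` is `O(1 / T)`, the second moment of the final age
divided by `T` is `O(1 / T ^ 2)`, and the Riemann sum error per unit of time is `O(1 / q)`. All are
summable in `N`, so all errors vanish almost surely (`ae_tendsto_zero_of_summable_integral`).
Monotonicity of the integral fills the gaps between squares (`tendsto_div_of_tendsto_sq`). -/

/-! ### Independence, almost sure convergence and orthogonality -/

section Probability

variable {Ω : Type*} [MeasurableSpace Ω] {μ : Measure Ω} [IsProbabilityMeasure μ]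

/-- The hypotheses make the joint law of the triple a product of three measures, and products can be
reassociated. -/
theorem indepFun_prodMk_right {α β γ : Type*} [MeasurableSpace α] [MeasurableSpace β]
    [MeasurableSpace γ] {X : Ω → α} {Y : Ω → β} {Z : Ω → γ} (hX : Measurable X)
    (hY : Measurable Y) (hZ : Measurable Z) (hXY : IndepFun X Y μ)
    (hXYZ : IndepFun (fun ω => (X ω, Y ω)) Z μ) :
    IndepFun X (fun ω => (Y ω, Z ω)) μ := by
  have : IsProbabilityMeasure (μ.map X) := Measure.isProbabilityMeasure_map hX.aemeasurable
  have : IsProbabilityMeasure (μ.map Y) := Measure.isProbabilityMeasure_map hY.aemeasurable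
  have : IsProbabilityMeasure (μ.map Z) := Measure.isProbabilityMeasure_map hZ.aemeasurable
  have hYZ : IndepFun Y Z μ := hXYZ.comp (φ := Prod.snd) (ψ := id) measurable_snd measurable_id
  have h1 := hXYZ.map_prod_eq_prod_map_map (hX.prodMk hY).aemeasurable hZ.aemeasurable
  rw [hXY.map_prod_eq_prod_map_map hX.aemeasurable hY.aemeasurable] at h1
  rw [indepFun_iff_map_prod_eq_prod_map_map hX.aemeasurable (hY.prodMk hZ).aemeasurable,
    hYZ.map_prod_eq_prod_map_map hY.aemeasurable hZ.aemeasurable,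
    ← Measure.prodAssoc_prod, ← h1,
    Measure.map_map MeasurableEquiv.prodAssoc.measurable ((hX.prodMk hY).prodMk hZ)]
  rfl

/-- A function of a finite part `S` of an independent family and of an independent variable `Z` is
uncorrelated with a function of a disjoint finite part `T` of the family. -/
theorem integral_mul_of_dependsOn {I 𝓧 𝓩 : Type*} [MeasurableSpace 𝓧] [MeasurableSpace 𝓩]
    [Nonempty 𝓧] {X : I → Ω → 𝓧} {Z : Ω → 𝓩} (hXm : ∀ i, Measurable (X i)) (hZm : Measurable Z)
    (hX : iIndepFun X μ) (hXZ : IndepFun (fun ω i => X i ω) Z μ) {S T : Finset I}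
    (hST : Disjoint S T) {Φ : (I → 𝓧) × 𝓩 → ℝ} (hΦm : Measurable Φ)
    (hΦ : ∀ z, DependsOn (fun x => Φ (x, z)) S) {Ψ : (I → 𝓧) → ℝ} (hΨm : Measurable Ψ)
    (hΨ : DependsOn Ψ T) :
    ∫ ω, Φ (fun i => X i ω, Z ω) * Ψ (fun i => X i ω) ∂μ =
      (∫ ω, Φ (fun i => X i ω, Z ω) ∂μ) * ∫ ω, Ψ (fun i => X i ω) ∂μ := by
  classical
  inhabit 𝓧
  -- Padding with a default value turns `Φ` and `Ψ` into measurable functions of the coordinates in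
  -- `S` and `T` alone; `DependsOn` makes the padding harmless.
  let ext (U : Finset I) (x : U → 𝓧) (i : I) : 𝓧 := if h : i ∈ U then x ⟨i, h⟩ else default
  have hext (U : Finset I) : Measurable (ext U) := by
    refine measurable_pi_iff.2 fun i => ?_
    by_cases h : i ∈ U
    · simpa [ext, h] using measurable_pi_apply _
    · simp [ext, h]
  have hXT (U : Finset I) : Measurable (fun ω (i : U) => X i ω) :=
    measurable_pi_iff.2 fun i => hXm i
  have hind : IndepFun (fun ω (i : T) => X i ω) (fun ω => (fun (i : S) => X i ω, Z ω)) μ := by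
    refine indepFun_prodMk_right (hXT T) (hXT S) hZm
      (hX.indepFun_finset T S hST.symm hXm) ?_
    exact hXZ.comp (φ := fun x => (fun (i : T) => x i, fun (i : S) => x i)) (ψ := id)
      (by fun_prop) measurable_id
  have hind2 := hind.comp (φ := fun x => Ψ (ext T x)) (ψ := fun p => Φ (ext S p.1, p.2))
    (hΨm.comp (hext T))
    (hΦm.comp (((hext S).comp measurable_fst).prodMk measurable_snd))
  have e1 : (fun x => Ψ (ext T x)) ∘ (fun ω (i : T) => X i ω) = fun ω => Ψ (fun i => X i ω) := by
    ext ω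
    exact hΨ fun i hi => by simp only [ext]; rw [dif_pos (by exact hi)]
  have e2 : (fun p : (S → 𝓧) × 𝓩 => Φ (ext S p.1, p.2)) ∘
      (fun ω => (fun (i : S) => X i ω, Z ω)) = fun ω => Φ (fun i => X i ω, Z ω) := by
    ext ω
    exact hΦ (Z ω) fun i hi => by simp only [ext]; rw [dif_pos (by exact hi)]
  rw [e1, e2] at hind2
  have hXa : Measurable (fun ω i => X i ω) := measurable_pi_iff.2 hXm
  exact hind2.symm.integral_fun_mul_eq_mul_integral
    (hΦm.comp (hXa.prodMk hZm)).aestronglyMeasurable (hΨm.comp hXa).aestronglyMeasurable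

omit [IsProbabilityMeasure μ] in
-- The sum of all `Z n` has finite expectation, hence is almost surely finite, hence its terms tend
-- to zero. Every almost sure statement about error terms goes through this.
theorem ae_tendsto_zero_of_summable_integral {Z : ℕ → Ω → ℝ} {c : ℕ → ℝ}
    (h0 : ∀ n ω, 0 ≤ Z n ω) (hint : ∀ n, Integrable (Z n) μ) (hc : Summable c)
    (hle : ∀ n, ∫ ω, Z n ω ∂μ ≤ c n) :
    ∀ᵐ ω ∂μ, Tendsto (fun n => Z n ω) atTop (𝓝 0) := by
  have hs : Summable fun n => ∫ ω, Z n ω ∂μ :=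
    Summable.of_nonneg_of_le (fun n => integral_nonneg (h0 n)) hle hc
  have h1 : ∑' n, ∫⁻ ω, ENNReal.ofReal (Z n ω) ∂μ ≠ ⊤ := by
    have : ∀ n, ∫⁻ ω, ENNReal.ofReal (Z n ω) ∂μ = ENNReal.ofReal (∫ ω, Z n ω ∂μ) := fun n =>
      (ofReal_integral_eq_lintegral_ofReal (hint n) (ae_of_all _ (h0 n))).symm
    simp_rw [this]
    exact hs.tsum_ofReal_ne_top
  rw [← lintegral_tsum fun n => (hint n).aemeasurable.ennreal_ofReal] at h1
  filter_upwards [ae_lt_top' (AEMeasurable.tsum fun n =>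
    (hint n).aemeasurable.ennreal_ofReal) h1] with ω hω
  have h2 := ENNReal.tendsto_atTop_zero_of_tsum_ne_top hω.ne
  have h3 := (ENNReal.tendsto_toReal ENNReal.zero_ne_top).comp h2
  refine (h3.congr fun n => ?_)
  simp [ENNReal.toReal_ofReal (h0 n ω)]

omit [IsProbabilityMeasure μ] in
theorem integral_sum_sq_eq_of_orthogonal {D : ℕ → Ω → ℝ} (n : ℕ)
    (hint : ∀ i j, Integrable (fun ω => D i ω * D j ω) μ)
    (horth : ∀ i j, i < j → j < n → ∫ ω, D i ω * D j ω ∂μ = 0) :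
    ∫ ω, (∑ i ∈ Finset.range n, D i ω) ^ 2 ∂μ = ∑ i ∈ Finset.range n, ∫ ω, D i ω ^ 2 ∂μ := by
  simp_rw [sq, Finset.sum_mul_sum]
  rw [integral_finsetSum _ fun i _ => integrable_finsetSum _ fun j _ => hint i j]
  refine Finset.sum_congr rfl fun i hi => ?_
  rw [integral_finsetSum _ fun j _ => hint i j, Finset.sum_eq_single i]
  · intro j hj hji
    rw [Finset.mem_range] at hi hj
    rcases lt_or_gt_of_ne hji with h | h
    · simp_rw [mul_comm (D i _)]
      exact horth j i h hi
    · exact horth i j h hj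
  · intro h; exact absurd hi h

end Probability

/-! ### The discrete chain seen by one node -/

section Chain

variable {m : ℕ} {j : Fin m}

/-- The counters that matter for node `j`: the source (`none`) and the edges from the other nodes
into `j`. -/
abbrev Incoming (j : Fin m) : Type := Option {a : Fin m // a ≠ j}

/-- The indicator of a positive number of ticks. -/
def tick (x : ℕ) : ℕ := if 0 < x then 1 else 0

/-- The nodes of `A` whose edge into `j` ticks, where `x` collects the numbers of ticks. -/
def newKeys (x : Incoming j → ℕ) (A : Finset (Fin m)) : Finset (Fin m) :=
  {a ∈ A | ∃ h : a ≠ j, 0 < x (some ⟨a, h⟩)}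

/-- The state of node `j`: the current version, the nodes whose keys of this version are held by
`j`, and the version age. -/
abbrev ChainState (m : ℕ) : Type := ℕ × Finset (Fin m) × ℕ

/-- One step of the discrete chain, where `x` collects the numbers of ticks in this step. -/
def chainStep (k : ℕ) (s : ChainState m) (x : Incoming j → ℕ) (κ : ℕ → Finset (Fin m)) :
    ChainState m :=
  -- An update wins over edge ticks in the same step and several updates count as one. This is an
  -- arbitrary convention: the chain is compared with the sample path only while every step has at
  -- most one tick.
  let W := if 0 < x none then κ (s.1 + 1) ∩ {j} else s.2.1 ∪ newKeys x (κ s.1)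
  (s.1 + tick (x none), W, if k + 1 ≤ W.card then 0 else s.2.2 + tick (x none))

/-- The discrete chain; `e (c, i)` is the number of ticks of the counter `c` in step `i`. -/
def chain (k : ℕ) (e : Incoming j × ℕ → ℕ) (κ : ℕ → Finset (Fin m)) : ℕ → ChainState m
  | 0 => (0, κ 0 ∩ {j}, 0)
  | i + 1 => chainStep k (chain k e κ i) (fun c => e (c, i)) κ

variable {k : ℕ} {e : Incoming j × ℕ → ℕ} {κ : ℕ → Finset (Fin m)}

theorem tick_le_one (x : ℕ) : tick x ≤ 1 := by unfold tick; split_ifs <;> simp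

@[simp] theorem tick_zero : tick 0 = 0 := rfl

theorem tick_pos {x : ℕ} (h : 0 < x) : tick x = 1 := by simp [tick, h]

theorem chain_version_succ (i : ℕ) :
    (chain k e κ (i + 1)).1 = (chain k e κ i).1 + tick (e (none, i)) := rfl

theorem chain_held_succ (i : ℕ) :
    (chain k e κ (i + 1)).2.1 = if 0 < e (none, i) then κ ((chain k e κ i).1 + 1) ∩ {j}
      else (chain k e κ i).2.1 ∪ newKeys (fun c => e (c, i)) (κ (chain k e κ i).1) := rfl

theorem chain_age_succ (i : ℕ) :
    (chain k e κ (i + 1)).2.2 = if k + 1 ≤ (chain k e κ (i + 1)).2.1.card then 0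
      else (chain k e κ i).2.2 + tick (e (none, i)) := rfl

theorem chain_version_le (i : ℕ) : (chain k e κ i).1 ≤ i := by
  induction i with
  | zero => simp [chain]
  | succ i ih => rw [chain_version_succ]; have := tick_le_one (e (none, i)); omega

theorem chain_version_mono : Monotone fun i => (chain k e κ i).1 :=
  monotone_nat_of_le_succ fun i => by rw [chain_version_succ]; omega

theorem chain_age_succ_le (i : ℕ) :
    (chain k e κ (i + 1)).2.2 ≤ (chain k e κ i).2.2 + tick (e (none, i)) := by
  rw [chain_age_succ]; split_ifs <;> omega

theorem chain_age_add_le (i l : ℕ) : (chain k e κ (i + l)).2.2 ≤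
    (chain k e κ i).2.2 + ∑ r ∈ Finset.range l, tick (e (none, i + r)) := by
  induction l with
  | zero => simp
  | succ l ih =>
    rw [Finset.sum_range_succ, ← add_assoc i l 1]
    have := chain_age_succ_le (k := k) (e := e) (κ := κ) (i + l)
    omega

theorem chain_age_le (i : ℕ) : (chain k e κ i).2.2 ≤ i := by
  induction i with
  | zero => simp [chain]
  | succ i ih =>
    have := chain_age_succ_le (k := k) (e := e) (κ := κ) i
    have := tick_le_one (e (none, i))
    omega

theorem chain_age_eq_zero_of_le_card (i : ℕ) (h : k + 1 ≤ (chain k e κ i).2.1.card) :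
    (chain k e κ i).2.2 = 0 := by
  cases i with
  | zero => rfl
  | succ i => rw [chain_age_succ, if_pos h]

theorem chain_held_subset (i : ℕ) : (chain k e κ i).2.1 ⊆ κ (chain k e κ i).1 := by
  induction i with
  | zero => exact Finset.inter_subset_left
  | succ i ih =>
    rw [chain_held_succ, chain_version_succ]
    split_ifs with h
    · rw [tick_pos h]; exact Finset.inter_subset_left
    · rw [Nat.eq_zero_of_not_pos h]
      exact Finset.union_subset ih (Finset.filter_subset _ _)

theorem mem_chain_held (i : ℕ) (h : j ∈ κ (chain k e κ i).1) : j ∈ (chain k e κ i).2.1 := by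
  induction i with
  | zero => simpa [chain] using h
  | succ i ih =>
    rw [chain_held_succ]
    rw [chain_version_succ] at h
    split_ifs with h0
    · rw [tick_pos h0] at h; simpa using h
    · rw [Nat.eq_zero_of_not_pos h0] at h
      exact Finset.mem_union_left _ (ih h)

/-- If the source does not tick during the steps `i, …, i + l - 1`, the version does not change and
all keys sent to `j` meanwhile are kept. -/
theorem chain_version_held_of_no_update (i l : ℕ) (h : ∀ r < l, e (none, i + r) = 0) :
    (chain k e κ (i + l)).1 = (chain k e κ i).1 ∧
      (∀ a ∈ κ (chain k e κ i).1, ∀ (ha : a ≠ j) (r : ℕ), r < l →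
        0 < e (some ⟨a, ha⟩, i + r) → a ∈ (chain k e κ (i + l)).2.1) ∧
      (j ∈ κ (chain k e κ i).1 → j ∈ (chain k e κ (i + l)).2.1) := by
  induction l with
  | zero => exact ⟨rfl, by simp, fun h => mem_chain_held i h⟩
  | succ l ih =>
    obtain ⟨h1, h2, h3⟩ := ih fun r hr => h r (by omega)
    have h0 := h l (by omega)
    have hv : (chain k e κ (i + (l + 1))).1 = (chain k e κ i).1 := by
      rw [← add_assoc, chain_version_succ, h0, h1]; rfl
    refine ⟨hv, fun a ha haj r hr hpos => ?_, fun hj => ?_⟩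
    · rw [← add_assoc, chain_held_succ, h0, if_neg (lt_irrefl 0), Finset.mem_union]
      rcases Nat.lt_succ_iff_lt_or_eq.1 hr with hr | rfl
      · exact Or.inl (h2 a ha haj r hr hpos)
      · right
        rw [newKeys, Finset.mem_filter, h1]
        exact ⟨ha, haj, hpos⟩
    · exact mem_chain_held _ (by rw [hv]; exact hj)

/-- If the source does not tick while all the incoming edges do, the age becomes `0`. -/
theorem chain_age_eq_zero_of_all_tick (i l : ℕ) (h0 : ∀ r < l, e (none, i + r) = 0)
    (ha : ∀ a : {a : Fin m // a ≠ j}, ∃ r < l, 0 < e (some a, i + r))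
    (hκ : k + 1 ≤ (κ (chain k e κ i).1).card) : (chain k e κ (i + l)).2.2 = 0 := by
  obtain ⟨-, h2, h3⟩ := chain_version_held_of_no_update (k := k) (κ := κ) i l h0
  refine chain_age_eq_zero_of_le_card _ (hκ.trans (Finset.card_le_card fun a haκ => ?_))
  by_cases haj : a = j
  · subst haj; exact h3 haκ
  · obtain ⟨r, hr, hpos⟩ := ha ⟨a, haj⟩
    exact h2 a haκ haj r hr hpos

/-- The steps before step `i`. -/
def stepsBefore (j : Fin m) (i : ℕ) : Finset (Incoming j × ℕ) := Finset.univ ×ˢ Finset.range i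

theorem mem_stepsBefore {i : ℕ} {p : Incoming j × ℕ} : p ∈ stepsBefore j i ↔ p.2 < i := by
  simp [stepsBefore]

/-- Adaptedness to the ticks: this is what makes the state before step `i` independent of the ticks
in step `i`. -/
theorem dependsOn_chain (k : ℕ) (κ : ℕ → Finset (Fin m)) (i : ℕ) :
    DependsOn (fun e : Incoming j × ℕ → ℕ => chain k e κ i) (stepsBefore j i) := by
  induction i with
  | zero => intro e e' _; rfl
  | succ i ih =>
    intro e e' h
    have h1 : chain k e κ i = chain k e' κ i := ih fun p hp =>
      h p (by rw [Finset.mem_coe, mem_stepsBefore] at hp ⊢; omega)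
    have h2 : (fun c => e (c, i)) = fun c => e' (c, i) := funext fun c =>
      h (c, i) (by rw [Finset.mem_coe, mem_stepsBefore]; simp)
    simp only [chain, h1, h2]

/-- Adaptedness to the selections: only versions already generated have been looked at, so the next
selection is still fresh. -/
theorem chain_congr_selection {κ' : ℕ → Finset (Fin m)} (i : ℕ)
    (h : ∀ l ≤ (chain k e κ i).1, κ l = κ' l) : chain k e κ i = chain k e κ' i := by
  induction i with
  | zero => simp only [chain, h 0 (Nat.zero_le _)]
  | succ i ih =>
    have hi : chain k e κ i = chain k e κ' i := ih fun l hl =>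
      h l (hl.trans (chain_version_mono (Nat.le_succ i)))
    have h1 : κ (chain k e κ i).1 = κ' (chain k e κ i).1 :=
      h _ (chain_version_mono (Nat.le_succ i))
    simp only [chain, chainStep, ← hi, h1]
    by_cases h0 : 0 < e (none, i)
    · rw [h ((chain k e κ i).1 + 1) (by rw [chain_version_succ, tick_pos h0])]
    · simp only [if_neg h0]

/-- The version only counts steps with a source tick. Hence fixing its value puts no condition on
the selections. -/
theorem chain_version_congr (κ' : ℕ → Finset (Fin m)) (i : ℕ) :
    (chain k e κ i).1 = (chain k e κ' i).1 := by
  induction i with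
  | zero => rfl
  | succ i ih => rw [chain_version_succ, chain_version_succ, ih]

instance : DiscreteMeasurableSpace (Finset (Fin m)) := ⟨fun _ => trivial⟩

theorem measurable_chain (k i : ℕ) :
    Measurable fun p : (Incoming j × ℕ → ℕ) × (ℕ → Finset (Fin m)) => chain k p.1 p.2 i := by
  induction i with
  | zero =>
    exact (measurable_from_top
      (f := fun A : Finset (Fin m) => ((0, A ∩ {j}, 0) : ChainState m))).comp
      ((measurable_pi_apply 0).comp measurable_snd)
  | succ i ih =>
    have h : Measurable fun q : (ChainState m × (Incoming j → ℕ)) × (ℕ → Finset (Fin m)) =>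
        chainStep k q.1.1 q.1.2 q.2 := by
      -- The step reads `κ` at an index that depends on the state. States and tick vectors form a
      -- countable type, so both may be frozen, leaving a function of two fixed coordinates of `κ`.
      refine measurable_from_prod_countable_right fun q => ?_
      let g (A : Finset (Fin m) × Finset (Fin m)) : ChainState m :=
        let W := if 0 < q.2 none then A.2 ∩ {j} else q.1.2.1 ∪ newKeys q.2 A.1
        (q.1.1 + tick (q.2 none), W, if k + 1 ≤ W.card then 0 else q.1.2.2 + tick (q.2 none))
      have hA : Measurable fun κ : ℕ → Finset (Fin m) => (κ q.1.1, κ (q.1.1 + 1)) :=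
        (measurable_pi_apply q.1.1).prodMk (measurable_pi_apply (q.1.1 + 1))
      exact (Measurable.of_discrete (f := g)).comp hA
    exact h.comp ((ih.prodMk (measurable_pi_iff.2 fun c =>
      (measurable_pi_apply (c, i)).comp measurable_fst)).prodMk measurable_snd)

end Chain

/-! ### Sample paths: the chain follows the network -/

section Path

/-- A sample path of a counter: it starts at `0`, is monotone and right-continuous. -/
structure IsCounterPath (c : ℝ≥0 → ℕ) : Prop where
  zero : c 0 = 0
  mono : Monotone c
  rightCts : ∀ t, ContinuousWithinAt c (Set.Ici t) t

/-- The tick sits at the first time the path reaches the level `c t`. Right-continuity of an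
integer-valued path makes it constant just after this infimum, so the level is attained there. -/
theorem IsCounterPath.exists_ticksAt {c : ℝ≥0 → ℕ} (hc : IsCounterPath c) {s t : ℝ≥0}
    (h : c s < c t) : ∃ v, s < v ∧ v ≤ t ∧ TicksAt c v := by
  set B : Set ℝ≥0 := {w | c t ≤ c w} with hB
  have htB : t ∈ B := le_refl (c t)
  have hv : c t ≤ c (sInf B) := by
    have h1 : ∀ᶠ w in 𝓝[≥] sInf B, c w = c (sInf B) :=
      (hc.rightCts (sInf B)).eventually (p := fun x => x = c (sInf B)) (by simp [nhds_discrete])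
    rw [eventually_nhdsWithin_iff] at h1
    obtain ⟨ε, hε, h2⟩ := Metric.eventually_nhds_iff.1 h1
    obtain ⟨w, hwB, hw⟩ := exists_lt_of_csInf_lt ⟨t, htB⟩
      (lt_add_of_pos_right (sInf B) (Real.toNNReal_pos.2 hε))
    have hle : sInf B ≤ w := csInf_le (OrderBot.bddBelow _) hwB
    rw [← h2 (y := w) ?_ hle]
    · exact hwB
    · rw [NNReal.dist_eq, abs_of_nonneg (sub_nonneg.2 (NNReal.coe_le_coe.2 hle))]
      have := NNReal.coe_lt_coe.2 hw
      rw [NNReal.coe_add, Real.coe_toNNReal _ hε.le] at this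
      linarith
  have hsv : s < sInf B := by
    by_contra! hle
    have := hc.mono hle
    omega
  refine ⟨sInf B, hsv, csInf_le (OrderBot.bddBelow _) htB, lt_of_le_of_lt bot_le hsv,
    fun u hu => ?_⟩
  by_contra! hle
  exact absurd (csInf_le (OrderBot.bddBelow _) (show u ∈ B from hv.trans hle)) (not_le.2 hu)

theorem not_ticksAt_of_eq {c : ℝ≥0 → ℕ} (hc : Monotone c) {s t v : ℝ≥0} (h : c s = c t)
    (hs : s < v) (ht : v ≤ t) : ¬ TicksAt c v := fun hv => by
  have h1 := hv.2 s hs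
  have h2 := hc ht
  omega

variable {m : ℕ} {a₀ : ℝ≥0 → ℕ} {a : Edge m → ℝ≥0 → ℕ} {K : ℕ → Finset (Fin m)} {k : ℕ} {j : Fin m}

/-- The source counter and the counters of the edges into `j`. -/
def incomingCounter {α : Type*} (a₀ : α) (a : Edge m → α) (j : Fin m) (c : Incoming j) : α :=
  c.elim a₀ fun b => a ⟨(b.1, j), b.2⟩

theorem hasKey_mono {ℓ : ℕ} {s t : ℝ≥0} (ha₀ : Monotone a₀) (hst : s ≤ t) {i : Fin m}
    (h : HasKey a₀ a K j ℓ s i) : HasKey a₀ a K j ℓ t i := by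
  refine ⟨h.1, h.2.imp (fun h => ⟨h.1, h.2.trans (ha₀ hst)⟩) ?_⟩
  rintro ⟨hij, v, hv, h2⟩
  exact ⟨hij, v, hv.trans hst, h2⟩

theorem hasDecrypted_mono {ℓ : ℕ} {s t : ℝ≥0} (ha₀ : Monotone a₀) (hst : s ≤ t)
    (h : HasDecrypted a₀ a K k j ℓ s) : HasDecrypted a₀ a K k j ℓ t :=
  h.trans (Set.ncard_le_ncard (fun _ hi => hasKey_mono ha₀ hst hi) (Set.toFinite _))

/-- Only edge ticks while `ℓ` is current can deliver its keys, so later ticks need not be excluded.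
-/
theorem hasKey_iff_of_no_tick {ℓ : ℕ} {s t : ℝ≥0} (ha₀ : Monotone a₀) (hst : s ≤ t)
    (hℓ : ℓ ≤ a₀ s) (h : ∀ b (hb : b ≠ j) v, s < v → v ≤ t → a₀ v = ℓ →
      ¬ TicksAt (a ⟨(b, j), hb⟩) v) (i : Fin m) :
    HasKey a₀ a K j ℓ t i ↔ HasKey a₀ a K j ℓ s i := by
  refine ⟨fun hi => ⟨hi.1, hi.2.imp (fun h => ⟨h.1, hℓ⟩) ?_⟩, hasKey_mono ha₀ hst⟩
  rintro ⟨hij, v, hv, h1, h2⟩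
  refine ⟨hij, v, ?_, h1, h2⟩
  by_contra! hsv
  exact h i hij v hsv hv h2 h1

theorem hasDecrypted_iff_of_no_tick {ℓ : ℕ} {s t : ℝ≥0} (ha₀ : Monotone a₀) (hst : s ≤ t)
    (hℓ : ℓ ≤ a₀ s) (h : ∀ b (hb : b ≠ j) v, s < v → v ≤ t → a₀ v = ℓ →
      ¬ TicksAt (a ⟨(b, j), hb⟩) v) :
    HasDecrypted a₀ a K k j ℓ t ↔ HasDecrypted a₀ a K k j ℓ s := by
  unfold HasDecrypted
  simp_rw [hasKey_iff_of_no_tick ha₀ hst hℓ h]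

theorem bddAbove_decrypted (t : ℝ≥0) :
    BddAbove {ℓ | ℓ ≤ a₀ t ∧ (ℓ = 0 ∨ HasDecrypted a₀ a K k j ℓ t)} := ⟨a₀ t, fun _ h => h.1⟩

theorem latestVersion_le (t : ℝ≥0) : latestVersion a₀ a K k j t ≤ a₀ t :=
  csSup_le ⟨0, Nat.zero_le _, Or.inl rfl⟩ fun _ h => h.1

theorem latestVersion_mono (ha₀ : Monotone a₀) : Monotone (latestVersion a₀ a K k j) :=
  fun _ t hst => csSup_le_csSup (bddAbove_decrypted t) ⟨0, Nat.zero_le _, Or.inl rfl⟩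
    fun _ h => ⟨h.1.trans (ha₀ hst), h.2.imp_right (hasDecrypted_mono ha₀ hst)⟩

theorem latestVersion_of_hasDecrypted {t : ℝ≥0} (h : HasDecrypted a₀ a K k j (a₀ t) t) :
    latestVersion a₀ a K k j t = a₀ t :=
  le_antisymm (latestVersion_le t) (le_csSup (bddAbove_decrypted t) ⟨le_rfl, Or.inr h⟩)

/-- The total number of ticks over `(s, t]` of the counters that matter for node `j`. -/
def totalTicks (a₀ : ℝ≥0 → ℕ) (a : Edge m → ℝ≥0 → ℕ) (j : Fin m) (s t : ℝ≥0) : ℕ :=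
  ∑ c : Incoming j, (incomingCounter a₀ a j c t - incomingCounter a₀ a j c s)

theorem le_totalTicks (c : Incoming j) (s t : ℝ≥0) :
    incomingCounter a₀ a j c t - incomingCounter a₀ a j c s ≤ totalTicks a₀ a j s t :=
  Finset.single_le_sum (f := fun c => incomingCounter a₀ a j c t - incomingCounter a₀ a j c s)
    (fun _ _ => Nat.zero_le _) (Finset.mem_univ c)

theorem add_le_totalTicks {c c' : Incoming j} (hc : c ≠ c') (s t : ℝ≥0) :
    (incomingCounter a₀ a j c t - incomingCounter a₀ a j c s) +
      (incomingCounter a₀ a j c' t - incomingCounter a₀ a j c' s) ≤ totalTicks a₀ a j s t := by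
  rw [← Finset.sum_pair (f := fun c => incomingCounter a₀ a j c t - incomingCounter a₀ a j c s) hc]
  exact Finset.sum_le_sum_of_subset (Finset.subset_univ _)

variable (hC : ∀ c, IsCounterPath (incomingCounter a₀ a j c))
include hC

theorem not_ticksAt_edge_of_eq {b : Fin m} (hb : b ≠ j) {s t v : ℝ≥0}
    (h : incomingCounter a₀ a j (some ⟨b, hb⟩) t - incomingCounter a₀ a j (some ⟨b, hb⟩) s = 0)
    (hs : s < v) (ht : v ≤ t) : ¬ TicksAt (a ⟨(b, j), hb⟩) v :=
  not_ticksAt_of_eq (hC (some ⟨b, hb⟩)).mono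
    (le_antisymm ((hC (some ⟨b, hb⟩)).mono (hs.le.trans ht)) (Nat.sub_eq_zero_iff_le.1 h)) hs ht

theorem latestVersion_of_totalTicks_eq_zero {s t : ℝ≥0} (hst : s ≤ t)
    (h : totalTicks a₀ a j s t = 0) :
    a₀ t = a₀ s ∧ latestVersion a₀ a K k j t = latestVersion a₀ a K k j s := by
  have ha₀ : Monotone a₀ := (hC none).mono
  have h0 (c : Incoming j) := Nat.le_zero.1 (h ▸ le_totalTicks (a₀ := a₀) (a := a) c s t)
  have h1 : a₀ t = a₀ s := le_antisymm (Nat.sub_eq_zero_iff_le.1 (h0 none)) (ha₀ hst)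
  refine ⟨h1, ?_⟩
  unfold latestVersion
  congr 1
  ext ℓ
  rw [Set.mem_ofPred_eq, Set.mem_ofPred_eq, h1]
  refine and_congr_right fun hℓ => or_congr_right (hasDecrypted_iff_of_no_tick ha₀ hst hℓ ?_)
  exact fun b hb v hsv hvt _ => not_ticksAt_edge_of_eq hC hb (h0 _) hsv hvt

/-- A superseded version could only be newly decrypted if an edge ticked while it was current and
the source ticked afterwards. Those would be two ticks in one step. -/
theorem latestVersion_of_totalTicks_le_one {s t : ℝ≥0} (hst : s ≤ t)
    (h : totalTicks a₀ a j s t ≤ 1) (hdec : ¬ HasDecrypted a₀ a K k j (a₀ t) t) :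
    latestVersion a₀ a K k j t = latestVersion a₀ a K k j s := by
  have ha₀ : Monotone a₀ := (hC none).mono
  have hn : a₀ t - a₀ s ≤ 1 := (le_totalTicks none s t).trans h
  unfold latestVersion
  congr 1
  ext ℓ
  refine ⟨fun hℓ => ?_, fun hℓ => ⟨hℓ.1.trans (ha₀ hst),
    hℓ.2.imp_right (hasDecrypted_mono ha₀ hst)⟩⟩
  rcases hℓ with ⟨hℓ, rfl | hd⟩
  · exact ⟨Nat.zero_le _, Or.inl rfl⟩
  have hlt : ℓ < a₀ t := lt_of_le_of_ne hℓ fun h => hdec (h ▸ hd)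
  have hle : ℓ ≤ a₀ s := by omega
  refine ⟨hle, Or.inr ((hasDecrypted_iff_of_no_tick ha₀ hst hle ?_).1 hd)⟩
  intro b hb v hsv hvt hv
  refine not_ticksAt_edge_of_eq hC hb ?_ hsv hvt
  have h2 : (a₀ t - a₀ s) + _ ≤ _ := add_le_totalTicks (a₀ := a₀) (a := a)
    (c := none) (c' := some ⟨b, hb⟩) (by simp) s t
  have := ha₀ hsv.le
  omega

/-- The update uses up the only tick of the step, so no edge has yet delivered a key of the new
version; only the node's own key from the source remains. -/
theorem hasKey_iff_of_update {s t : ℝ≥0} (h : totalTicks a₀ a j s t ≤ 1)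
    (h0 : a₀ s < a₀ t) (i : Fin m) :
    HasKey a₀ a K j (a₀ t) t i ↔ i ∈ K (a₀ t) ∩ {j} := by
  have ha₀ : Monotone a₀ := (hC none).mono
  rw [Finset.mem_inter, Finset.mem_singleton]
  refine and_congr_right fun _ => ⟨?_, fun h => Or.inl ⟨h, le_rfl⟩⟩
  rintro (⟨h, -⟩ | ⟨hij, v, hv, h1, h2⟩)
  · exact h
  · have hsv : s < v := by
      by_contra! hle
      have := ha₀ hle
      omega
    have h3 : (a₀ t - a₀ s) + _ ≤ _ := add_le_totalTicks (a₀ := a₀) (a := a)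
      (c := none) (c' := some ⟨i, hij⟩) (by simp) s t
    exact absurd h1 (not_ticksAt_edge_of_eq hC hij (by omega) hsv hv)

/-- The same version is current throughout, so every edge tick of the step delivers a current key,
and any number of edge ticks is allowed. -/
theorem hasKey_iff_of_no_update {s t : ℝ≥0} (hst : s ≤ t) (h0 : a₀ t = a₀ s) (i : Fin m) :
    HasKey a₀ a K j (a₀ t) t i ↔ HasKey a₀ a K j (a₀ s) s i ∨
      i ∈ newKeys (fun c : Incoming j => incomingCounter a₀ a j c t - incomingCounter a₀ a j c s)
        (K (a₀ s)) := by
  have ha₀ : Monotone a₀ := (hC none).mono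
  rw [newKeys, Finset.mem_filter, h0]
  constructor
  · rintro ⟨hi, ⟨h, -⟩ | ⟨hij, v, hv, h1, h2⟩⟩
    · exact Or.inl ⟨hi, Or.inl ⟨h, le_rfl⟩⟩
    · rcases le_or_gt v s with hvs | hsv
      · exact Or.inl ⟨hi, Or.inr ⟨hij, v, hvs, h1, h2⟩⟩
      · refine Or.inr ⟨hi, hij, ?_⟩
        by_contra hle
        exact not_ticksAt_edge_of_eq hC hij (Nat.eq_zero_of_not_pos hle) hsv hv h1
  · rintro (h | ⟨hi, hij, hpos⟩)
    · exact hasKey_mono ha₀ hst h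
    · obtain ⟨v, hsv, hvt, hv⟩ := (hC (some ⟨i, hij⟩)).exists_ticksAt
        (Nat.lt_of_sub_pos hpos)
      refine ⟨hi, Or.inr ⟨hij, v, hvt, hv, le_antisymm (h0 ▸ ha₀ hvt) (ha₀ hsv.le)⟩⟩

/-- As long as there is at most one tick per step, the discrete chain driven by the increments of
the counters follows the sample path. -/
theorem chain_eq_of_totalTicks_le_one {t : ℕ → ℝ≥0} (ht : Monotone t) (ht0 : t 0 = 0) {n : ℕ}
    (h1 : ∀ i < n, totalTicks a₀ a j (t i) (t (i + 1)) ≤ 1) {i : ℕ} (hi : i ≤ n) :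
    let s := chain k (fun p : Incoming j × ℕ => incomingCounter a₀ a j p.1 (t (p.2 + 1)) -
      incomingCounter a₀ a j p.1 (t p.2)) K i
    s.1 = a₀ (t i) ∧ (∀ b, HasKey a₀ a K j (a₀ (t i)) (t i) b ↔ b ∈ s.2.1) ∧
      s.2.2 + latestVersion a₀ a K k j (t i) = a₀ (t i) := by
  have ha₀ : Monotone a₀ := (hC none).mono
  induction i with
  | zero =>
    have h0 : a₀ (t 0) = 0 := by rw [ht0]; exact (hC none).zero
    have hL := latestVersion_le (a₀ := a₀) (a := a) (K := K) (k := k) (j := j) (t 0)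
    refine ⟨h0.symm, fun b => ?_, ?_⟩
    · rw [h0]
      simp only [chain, Finset.mem_inter, Finset.mem_singleton]
      refine and_congr_right fun _ => ⟨?_, fun h => Or.inl ⟨h, Nat.zero_le _⟩⟩
      rintro (⟨h, -⟩ | ⟨_, v, hv, h1, -⟩)
      · exact h
      · rw [ht0] at hv
        exact absurd h1.1 (not_lt.2 hv)
    · simp only [chain]; omega
  | succ i ih =>
    obtain ⟨hv, hW, hy⟩ := ih (by omega)
    have hT := h1 i (by omega)
    have hmono : t i ≤ t (i + 1) := ht (Nat.le_succ i)
    have hn : a₀ (t (i + 1)) - a₀ (t i) ≤ 1 := (le_totalTicks none (t i) (t (i + 1))).trans hT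
    have hle : a₀ (t i) ≤ a₀ (t (i + 1)) := ha₀ hmono
    have hv' : (chain k (fun p : Incoming j × ℕ => incomingCounter a₀ a j p.1 (t (p.2 + 1)) -
        incomingCounter a₀ a j p.1 (t p.2)) K i).1 + tick (a₀ (t (i + 1)) - a₀ (t i)) =
        a₀ (t (i + 1)) := by
      rw [hv]; unfold tick; split_ifs <;> omega
    have hW' : ∀ b, HasKey a₀ a K j (a₀ (t (i + 1))) (t (i + 1)) b ↔
        b ∈ (chain k (fun p : Incoming j × ℕ => incomingCounter a₀ a j p.1 (t (p.2 + 1)) -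
          incomingCounter a₀ a j p.1 (t p.2)) K (i + 1)).2.1 := by
      intro b
      rw [chain_held_succ]
      have he : incomingCounter a₀ a j none (t (i + 1)) - incomingCounter a₀ a j none (t i) =
        a₀ (t (i + 1)) - a₀ (t i) := rfl
      dsimp only
      rw [he]
      split_ifs with h0
      · rw [hasKey_iff_of_update hC hT (by omega), hv,
          show a₀ (t i) + 1 = a₀ (t (i + 1)) by omega]
      · rw [hasKey_iff_of_no_update hC hmono (by omega), hv, Finset.mem_union, hW]
    refine ⟨hv', hW', ?_⟩
    have hdec : HasDecrypted a₀ a K k j (a₀ (t (i + 1))) (t (i + 1)) ↔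
        k + 1 ≤ (chain k (fun p : Incoming j × ℕ => incomingCounter a₀ a j p.1 (t (p.2 + 1)) -
          incomingCounter a₀ a j p.1 (t p.2)) K (i + 1)).2.1.card := by
      unfold HasDecrypted
      simp_rw [hW']
      rw [← Set.ncard_coe_finset]
      rfl
    rw [chain_age_succ]
    split_ifs with hd
    · rw [latestVersion_of_hasDecrypted (hdec.2 hd), zero_add]
    · rw [latestVersion_of_totalTicks_le_one hC hmono hT (fun h => hd (hdec.1 h))]
      rw [hv] at hv'
      change _ + tick (a₀ (t (i + 1)) - a₀ (t i)) + _ = _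
      omega

/-- Without ticks the age is constant. Otherwise it rises by at most the number of source ticks and
falls by at most its own value, and the bound covers both because the number of ticks is at least
one. -/
theorem abs_versionAge_sub_le {s t : ℝ≥0} (hst : s ≤ t) :
    |versionAge a₀ a K k j t - versionAge a₀ a K k j s| ≤
      totalTicks a₀ a j s t * (versionAge a₀ a K k j s + 1) := by
  have ha₀ : Monotone a₀ := (hC none).mono
  rcases Nat.eq_zero_or_pos (totalTicks a₀ a j s t) with h0 | hpos
  · obtain ⟨h1, h2⟩ := latestVersion_of_totalTicks_eq_zero (K := K) (k := k) hC hst h0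
    simp [versionAge, h1, h2, h0]
  · have hL := latestVersion_mono (a := a) (K := K) (k := k) (j := j) ha₀ hst
    have hs := latestVersion_le (a₀ := a₀) (a := a) (K := K) (k := k) (j := j) s
    have ht := latestVersion_le (a₀ := a₀) (a := a) (K := K) (k := k) (j := j) t
    have hn : a₀ t - a₀ s ≤ _ := le_totalTicks (a₀ := a₀) (a := a) (j := j) none s t
    have hn' : a₀ t ≤ a₀ s + totalTicks a₀ a j s t := by omega
    have hpos' : (1 : ℝ) ≤ totalTicks a₀ a j s t := by exact_mod_cast hpos
    have hn2 : (a₀ t : ℝ) ≤ a₀ s + totalTicks a₀ a j s t := by exact_mod_cast hn'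
    rify at hL hs ht
    unfold versionAge
    rw [abs_le]
    constructor <;> nlinarith

theorem intervalIntegrable_versionAge (x y : ℝ) :
    IntervalIntegrable (fun u : ℝ => versionAge a₀ a K k j u.toNNReal) volume x y := by
  have ha₀ : Monotone a₀ := (hC none).mono
  have h1 : Monotone fun u : ℝ => (a₀ u.toNNReal : ℝ) := fun u v huv =>
    Nat.cast_le.2 (ha₀ (Real.toNNReal_mono huv))
  have h2 : Monotone fun u : ℝ => (latestVersion a₀ a K k j u.toNNReal : ℝ) := fun u v huv =>
    Nat.cast_le.2 (latestVersion_mono ha₀ (Real.toNNReal_mono huv))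
  exact h1.intervalIntegrable.sub h2.intervalIntegrable

omit hC in
theorem versionAge_nonneg (t : ℝ≥0) : 0 ≤ versionAge a₀ a K k j t :=
  sub_nonneg.2 (Nat.cast_le.2 (latestVersion_le t))

/-- The integral of the age over `[0, n / q]` compared with its Riemann sum, as long as there is at
most one tick per step. -/
theorem abs_integral_versionAge_sub_le {q : ℕ} (hq : 0 < q) {n : ℕ}
    (h1 : ∀ i < n, totalTicks a₀ a j ((i : ℝ≥0) / q) (((i + 1 : ℕ) : ℝ≥0) / q) ≤ 1) :
    let e := fun p : Incoming j × ℕ => incomingCounter a₀ a j p.1 (((p.2 + 1 : ℕ) : ℝ≥0) / q) -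
      incomingCounter a₀ a j p.1 ((p.2 : ℝ≥0) / q)
    |(∫ u in (0 : ℝ)..(n / q : ℝ), versionAge a₀ a K k j u.toNNReal) -
        (1 / q : ℝ) * ∑ i ∈ Finset.range n, ((chain k e K i).2.2 : ℝ)| ≤
      (1 / q : ℝ) * ∑ i ∈ Finset.range n, (∑ c, (e (c, i) : ℝ)) * ((chain k e K i).2.2 + 1) := by
  intro e
  have hq' : (0 : ℝ) < q := by exact_mod_cast hq
  have ht : Monotone fun i : ℕ => (i : ℝ≥0) / q := fun i i' h => by
    dsimp only; gcongr
  have hchain (i : ℕ) (hi : i ≤ n) :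
      ((chain k e K i).2.2 : ℝ) = versionAge a₀ a K k j ((i : ℝ≥0) / q) := by
    have := (chain_eq_of_totalTicks_le_one (K := K) (k := k) hC ht (by simp) h1 hi).2.2
    rw [versionAge, eq_sub_iff_add_eq]
    exact_mod_cast this
  have hsum := intervalIntegral.sum_integral_adjacent_intervals (μ := volume)
    (f := fun u : ℝ => versionAge a₀ a K k j u.toNNReal) (a := fun i : ℕ => (i : ℝ) / q) (n := n)
    fun i _ => intervalIntegrable_versionAge hC _ _
  simp only [Nat.cast_zero, zero_div] at hsum
  rw [← hsum, Finset.mul_sum, ← Finset.sum_sub_distrib, Finset.mul_sum]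
  refine (Finset.abs_sum_le_sum_abs _ _).trans (Finset.sum_le_sum fun i hi => ?_)
  rw [Finset.mem_range] at hi
  have hlen : ((i + 1 : ℕ) : ℝ) / q - (i : ℝ) / q = 1 / q := by push_cast; ring
  have hle : (i : ℝ) / q ≤ ((i + 1 : ℕ) : ℝ) / q := by
    have : (0 : ℝ) ≤ 1 / q := by positivity
    linarith
  have hconst : (1 / q : ℝ) * ((chain k e K i).2.2 : ℝ) =
      ∫ _ in ((i : ℝ) / q)..(((i + 1 : ℕ) : ℝ) / q), ((chain k e K i).2.2 : ℝ) := by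
    rw [intervalIntegral.integral_const, hlen, smul_eq_mul]
  rw [hconst, ← intervalIntegral.integral_sub (intervalIntegrable_versionAge hC _ _)
    intervalIntegrable_const]
  have hb := intervalIntegral.norm_integral_le_of_norm_le_const (a := (i : ℝ) / q)
    (b := ((i + 1 : ℕ) : ℝ) / q)
    (f := fun u : ℝ => versionAge a₀ a K k j u.toNNReal - ((chain k e K i).2.2 : ℝ))
    (C := (∑ c, (e (c, i) : ℝ)) * ((chain k e K i).2.2 + 1)) ?_
  · rw [hlen, abs_of_nonneg (by positivity), Real.norm_eq_abs] at hb
    linarith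
  · intro u hu
    rw [Set.uIoc_of_le hle, Set.mem_Ioc] at hu
    have hu1 : (i : ℝ≥0) / q ≤ u.toNNReal := by
      rw [← NNReal.coe_le_coe, Real.coe_toNNReal _ (le_trans (by positivity) hu.1.le)]
      push_cast
      exact hu.1.le
    have hu2 : u.toNNReal ≤ ((i + 1 : ℕ) : ℝ≥0) / q := by
      rw [Real.toNNReal_le_iff_le_coe]
      push_cast at hu ⊢
      exact hu.2
    -- Inside the step the age differs from its left endpoint value only because of ticks up to `u`,
    -- at most those of the whole step.
    rw [hchain i hi.le, Real.norm_eq_abs]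
    refine (abs_versionAge_sub_le hC hu1).trans ?_
    refine mul_le_mul_of_nonneg_right ?_ (add_nonneg (versionAge_nonneg _) zero_le_one)
    rw [totalTicks, Nat.cast_sum]
    refine Finset.sum_le_sum fun c _ => Nat.cast_le.2 ?_
    exact Nat.sub_le_sub_right ((hC c).mono hu2) _

end Path

/-! ### Law of the chain and second moments of the age -/

section ChainLaw

variable {m : ℕ} {j : Fin m}

/-- The input of the discrete chain: the numbers of ticks and the selections. -/
abbrev ChainInput (j : Fin m) : Type := (Incoming j × ℕ → ℕ) × (ℕ → Finset (Fin m))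

/-- All numbers of ticks and all selections are independent; in each step the counter `c` ticks with
probability `π c`; each selection consists of `n` nodes and contains `j` with probability `φ`. -/
structure IsChainLaw (ν : Measure (ChainInput j)) (π : Incoming j → ℝ) (φ : ℝ) (n : ℕ) : Prop where
  indep_ticks : iIndepFun (fun q (p : ChainInput j) => p.1 q) ν
  indep_selections : iIndepFun (fun ℓ (p : ChainInput j) => p.2 ℓ) ν
  indep : IndepFun (Prod.fst : ChainInput j → _) Prod.snd ν
  prob_tick : ∀ c i, ∫ p : ChainInput j, (tick (p.1 (c, i)) : ℝ) ∂ν = π c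
  prob_selection : ∀ ℓ, ν.real {p : ChainInput j | j ∈ p.2 ℓ} = φ
  card_selection : ∀ᵐ p : ChainInput j ∂ν, ∀ ℓ, (p.2 ℓ).card = n

variable {ν : Measure (ChainInput j)} [IsProbabilityMeasure ν] {π : Incoming j → ℝ} {φ : ℝ}
  {n k : ℕ}

omit [IsProbabilityMeasure ν] in
theorem integrable_of_abs_le [IsFiniteMeasure ν] {f : ChainInput j → ℝ} {C : ℝ} (hf : Measurable f)
    (hC : ∀ p, |f p| ≤ C) : Integrable f ν :=
  Integrable.of_bound hf.aestronglyMeasurable C (ae_of_all _ hC)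

/-- The tick indicator of the counter `c` in step `i`. -/
def bit (c : Incoming j) (i : ℕ) (p : ChainInput j) : ℝ := tick (p.1 (c, i))

theorem bit_nonneg (c : Incoming j) (i : ℕ) (p : ChainInput j) : 0 ≤ bit c i p := Nat.cast_nonneg _

theorem bit_le_one (c : Incoming j) (i : ℕ) (p : ChainInput j) : bit c i p ≤ 1 := by
  unfold bit; exact_mod_cast tick_le_one _

theorem bit_sq (c : Incoming j) (i : ℕ) (p : ChainInput j) : bit c i p * bit c i p = bit c i p := by
  unfold bit tick; split_ifs <;> simp

theorem measurable_bit (c : Incoming j) (i : ℕ) : Measurable (bit c i) :=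
  (Measurable.of_discrete (f := fun x : ℕ => (tick x : ℝ))).comp
    ((measurable_pi_apply (c, i)).comp measurable_fst)

/-- The age of the discrete chain after `i` steps. -/
def chainAge (k i : ℕ) (p : ChainInput j) : ℝ := (chain k p.1 p.2 i).2.2

theorem chainAge_nonneg (i : ℕ) (p : ChainInput j) : 0 ≤ chainAge k i p := Nat.cast_nonneg _

theorem chainAge_le (i : ℕ) (p : ChainInput j) : chainAge k i p ≤ i := by
  unfold chainAge; exact_mod_cast chain_age_le i

theorem measurable_chainAge (k i : ℕ) : Measurable (chainAge (j := j) k i) :=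
  (Measurable.of_discrete (f := fun s : ChainState m => (s.2.2 : ℝ))).comp (measurable_chain k i)

theorem dependsOn_chainAge (i : ℕ) (κ : ℕ → Finset (Fin m)) :
    DependsOn (fun e : Incoming j × ℕ → ℕ => chainAge k i (e, κ)) (stepsBefore j i) :=
  fun e e' h => by simp only [chainAge, dependsOn_chain k κ i h]

omit [IsProbabilityMeasure ν] in
theorem IsChainLaw.integral_mul_eq_mul_integral [IsProbabilityMeasure ν] (h : IsChainLaw ν π φ n)
    {S T : Finset (Incoming j × ℕ)}
    (hST : Disjoint S T) {Φ : ChainInput j → ℝ} (hΦm : Measurable Φ)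
    (hΦ : ∀ κ, DependsOn (fun e => Φ (e, κ)) S) {Ψ : (Incoming j × ℕ → ℕ) → ℝ} (hΨm : Measurable Ψ)
    (hΨ : DependsOn Ψ T) :
    ∫ p, Φ p * Ψ p.1 ∂ν = (∫ p, Φ p ∂ν) * ∫ p, Ψ p.1 ∂ν :=
  integral_mul_of_dependsOn (X := fun q (p : ChainInput j) => p.1 q) (Z := Prod.snd)
    (fun q => (measurable_pi_apply q).comp measurable_fst) measurable_snd h.indep_ticks h.indep
    hST hΦm hΦ hΨm hΨ

/-- A quantity settled by the ticks before step `i` and any selections is independent of the ticks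
in step `i`. -/
theorem IsChainLaw.integral_mul_bit (h : IsChainLaw ν π φ n) (c : Incoming j) (i : ℕ)
    {Φ : ChainInput j → ℝ} (hΦm : Measurable Φ)
    (hΦ : ∀ κ, DependsOn (fun e => Φ (e, κ)) (stepsBefore j i)) :
    ∫ p, Φ p * bit c i p ∂ν = (∫ p, Φ p ∂ν) * π c := by
  rw [← h.prob_tick c i]
  refine h.integral_mul_eq_mul_integral (S := stepsBefore j i) (T := {(c, i)}) ?_ hΦm hΦ
    (Ψ := fun e => (tick (e (c, i)) : ℝ)) ?_ ?_
  · rw [Finset.disjoint_singleton_right, mem_stepsBefore]; simp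
  · exact (Measurable.of_discrete (f := fun x : ℕ => (tick x : ℝ))).comp
      (measurable_pi_apply (c, i))
  · intro e e' he
    simp only
    rw [he (c, i) (by simp)]

omit [IsProbabilityMeasure ν] in
theorem IsChainLaw.integral_bit (h : IsChainLaw ν π φ n) (c : Incoming j) (i : ℕ) :
    ∫ p, bit c i p ∂ν = π c := h.prob_tick c i

omit [IsProbabilityMeasure ν] in
theorem IsChainLaw.nonneg (h : IsChainLaw ν π φ n) (c : Incoming j) : 0 ≤ π c := by
  rw [← h.integral_bit c 0]; exact integral_nonneg fun p => bit_nonneg c 0 p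

theorem IsChainLaw.integral_bit_mul_bit (h : IsChainLaw ν π φ n) (c : Incoming j) {a b : ℕ}
    (hab : a ≠ b) : ∫ p, bit c a p * bit c b p ∂ν = π c * π c := by
  wlog hlt : a < b generalizing a b
  · simp_rw [mul_comm (bit c a _)]
    exact this hab.symm (by omega)
  · rw [h.integral_mul_bit c b (measurable_bit c a), h.integral_bit]
    intro κ e e' he
    simp only [bit]
    rw [he (c, a) (by rw [Finset.mem_coe, mem_stepsBefore]; exact hlt)]

/-! ### Moments of the age -/

/-- The number of updates in the steps `i, …, i + q - 1`. -/
def updates (i q : ℕ) (p : ChainInput j) : ℝ := ∑ r ∈ Finset.range q, bit none (i + r) p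

theorem measurable_updates (i q : ℕ) : Measurable (updates (j := j) i q) :=
  Finset.measurable_sum _ fun _ _ => measurable_bit _ _

theorem updates_nonneg (i q : ℕ) (p : ChainInput j) : 0 ≤ updates i q p :=
  Finset.sum_nonneg fun _ _ => bit_nonneg _ _ _

theorem updates_le (i q : ℕ) (p : ChainInput j) : updates i q p ≤ q :=
  (Finset.sum_le_sum fun _ _ => bit_le_one _ _ _).trans (by simp)

theorem updates_mono (i : ℕ) (p : ChainInput j) {q q' : ℕ} (h : q ≤ q') :
    updates i q p ≤ updates i q' p :=
  Finset.sum_le_sum_of_subset_of_nonneg (Finset.range_mono h) fun _ _ _ => bit_nonneg _ _ _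

theorem chainAge_add_le (i l : ℕ) (p : ChainInput j) :
    chainAge k (i + l) p ≤ chainAge k i p + updates i l p := by
  unfold chainAge updates bit
  exact_mod_cast chain_age_add_le i l

/-- Second moment of a binomial variable: the diagonal gives its mean, the off-diagonal terms at
most the square of its mean. -/
theorem IsChainLaw.integral_updates_sq_le (h : IsChainLaw ν π φ n) (i q : ℕ) {Λ : ℝ}
    (hΛ : q * π none ≤ Λ) : ∫ p, updates i q p ^ 2 ∂ν ≤ Λ + Λ ^ 2 := by
  have hint (a b : ℕ) : Integrable (fun p => bit (j := j) none a p * bit none b p) ν := by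
    refine integrable_of_abs_le (C := 1) ((measurable_bit _ _).mul (measurable_bit _ _)) fun p => ?_
    rw [abs_of_nonneg (mul_nonneg (bit_nonneg _ _ _) (bit_nonneg _ _ _))]
    exact mul_le_one₀ (bit_le_one _ _ _) (bit_nonneg _ _ _) (bit_le_one _ _ _)
  have hπ := h.nonneg none
  simp_rw [updates, sq, Finset.sum_mul_sum]
  rw [integral_finsetSum _ fun a _ => integrable_finsetSum _ fun b _ => hint _ _]
  have h1 : ∀ a ∈ Finset.range q, ∫ p, ∑ b ∈ Finset.range q,
      bit (j := j) none (i + a) p * bit none (i + b) p ∂ν ≤ π none + q * (π none * π none) := by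
    intro a ha
    rw [integral_finsetSum _ fun b _ => hint _ _, ← Finset.add_sum_erase _ _ ha]
    refine add_le_add ?_ ?_
    · simp_rw [bit_sq]; exact (h.integral_bit _ _).le
    · rw [Finset.sum_congr rfl fun b hb => h.integral_bit_mul_bit none
        (a := i + a) (b := i + b) (by have := Finset.ne_of_mem_erase hb; omega),
        Finset.sum_const, nsmul_eq_mul]
      gcongr
      exact (Finset.card_le_card (Finset.erase_subset _ _)).trans (by simp)
  refine (Finset.sum_le_sum h1).trans ?_
  rw [Finset.sum_const, Finset.card_range, nsmul_eq_mul]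
  have hq : (0 : ℝ) ≤ q * π none := by positivity
  nlinarith

/-- In the steps `i, …, i + q - 1` there is no update while all incoming edges tick. -/
def AllTick (i q : ℕ) (e : Incoming j × ℕ → ℕ) : Prop :=
  (∀ r < q, e (none, i + r) = 0) ∧ ∀ a : {a : Fin m // a ≠ j}, ∃ r < q, 0 < e (some a, i + r)

theorem measurableSet_allTick (i q : ℕ) :
    MeasurableSet {e : Incoming j × ℕ → ℕ | AllTick i q e} := by
  have hm (c : Incoming j) (l : ℕ) (s : Set ℕ) :
      MeasurableSet {e : Incoming j × ℕ → ℕ | e (c, l) ∈ s} :=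
    measurable_pi_apply (c, l) (MeasurableSet.of_discrete (s := s))
  have : {e : Incoming j × ℕ → ℕ | AllTick i q e} =
      (⋂ r ∈ Finset.range q, {e | e (none, i + r) ∈ ({0} : Set ℕ)}) ∩
        ⋂ a : {a : Fin m // a ≠ j}, ⋃ r ∈ Finset.range q, {e | e (some a, i + r) ∈ Set.Ioi 0} := by
    ext e
    simp [AllTick]
  rw [this]
  refine MeasurableSet.inter (Finset.measurableSet_biInter _ fun r _ => hm _ _ _)
    (MeasurableSet.iInter fun a => Finset.measurableSet_biUnion _ fun r _ => hm _ _ _)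

open scoped Classical in
/-- The indicator that `AllTick` fails. -/
noncomputable def missIndicator (i q : ℕ) (e : Incoming j × ℕ → ℕ) : ℝ :=
  {e | AllTick i q e}ᶜ.indicator 1 e

theorem measurable_missIndicator (i q : ℕ) : Measurable (missIndicator (j := j) i q) :=
  measurable_one.indicator (measurableSet_allTick i q).compl

theorem missIndicator_nonneg (i q : ℕ) (e : Incoming j × ℕ → ℕ) : 0 ≤ missIndicator i q e :=
  Set.indicator_nonneg (fun _ _ => zero_le_one) _

theorem missIndicator_le_one (i q : ℕ) (e : Incoming j × ℕ → ℕ) : missIndicator i q e ≤ 1 :=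
  Set.indicator_le_self' (fun _ _ => zero_le_one) _

theorem dependsOn_missIndicator (i q : ℕ) : DependsOn (missIndicator (j := j) i q)
    (Finset.univ ×ˢ Finset.Ico i (i + q) : Finset (Incoming j × ℕ)) := by
  intro e e' he
  have h (c : Incoming j) (r : ℕ) (hr : r < q) : e (c, i + r) = e' (c, i + r) :=
    he (c, i + r) (by simp [hr])
  have : AllTick i q e ↔ AllTick i q e' := by
    unfold AllTick
    refine and_congr (forall₂_congr fun r hr => by rw [h _ r hr]) (forall_congr' fun a => ?_)
    refine exists_congr fun r => and_congr_right fun hr => by rw [h _ r hr]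
  unfold missIndicator
  by_cases h1 : AllTick i q e
  · rw [Set.indicator_of_notMem (by simpa using h1),
      Set.indicator_of_notMem (by simpa using this.1 h1)]
  · rw [Set.indicator_of_mem (by simpa using h1),
      Set.indicator_of_mem (by simpa using fun h2 => h1 (this.2 h2))]
    rfl

omit [IsProbabilityMeasure ν] in
-- If all incoming edges tick without an update, the node ends up with all `n > k` keys and its age
-- is zero. Otherwise the age grows at most by the updates.
theorem IsChainLaw.chainAge_window_le (h : IsChainLaw ν π φ n) (hkn : k < n) (i q : ℕ) :
    ∀ᵐ p ∂ν, chainAge k (i + q) p ≤ missIndicator i q p.1 * (chainAge k i p + updates i q p) := by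
  filter_upwards [h.card_selection] with p hp
  unfold missIndicator
  by_cases h1 : AllTick i q p.1
  · rw [Set.indicator_of_notMem (by simpa using h1), zero_mul]
    unfold chainAge
    rw [chain_age_eq_zero_of_all_tick i q h1.1 h1.2 (by rw [hp]; omega)]
    simp
  · rw [Set.indicator_of_mem (by simpa using h1), Pi.one_apply, one_mul]
    exact chainAge_add_le i q p

/-- A Foster–Lyapunov contraction: over one window the square of the age survives only if the reset
is missed, which is independent of the age and has probability at most `1 - δ`. -/
theorem IsChainLaw.integral_chainAge_sq_window_le (h : IsChainLaw ν π φ n) (hkn : k < n) {q : ℕ}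
    {Λ δ : ℝ} (hΛ : q * π none ≤ Λ) (hδ : 0 < δ)
    (hmiss : ∀ i, ∫ p, missIndicator i q p.1 ∂ν ≤ 1 - δ) (i : ℕ) :
    ∫ p, chainAge k (i + q) p ^ 2 ∂ν ≤
      (1 - δ / 2) * ∫ p, chainAge k i p ^ 2 ∂ν + (2 / δ * Λ ^ 2 + Λ + Λ ^ 2) := by
  have hy := measurable_chainAge (j := j) k i
  have hu := measurable_updates (j := j) i q
  have hM : Measurable fun p : ChainInput j => missIndicator i q p.1 :=
    (measurable_missIndicator i q).comp measurable_fst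
  have hyi : Integrable (chainAge (j := j) k i) ν := integrable_of_abs_le (C := i) hy fun p => by
    rw [abs_of_nonneg (chainAge_nonneg i p)]; exact chainAge_le i p
  have hy2 (l : ℕ) : Integrable (fun p => chainAge (j := j) k l p ^ 2) ν :=
    integrable_of_abs_le (C := (l : ℝ) ^ 2) ((measurable_chainAge k l).pow_const 2) fun p => by
      rw [abs_of_nonneg (sq_nonneg _)]
      exact pow_le_pow_left₀ (chainAge_nonneg l p) (chainAge_le l p) 2
  have hMy : Integrable (fun p => chainAge (j := j) k i p ^ 2 * missIndicator i q p.1) ν :=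
    integrable_of_abs_le (C := (i : ℝ) ^ 2) ((hy.pow_const 2).mul hM) fun p => by
      rw [abs_of_nonneg (mul_nonneg (sq_nonneg _) (missIndicator_nonneg _ _ _)),
        ← mul_one ((i : ℝ) ^ 2)]
      exact mul_le_mul (pow_le_pow_left₀ (chainAge_nonneg i p) (chainAge_le i p) 2)
        (missIndicator_le_one _ _ _) (missIndicator_nonneg _ _ _) (by positivity)
  have hyu : Integrable (fun p => chainAge (j := j) k i p * updates i q p) ν :=
    integrable_of_abs_le (C := (i : ℝ) * q) (hy.mul hu) fun p => by
      rw [abs_of_nonneg (mul_nonneg (chainAge_nonneg _ _) (updates_nonneg _ _ _))]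
      exact mul_le_mul (chainAge_le i p) (updates_le _ _ _) (updates_nonneg _ _ _) (by positivity)
  have hu2 : Integrable (fun p => updates (j := j) i q p ^ 2) ν :=
    integrable_of_abs_le (C := (q : ℝ) ^ 2) (hu.pow_const 2) fun p => by
      rw [abs_of_nonneg (sq_nonneg _)]
      exact pow_le_pow_left₀ (updates_nonneg _ _ p) (updates_le _ _ p) 2
  have hdep (κ : ℕ → Finset (Fin m)) := dependsOn_chainAge (k := k) (j := j) i κ
  have e1 : ∫ p, chainAge k i p ^ 2 * missIndicator i q p.1 ∂ν ≤
      (∫ p, chainAge k i p ^ 2 ∂ν) * (1 - δ) := by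
    rw [h.integral_mul_eq_mul_integral (S := stepsBefore j i)
      (T := Finset.univ ×ˢ Finset.Ico i (i + q)) ?_ (hy.pow_const 2) ?_
      (measurable_missIndicator i q) (dependsOn_missIndicator i q)]
    · exact mul_le_mul_of_nonneg_left (hmiss i) (integral_nonneg fun p => sq_nonneg _)
    · rw [Finset.disjoint_left]
      rintro ⟨c, l⟩ hp hq
      rw [mem_stepsBefore] at hp
      simp at hq
      simp at hp
      omega
    · intro κ e e' he
      simp only [hdep κ he]
  have e2 : ∫ p, chainAge k i p * updates i q p ∂ν = (∫ p, chainAge k i p ∂ν) * (q * π none) := by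
    unfold updates
    simp_rw [Finset.mul_sum]
    have hb (r : ℕ) : Integrable (fun p => chainAge (j := j) k i p * bit none (i + r) p) ν :=
      integrable_of_abs_le (C := (i : ℝ) * 1) (hy.mul (measurable_bit _ _)) fun p => by
        rw [abs_of_nonneg (mul_nonneg (chainAge_nonneg _ _) (bit_nonneg _ _ _))]
        exact mul_le_mul (chainAge_le i p) (bit_le_one _ _ _) (bit_nonneg _ _ _) (by positivity)
    rw [integral_finsetSum _ fun r _ => hb r, Finset.sum_congr rfl fun r _ =>
      h.integral_mul_bit none (i + r) hy fun κ => (hdep κ).mono fun p hp => by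
        rw [Finset.mem_coe, mem_stepsBefore] at hp ⊢; omega]
    simp
    ring
  have e3 := h.integral_updates_sq_le i q hΛ
  -- Young's inequality, weighted so that the cross term consumes only half of the contraction `δ`.
  have e4 : (∫ p, chainAge k i p ∂ν) * (2 * Λ) ≤
      δ / 2 * ∫ p, chainAge k i p ^ 2 ∂ν + 2 / δ * Λ ^ 2 := by
    have hc : ∫ _ : ChainInput j, 2 / δ * Λ ^ 2 ∂ν = 2 / δ * Λ ^ 2 := by simp
    rw [← integral_mul_const, ← integral_const_mul, ← hc,
      ← integral_add ((hy2 i).const_mul _) (integrable_const _)]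
    refine integral_mono (hyi.mul_const _) (((hy2 i).const_mul _).add (integrable_const _))
      fun p => ?_
    dsimp only
    have : δ / 2 * chainAge k i p ^ 2 + 2 / δ * Λ ^ 2 - chainAge k i p * (2 * Λ) =
      (δ * chainAge k i p - 2 * Λ) ^ 2 / (2 * δ) := by field_simp; ring
    have h2 : 0 ≤ (δ * chainAge k i p - 2 * Λ) ^ 2 / (2 * δ) := by positivity
    linarith
  have hyn : 0 ≤ ∫ p, chainAge k i p ∂ν := integral_nonneg fun p => chainAge_nonneg i p
  have e5 : ∫ p, chainAge k (i + q) p ^ 2 ∂ν ≤ ∫ p, (chainAge k i p ^ 2 * missIndicator i q p.1 +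
      2 * (chainAge k i p * updates i q p) + updates i q p ^ 2) ∂ν := by
    refine integral_mono_ae (hy2 _) ((hMy.add (hyu.const_mul 2)).add hu2) ?_
    filter_upwards [h.chainAge_window_le hkn i q] with p hp
    have h0 := chainAge_nonneg (k := k) i p
    have h1 := updates_nonneg i q p
    have h2 := missIndicator_nonneg i q p.1
    have h3 := missIndicator_le_one i q p.1
    have hM2 : missIndicator i q p.1 ^ 2 ≤ missIndicator i q p.1 := by nlinarith
    calc chainAge k (i + q) p ^ 2
        ≤ (missIndicator i q p.1 * (chainAge k i p + updates i q p)) ^ 2 :=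
          pow_le_pow_left₀ (chainAge_nonneg _ _) hp 2
      _ = missIndicator i q p.1 ^ 2 * (chainAge k i p + updates i q p) ^ 2 := by ring
      _ ≤ missIndicator i q p.1 * (chainAge k i p + updates i q p) ^ 2 := by gcongr
      _ = chainAge k i p ^ 2 * missIndicator i q p.1 + missIndicator i q p.1 *
          (2 * (chainAge k i p * updates i q p) + updates i q p ^ 2) := by ring
      -- The indicator is kept only in front of the squared age. In the other terms it is correlated
      -- with the updates, and the bound `1` suffices there.
      _ ≤ chainAge k i p ^ 2 * missIndicator i q p.1 + 1 *
          (2 * (chainAge k i p * updates i q p) + updates i q p ^ 2) := by gcongr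
      _ = _ := by ring
  rw [integral_add (f := fun p => chainAge k i p ^ 2 * missIndicator i q p.1 +
      2 * (chainAge k i p * updates i q p)) (hMy.add (hyu.const_mul 2)) hu2,
    integral_add hMy (hyu.const_mul 2),
    integral_const_mul, e2] at e5
  have e6 : (∫ p, chainAge k i p ∂ν) * (q * π none) ≤ (∫ p, chainAge k i p ∂ν) * Λ := by gcongr
  linarith

/-- A bound on the second moment of the age that is uniform in the number of steps. -/
theorem IsChainLaw.integral_chainAge_add_one_sq_le (h : IsChainLaw ν π φ n) (hkn : k < n) {q : ℕ}
    (hq : 0 < q) {Λ δ : ℝ} (hΛ : q * π none ≤ Λ) (hδ : 0 < δ)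
    (hmiss : ∀ i, ∫ p, missIndicator i q p.1 ∂ν ≤ 1 - δ) (i : ℕ) :
    ∫ p, (chainAge k i p + 1) ^ 2 ∂ν ≤
      3 * (2 / δ * (2 / δ * Λ ^ 2 + Λ + Λ ^ 2) + (Λ + Λ ^ 2) + 1) := by
  have hΛ0 : 0 ≤ Λ := le_trans (mul_nonneg (Nat.cast_nonneg _) (h.nonneg none)) hΛ
  have hδ1 : δ ≤ 1 := by
    have : 0 ≤ ∫ p, missIndicator 0 q p.1 ∂ν := integral_nonneg fun p => missIndicator_nonneg _ _ _
    linarith [hmiss 0]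
  have hy2 (l : ℕ) : Integrable (fun p => chainAge (j := j) k l p ^ 2) ν :=
    integrable_of_abs_le (C := (l : ℝ) ^ 2) ((measurable_chainAge k l).pow_const 2) fun p => by
      rw [abs_of_nonneg (sq_nonneg _)]
      exact pow_le_pow_left₀ (chainAge_nonneg l p) (chainAge_le l p) 2
  -- The bound is the fixed point of the affine contraction with factor `1 - δ / 2`, and the age
  -- starts at zero.
  have hwin (w : ℕ) : ∫ p, chainAge k (w * q) p ^ 2 ∂ν ≤
      2 / δ * (2 / δ * Λ ^ 2 + Λ + Λ ^ 2) := by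
    induction w with
    | zero => simp [chainAge, chain]; positivity
    | succ w ih =>
      rw [Nat.succ_mul]
      refine (h.integral_chainAge_sq_window_le hkn hΛ hδ hmiss (w * q)).trans ?_
      have : (1 - δ / 2) * ∫ p, chainAge k (w * q) p ^ 2 ∂ν ≤
          (1 - δ / 2) * (2 / δ * (2 / δ * Λ ^ 2 + Λ + Λ ^ 2)) :=
        mul_le_mul_of_nonneg_left ih (by linarith)
      refine (add_le_add_left this _).trans (le_of_eq ?_)
      field_simp
      ring
  have hu2 : Integrable (fun p => updates (j := j) (i / q * q) q p ^ 2) ν :=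
    integrable_of_abs_le (C := (q : ℝ) ^ 2) ((measurable_updates _ _).pow_const 2) fun p => by
      rw [abs_of_nonneg (sq_nonneg _)]
      exact pow_le_pow_left₀ (updates_nonneg _ _ p) (updates_le _ _ p) 2
  have h1 : ∫ p, (chainAge k i p + 1) ^ 2 ∂ν ≤ ∫ p, 3 * (chainAge k (i / q * q) p ^ 2 +
      updates (i / q * q) q p ^ 2 + 1) ∂ν := by
    refine integral_mono ?_ ((((hy2 _).add hu2).add (integrable_const _)).const_mul 3) fun p => ?_
    · refine integrable_of_abs_le (C := ((i : ℝ) + 1) ^ 2)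
        (((measurable_chainAge k i).add_const 1).pow_const 2) fun p => ?_
      rw [abs_of_nonneg (sq_nonneg _)]
      have := chainAge_nonneg (k := k) i p
      exact pow_le_pow_left₀ (by linarith) (by linarith [chainAge_le (k := k) i p]) 2
    · dsimp only
      -- Step `i` lies less than one window after a multiple of `q`, so the updates of a full window
      -- bound the growth since then. The factor `3` comes from squaring a sum of three terms.
      have h2 := chainAge_add_le (k := k) (i / q * q) (i % q) p
      rw [Nat.div_add_mod'] at h2
      have h3 := updates_mono (i / q * q) p (Nat.mod_lt i hq).le
      have h4 := chainAge_nonneg (k := k) i p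
      have h5 : (chainAge k i p + 1) ^ 2 ≤
          (chainAge k (i / q * q) p + updates (i / q * q) q p + 1) ^ 2 :=
        pow_le_pow_left₀ (by linarith) (by linarith) 2
      refine h5.trans ?_
      nlinarith [sq_nonneg (chainAge k (i / q * q) p - updates (i / q * q) q p),
        sq_nonneg (chainAge k (i / q * q) p - 1), sq_nonneg (updates (i / q * q) q p - 1)]
  rw [integral_const_mul, integral_add (f := fun p => chainAge k (i / q * q) p ^ 2 +
      updates (i / q * q) q p ^ 2) ((hy2 _).add hu2) (integrable_const _),
    integral_add (hy2 _) hu2] at h1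
  have h6 := hwin (i / q)
  have h7 := h.integral_updates_sq_le (i / q * q) q hΛ
  simp at h1
  linarith

end ChainLaw

/-! ### The potential, its drift and its orthogonal fluctuations -/

section Noise

variable {m : ℕ} {j : Fin m}

/-- `u r` is the probability that a node with `r` keys of the current version does not decrypt it
before the next update, if in each step the source ticks with probability `π₀` and an edge
with probability `π₁`. -/
structure IsMissProbability (u : ℕ → ℝ) (k n : ℕ) (π₀ π₁ : ℝ) : Prop where
  nonneg : ∀ r, 0 ≤ u r
  le_one : ∀ r, u r ≤ 1
  anti : ∀ r, u (r + 1) ≤ u r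
  eq_zero : ∀ r, k + 1 ≤ r → u r = 0
  -- First-step equation: `n - r` edges move `u r` to `u (r + 1)`, while an update makes the miss
  -- certain, with value `1`. The node's own key is counted in `r`, so the equation is the same
  -- whether or not the node is selected.
  balance : ∀ r ≤ k, ((n : ℝ) - r) * π₁ * (u (r + 1) - u r) - π₀ * u r = -π₀

/-- The change of the potential `u |W| * y` caused by a tick of the counter `c`, averaged over
the selection in case of an update. Here `A` is the set of nodes with a key of the current
version. -/
def gain (u : ℕ → ℝ) (v : ℝ) (s : ChainState m) (A : Finset (Fin m)) : Incoming j → ℝ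
  | none => v * (s.2.2 + 1) - u s.2.1.card * s.2.2
  | some a => if a.1 ∈ A \ s.2.1 then (u (s.2.1.card + 1) - u s.2.1.card) * s.2.2 else 0

/-- The potential of the state after `i` steps. -/
def potential (u : ℕ → ℝ) (k i : ℕ) (p : ChainInput j) : ℝ :=
  u (chain k p.1 p.2 i).2.1.card * (chain k p.1 p.2 i).2.2

/-- The gain due to the counter `c` in step `i`. -/
def chainGain (u : ℕ → ℝ) (v : ℝ) (k i : ℕ) (c : Incoming j) (p : ChainInput j) : ℝ :=
  gain u v (chain k p.1 p.2 i) (p.2 (chain k p.1 p.2 i).1) c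

/-- The deviation of the potential of a newly selected set from its mean `v`. -/
def selectionDev (j : Fin m) (u : ℕ → ℝ) (v : ℝ) (A : Finset (Fin m)) : ℝ := u (A ∩ {j}).card - v

/-- The fluctuation of the potential in step `i`. -/
def noise (u : ℕ → ℝ) (v : ℝ) (π : Incoming j → ℝ) (k i : ℕ) (p : ChainInput j) : ℝ :=
  ∑ c, chainGain u v k i c p * (bit c i p - π c) +
    bit none i p * (chainAge k i p + 1) * selectionDev j u v (p.2 ((chain k p.1 p.2 i).1 + 1))

variable {u : ℕ → ℝ} {v : ℝ} {π : Incoming j → ℝ} {φ π₁ : ℝ} {k n : ℕ}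

theorem card_inter_singleton (A : Finset (Fin m)) : (A ∩ {j}).card = if j ∈ A then 1 else 0 := by
  split_ifs with h
  · rw [Finset.inter_singleton_of_mem h, Finset.card_singleton]
  · rw [Finset.inter_singleton_of_notMem h, Finset.card_empty]

/-- Exactly `n - r` edges offer a missing key. The balance equation, multiplied by the age, cancels
every term containing `u`, so the drift is affine in the age alone. For `r > k` there is no balance
equation, but then the age is zero. -/
theorem sum_gain_mul (hu : IsMissProbability u k n (π none) π₁) (hπ : ∀ a, π (some a) = π₁)
    (p : ChainInput j) (i : ℕ) (hn : (p.2 (chain k p.1 p.2 i).1).card = n) :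
    ∑ c, chainGain u v k i c p * π c = π none * (v - (1 - v) * chainAge k i p) := by
  set s := chain k p.1 p.2 i with hs
  set A := p.2 s.1 with hA
  have hsub : s.2.1 ⊆ A := chain_held_subset i
  have hj : j ∉ A \ s.2.1 := fun h =>
    (Finset.mem_sdiff.1 h).2 (mem_chain_held i (Finset.mem_sdiff.1 h).1)
  have hsum : ∑ a : {a : Fin m // a ≠ j}, chainGain u v k i (some a) p * π (some a) =
      ((n : ℝ) - s.2.1.card) * ((u (s.2.1.card + 1) - u s.2.1.card) * s.2.2 * π₁) := by
    have h1 : ∀ a : {a : Fin m // a ≠ j}, chainGain u v k i (some a) p * π (some a) =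
        if a.1 ∈ A \ s.2.1 then (u (s.2.1.card + 1) - u s.2.1.card) * s.2.2 * π₁ else 0 := by
      intro a
      simp only [chainGain, gain, hπ, ← hs, ← hA, ite_mul, zero_mul]
    rw [Finset.sum_congr rfl fun a _ => h1 a, ← Finset.sum_filter, Finset.sum_const, nsmul_eq_mul]
    congr 1
    have h2 : (Finset.univ.filter fun a : {a : Fin m // a ≠ j} => a.1 ∈ A \ s.2.1).card =
        (A \ s.2.1).card := by
      refine Finset.card_bij (fun a _ => a.1) (fun a ha => (Finset.mem_filter.1 ha).2)
        (fun a _ b _ h => Subtype.ext h) fun b hb => ?_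
      exact ⟨⟨b, fun h => hj (h ▸ hb)⟩, Finset.mem_filter.2 ⟨Finset.mem_univ _, hb⟩, rfl⟩
    rw [h2, Finset.card_sdiff_of_subset hsub, Nat.cast_sub (Finset.card_le_card hsub), hn]
  rw [Fintype.sum_option, hsum]
  simp only [chainGain, gain, chainAge, ← hs]
  rcases le_or_gt s.2.1.card k with hr | hr
  · linear_combination (s.2.2 : ℝ) * hu.balance _ hr
  · have h0 : s.2.2 = 0 := chain_age_eq_zero_of_le_card i hr
    rw [h0]
    push_cast
    ring

/-- The one-step evolution of the potential when at most one counter ticks. -/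
theorem potential_succ_sub (hu : IsMissProbability u k n (π none) π₁)
    (hπ : ∀ a, π (some a) = π₁) (p : ChainInput j) (i : ℕ)
    (hn : (p.2 (chain k p.1 p.2 i).1).card = n) (h1 : ∑ c, p.1 (c, i) ≤ 1) :
    potential u k (i + 1) p - potential u k i p =
      noise u v π k i p + π none * (v - (1 - v) * chainAge k i p) := by
  rw [← sum_gain_mul (v := v) hu hπ p i hn, noise]
  simp_rw [mul_sub, Finset.sum_sub_distrib]
  -- The reset of the age upon decryption is invisible in the potential, since `u` vanishes from `k
  -- + 1` keys on.
  have hval : potential u k (i + 1) p = u (chain k p.1 p.2 (i + 1)).2.1.card *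
      ((chain k p.1 p.2 i).2.2 + bit none i p) := by
    unfold potential
    rw [chain_age_succ]
    split_ifs with h
    · rw [hu.eq_zero _ h]; simp
    · rw [bit]; push_cast; ring
  by_cases h0 : ∀ c, p.1 (c, i) = 0
  · have hb (c : Incoming j) : bit c i p = 0 := by simp [bit, h0]
    have hW : (chain k p.1 p.2 (i + 1)).2.1 = (chain k p.1 p.2 i).2.1 := by
      rw [chain_held_succ, h0, if_neg (lt_irrefl 0), Finset.union_eq_left]
      intro b hb
      simp [newKeys, h0] at hb
    rw [hval, hW]
    simp [hb, potential]
  · push Not at h0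
    obtain ⟨c, hc⟩ := h0
    have hother (c' : Incoming j) (hne : c' ≠ c) : p.1 (c', i) = 0 := by
      have := Finset.add_le_sum (f := fun c => p.1 (c, i)) (fun _ _ => Nat.zero_le _)
        (Finset.mem_univ c) (Finset.mem_univ c') hne.symm
      omega
    have hb (c' : Incoming j) (hne : c' ≠ c) : bit c' i p = 0 := by simp [bit, hother c' hne]
    have hbc : bit c i p = 1 := by simp [bit, tick_pos (Nat.pos_of_ne_zero hc)]
    rw [Finset.sum_eq_single c (fun c' _ hne => by rw [hb c' hne, mul_zero])
      (fun h => absurd (Finset.mem_univ c) h), hbc, hval]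
    rcases c with _ | a
    · have hW : (chain k p.1 p.2 (i + 1)).2.1 = p.2 ((chain k p.1 p.2 i).1 + 1) ∩ {j} := by
        rw [chain_held_succ, if_pos (Nat.pos_of_ne_zero hc)]
      rw [hW, hbc]
      simp only [selectionDev, chainGain, gain, chainAge, potential]
      ring
    · have hn0 : p.1 (none, i) = 0 := hother none (by simp)
      rw [hb none (by simp)]
      have hW : (chain k p.1 p.2 (i + 1)).2.1 = if a.1 ∈ p.2 (chain k p.1 p.2 i).1 \
          (chain k p.1 p.2 i).2.1 then insert a.1 (chain k p.1 p.2 i).2.1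
          else (chain k p.1 p.2 i).2.1 := by
        rw [chain_held_succ, hn0, if_neg (lt_irrefl 0)]
        have hnew : newKeys (fun c => p.1 (c, i)) (p.2 (chain k p.1 p.2 i).1) =
            p.2 (chain k p.1 p.2 i).1 ∩ {a.1} := by
          ext b
          simp only [newKeys, Finset.mem_filter, Finset.mem_inter, Finset.mem_singleton]
          refine and_congr_right fun _ => ⟨?_, ?_⟩
          · rintro ⟨hb, hpos⟩
            by_contra hne
            have := hother (some ⟨b, hb⟩) (by simpa [Subtype.ext_iff] using hne)
            omega
          · rintro rfl
            exact ⟨a.2, Nat.pos_of_ne_zero hc⟩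
        rw [hnew]
        ext b
        split_ifs with h <;> simp only [Finset.mem_union, Finset.mem_inter, Finset.mem_singleton,
          Finset.mem_insert, Finset.mem_sdiff] at h ⊢ <;> grind
      rw [hW]
      simp only [chainGain, gain, potential]
      split_ifs with h
      · rw [Finset.card_insert_of_notMem (Finset.mem_sdiff.1 h).2]
        ring
      · ring

theorem abs_chainGain_le (hu : IsMissProbability u k n (π none) π₁) (hv : 0 ≤ v) (hv1 : v ≤ 1)
    (i : ℕ) (c : Incoming j) (p : ChainInput j) : |chainGain u v k i c p| ≤ chainAge k i p + 1 := by
  have hy := chainAge_nonneg (k := k) i p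
  unfold chainAge at hy
  rcases c with _ | a
  · simp only [chainGain, gain, chainAge]
    have h1 := hu.nonneg (chain k p.1 p.2 i).2.1.card
    have h2 := hu.le_one (chain k p.1 p.2 i).2.1.card
    rw [abs_le]
    constructor <;> nlinarith
  · simp only [chainGain, gain, chainAge]
    split_ifs
    · have h1 := hu.nonneg ((chain k p.1 p.2 i).2.1.card + 1)
      have h2 := hu.le_one (chain k p.1 p.2 i).2.1.card
      have h3 := hu.anti (chain k p.1 p.2 i).2.1.card
      rw [abs_le]
      constructor <;> nlinarith
    · simp; linarith

theorem abs_selectionDev_le (hu : IsMissProbability u k n (π none) π₁) (hv : 0 ≤ v) (hv1 : v ≤ 1)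
    (A : Finset (Fin m)) : |selectionDev j u v A| ≤ 1 := by
  have h1 := hu.nonneg (A ∩ {j}).card
  have h2 := hu.le_one (A ∩ {j}).card
  rw [selectionDev, abs_le]
  constructor <;> linarith

theorem measurable_chain_selection (i : ℕ)
    (g : ChainState m → Finset (Fin m) → Finset (Fin m) → ℝ) :
    Measurable fun p : ChainInput j => g (chain k p.1 p.2 i) (p.2 (chain k p.1 p.2 i).1)
      (p.2 ((chain k p.1 p.2 i).1 + 1)) := by
  have h : Measurable fun q : ChainState m × (ℕ → Finset (Fin m)) =>
      g q.1 (q.2 q.1.1) (q.2 (q.1.1 + 1)) := by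
    refine measurable_from_prod_countable_right fun s => ?_
    have hA : Measurable fun κ : ℕ → Finset (Fin m) => (κ s.1, κ (s.1 + 1)) :=
      (measurable_pi_apply s.1).prodMk (measurable_pi_apply (s.1 + 1))
    exact (Measurable.of_discrete
      (f := fun A : Finset (Fin m) × Finset (Fin m) => g s A.1 A.2)).comp
      hA
  exact h.comp ((measurable_chain k i).prodMk measurable_snd)

theorem measurable_chainGain (i : ℕ) (c : Incoming j) : Measurable (chainGain u v k i c) :=
  measurable_chain_selection i fun s A _ => gain u v s A c

theorem measurable_noise (i : ℕ) : Measurable (noise u v π k i) := by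
  refine (Finset.measurable_sum _ fun c _ => (measurable_chainGain i c).mul
    ((measurable_bit c i).sub_const _)).add (((measurable_bit _ _).mul
      ((measurable_chainAge k i).add_const 1)).mul ?_)
  exact measurable_chain_selection i fun _ _ A => selectionDev j u v A

theorem dependsOn_chainGain (i : ℕ) (c : Incoming j) (κ : ℕ → Finset (Fin m)) :
    DependsOn (fun e => chainGain u v k i c (e, κ)) (stepsBefore j i) :=
  fun e e' h => by simp only [chainGain, dependsOn_chain k κ i h]

theorem dependsOn_noise (i : ℕ) (κ : ℕ → Finset (Fin m)) :
    DependsOn (fun e => noise u v π k i (e, κ)) (stepsBefore j (i + 1)) := by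
  intro e e' h
  have h1 : chain k e κ i = chain k e' κ i := dependsOn_chain k κ i fun p hp =>
    h p (by rw [Finset.mem_coe, mem_stepsBefore] at hp ⊢; omega)
  have h2 (c : Incoming j) : e (c, i) = e' (c, i) :=
    h (c, i) (by rw [Finset.mem_coe, mem_stepsBefore]; simp)
  simp only [noise, chainGain, bit, chainAge, h1, h2]

/-- The selection after the current one enters only with the factor `bit none i`, that is, only if
its version is generated in this very step. -/
theorem noise_congr_selection {e : Incoming j × ℕ → ℕ} {κ κ' : ℕ → Finset (Fin m)} (i : ℕ)
    (h : ∀ l ≤ (chain k e κ (i + 1)).1, κ l = κ' l) :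
    noise u v π k i (e, κ) = noise u v π k i (e, κ') := by
  have hle : (chain k e κ i).1 ≤ (chain k e κ (i + 1)).1 := chain_version_mono (Nat.le_succ i)
  have h1 : chain k e κ i = chain k e κ' i :=
    chain_congr_selection i fun l hl => h l (hl.trans hle)
  simp only [noise, chainGain, chainAge, bit, ← h1, ← h _ hle]
  by_cases h0 : 0 < e (none, i)
  · rw [h ((chain k e κ i).1 + 1) (by rw [chain_version_succ, tick_pos h0])]
  · simp [Nat.eq_zero_of_not_pos h0]

theorem abs_noise_le (hu : IsMissProbability u k n (π none) π₁) (hv : 0 ≤ v) (hv1 : v ≤ 1)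
    (hπ0 : ∀ c, 0 ≤ π c) (i : ℕ) (p : ChainInput j) :
    |noise u v π k i p| ≤ 2 * (chainAge k i p + 1) * ∑ c, (bit c i p + π c) := by
  have hy := chainAge_nonneg (k := k) i p
  have h1 : |∑ c, chainGain u v k i c p * (bit c i p - π c)| ≤
      (chainAge k i p + 1) * ∑ c, (bit c i p + π c) := by
    rw [Finset.mul_sum]
    refine (Finset.abs_sum_le_sum_abs _ _).trans (Finset.sum_le_sum fun c _ => ?_)
    rw [abs_mul]
    refine mul_le_mul (abs_chainGain_le hu hv hv1 i c p) ?_ (abs_nonneg _) (by linarith)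
    have := bit_nonneg c i p
    have := hπ0 c
    rw [abs_le]; constructor <;> linarith
  have h2 : |bit none i p * (chainAge k i p + 1) *
      selectionDev j u v (p.2 ((chain k p.1 p.2 i).1 + 1))| ≤
      (chainAge k i p + 1) * ∑ c, (bit c i p + π c) := by
    have hb : bit none i p ≤ ∑ c, (bit c i p + π c) :=
      (le_add_of_nonneg_right (hπ0 none)).trans (Finset.single_le_sum
        (f := fun c => bit c i p + π c) (fun c _ => add_nonneg (bit_nonneg c i p) (hπ0 c))
        (Finset.mem_univ none))
    have h0 := bit_nonneg none i p
    rw [abs_mul, abs_of_nonneg (mul_nonneg h0 (by linarith))]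
    calc _ ≤ bit none i p * (chainAge k i p + 1) * 1 := by
          gcongr
          exact abs_selectionDev_le hu hv hv1 _
      _ ≤ _ := by rw [mul_one, mul_comm]; gcongr
  calc _ ≤ _ := abs_add_le _ _
    _ ≤ _ := add_le_add h1 h2
    _ = _ := by ring

variable {ν : Measure (ChainInput j)} [IsProbabilityMeasure ν]

theorem IsChainLaw.le_one (h : IsChainLaw ν π φ n) (c : Incoming j) : π c ≤ 1 := by
  rw [← h.integral_bit c 0]
  refine (integral_mono (integrable_of_abs_le (C := 1) (measurable_bit _ _) fun p => ?_)
    (integrable_const 1) fun p => bit_le_one c 0 p).trans (by simp)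
  rw [abs_of_nonneg (bit_nonneg _ _ _)]; exact bit_le_one _ _ _

theorem abs_noise_le_of_step (hu : IsMissProbability u k n (π none) π₁) (hv : 0 ≤ v) (hv1 : v ≤ 1)
    (h : IsChainLaw ν π φ n) (i : ℕ) (p : ChainInput j) :
    |noise u v π k i p| ≤ 2 * (i + 1) * (2 * Fintype.card (Incoming j)) := by
  refine (abs_noise_le hu hv hv1 h.nonneg i p).trans ?_
  have hy := chainAge_nonneg (k := k) i p
  have hs : ∑ c, (bit c i p + π c) ≤ 2 * Fintype.card (Incoming j) := by
    refine (Finset.sum_le_sum fun c _ => add_le_add (bit_le_one c i p) (h.le_one c)).trans ?_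
    rw [Finset.sum_const, nsmul_eq_mul, Finset.card_univ]
    linarith
  gcongr
  · exact Finset.sum_nonneg fun c _ => add_nonneg (bit_nonneg c i p) (h.nonneg c)
  · exact chainAge_le i p

/-- A new version starts with one key with probability `φ` and with none otherwise, so `v` is the
mean of the new value of `u`. -/
theorem IsChainLaw.integral_selectionDev (h : IsChainLaw ν π φ n)
    (hv : v = φ * u 1 + (1 - φ) * u 0) (ℓ : ℕ) :
    ∫ p : ChainInput j, selectionDev j u v (p.2 ℓ) ∂ν = 0 := by
  have hm : Measurable fun p : ChainInput j => p.2 ℓ := (measurable_pi_apply ℓ).comp measurable_snd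
  have hS : MeasurableSet {p : ChainInput j | j ∈ p.2 ℓ} :=
    hm (MeasurableSet.of_discrete (s := {A : Finset (Fin m) | j ∈ A}))
  have h1 : ∀ p : ChainInput j, selectionDev j u v (p.2 ℓ) =
      {p : ChainInput j | j ∈ p.2 ℓ}.indicator (fun _ => u 1 - u 0) p + (u 0 - v) := by
    intro p
    rw [selectionDev, card_inter_singleton]
    by_cases hj : j ∈ p.2 ℓ
    · rw [if_pos hj, Set.indicator_of_mem (by exact hj)]; ring
    · rw [if_neg hj, Set.indicator_of_notMem (by exact hj)]; ring
  simp_rw [h1]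
  rw [integral_add ((integrable_const _).indicator hS) (integrable_const _),
    integral_indicator_const _ hS, h.prob_selection, hv]
  simp
  ring

/-- The fluctuations in different steps are uncorrelated. -/
theorem IsChainLaw.integral_noise_mul_noise (h : IsChainLaw ν π φ n)
    (hu : IsMissProbability u k n (π none) π₁) (hv0 : 0 ≤ v) (hv1 : v ≤ 1)
    (hv : v = φ * u 1 + (1 - φ) * u 0) {a b : ℕ} (hab : a < b) :
    ∫ p, noise u v π k a p * noise u v π k b p ∂ν = 0 := by
  set C : ℝ := 2 * (a + 1) * (2 * Fintype.card (Incoming j)) with hC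
  have hC0 : 0 ≤ C := by positivity
  have hD (p : ChainInput j) : |noise u v π k a p| ≤ C := abs_noise_le_of_step hu hv0 hv1 h a p
  have hDm := measurable_noise (u := u) (v := v) (π := π) (k := k) a
  have hym := measurable_chainAge (j := j) k b
  have hmono : stepsBefore j (a + 1) ⊆ stepsBefore j b := fun p hp => by
    rw [mem_stepsBefore] at hp ⊢; omega
  have hg (c : Incoming j) (p : ChainInput j) : |chainGain u v k b c p| ≤ b + 1 :=
    (abs_chainGain_le hu hv0 hv1 b c p).trans (by linarith [chainAge_le (k := k) b p])
  have hDg (c : Incoming j) (p : ChainInput j) :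
      |noise u v π k a p * chainGain u v k b c p| ≤ C * (b + 1) := by
    rw [abs_mul]
    exact mul_le_mul (hD p) (hg c p) (abs_nonneg _) hC0
  have hDgm (c : Incoming j) : Measurable fun p => noise u v π k a p * chainGain u v k b c p :=
    hDm.mul (measurable_chainGain b c)
  have hbit (c : Incoming j) (p : ChainInput j) : |bit c b p| ≤ 1 := by
    rw [abs_of_nonneg (bit_nonneg _ _ _)]; exact bit_le_one _ _ _
  have hint1 (c : Incoming j) :
      Integrable (fun p => noise u v π k a p * chainGain u v k b c p * bit c b p) ν := by
    refine integrable_of_abs_le (C := C * (b + 1) * 1) ((hDgm c).mul (measurable_bit _ _))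
      fun p => ?_
    rw [abs_mul]
    exact mul_le_mul (hDg c p) (hbit c p) (abs_nonneg _) (by positivity)
  have hint2 (c : Incoming j) :
      Integrable (fun p => noise u v π k a p * chainGain u v k b c p * π c) ν :=
    (integrable_of_abs_le (hDgm c) (hDg c)).mul_const _
  -- The factors before the tick of step `b` depend on earlier ticks only, so the centred tick
  -- integrates to zero against them.
  have h1 (c : Incoming j) : ∫ p, (noise u v π k a p * chainGain u v k b c p * bit c b p -
      noise u v π k a p * chainGain u v k b c p * π c) ∂ν = 0 := by
    rw [integral_sub (hint1 c) (hint2 c), h.integral_mul_bit c b (hDgm c), integral_mul_const,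
      sub_self]
    intro κ e e' he
    have e1 := dependsOn_chainGain (u := u) (v := v) (k := k) b c κ he
    have e2 := dependsOn_noise (u := u) (v := v) (π := π) (k := k) a κ fun p hp => he p (hmono hp)
    dsimp only at e1 e2 ⊢
    rw [e1, e2]
  -- The fresh selection has a random index. Splitting by the version `L` after `b` steps makes it
  -- the fixed index `L + 1`, while everything else in `G L` uses selections up to `L`.
  let G (L : ℕ) (p : ChainInput j) : ℝ := {p : ChainInput j | (chain k p.1 p.2 b).1 = L}.indicator
    (fun p => noise u v π k a p * (bit none b p * (chainAge k b p + 1))) p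
  have hset (L : ℕ) : MeasurableSet {p : ChainInput j | (chain k p.1 p.2 b).1 = L} :=
    measurable_chain k b (MeasurableSet.of_discrete (s := {s : ChainState m | s.1 = L}))
  have hGm (L : ℕ) : Measurable (G L) :=
    (hDm.mul ((measurable_bit _ _).mul (hym.add_const 1))).indicator (hset L)
  have hGb (L : ℕ) (p : ChainInput j) : |G L p| ≤ C * (b + 1) := by
    simp only [G, Set.indicator_apply]
    split_ifs
    · have h0 := bit_nonneg none b p
      have h4 := bit_le_one none b p
      have h5 := chainAge_nonneg (k := k) b p
      have h6 := chainAge_le (k := k) b p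
      rw [abs_mul, abs_of_nonneg (mul_nonneg h0 (by linarith : 0 ≤ chainAge k b p + 1))]
      exact mul_le_mul (hD p) (by nlinarith) (by positivity) hC0
    · rw [abs_zero]; positivity
  have hsel (L : ℕ) : Measurable fun p : ChainInput j => selectionDev j u v (p.2 (L + 1)) :=
    (Measurable.of_discrete (f := selectionDev j u v)).comp
      ((measurable_pi_apply (L + 1)).comp measurable_snd)
  have hGint (L : ℕ) : Integrable (fun p => G L p * selectionDev j u v (p.2 (L + 1))) ν := by
    refine integrable_of_abs_le (C := C * (b + 1) * 1) ((hGm L).mul (hsel L)) fun p => ?_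
    rw [abs_mul]
    exact mul_le_mul (hGb L p) (abs_selectionDev_le hu hv0 hv1 _) (abs_nonneg _) (by positivity)
  have h2 (L : ℕ) : ∫ p, G L p * selectionDev j u v (p.2 (L + 1)) ∂ν = 0 := by
    -- The roles are swapped here: the selections are the independent family and all the ticks are
    -- the extra variable.
    have h3 := integral_mul_of_dependsOn (μ := ν) (X := fun ℓ (p : ChainInput j) => p.2 ℓ)
      (Z := Prod.fst) (fun ℓ => (measurable_pi_apply ℓ).comp measurable_snd) measurable_fst
      h.indep_selections h.indep.symm (S := Finset.range (L + 1)) (T := {L + 1}) (by simp)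
      (Φ := fun z => G L (z.2, z.1)) ((hGm L).comp measurable_swap) ?_
      (Ψ := fun κ => selectionDev j u v (κ (L + 1)))
      ((Measurable.of_discrete (f := selectionDev j u v)).comp (measurable_pi_apply (L + 1))) ?_
    · rw [h.integral_selectionDev hv, mul_zero] at h3
      exact h3
    · intro e κ κ' hκ
      have hκ' (l : ℕ) (hl : l ≤ L) : κ l = κ' l := hκ l (by simp; omega)
      have hN : (chain k e κ b).1 = (chain k e κ' b).1 := chain_version_congr κ' b
      by_cases hL : (chain k e κ b).1 = L
      · simp only [G]
        rw [Set.indicator_of_mem (by exact hL),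
          Set.indicator_of_mem (by exact hN.symm.trans hL)]
        rw [noise_congr_selection a fun l hl =>
          hκ' l (hL ▸ hl.trans (chain_version_mono (show a + 1 ≤ b from hab)))]
        simp only [chainAge, bit]
        rw [chain_congr_selection b fun l hl => hκ' l (hL ▸ hl)]
      · simp only [G]
        rw [Set.indicator_of_notMem (by exact hL),
          Set.indicator_of_notMem (by exact fun h => hL (hN.trans h))]
    · intro κ κ' hκ
      simp only
      rw [hκ (L + 1) (by simp)]
  have hsplit (p : ChainInput j) : noise u v π k a p * noise u v π k b p =
      ∑ c, (noise u v π k a p * chainGain u v k b c p * bit c b p -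
        noise u v π k a p * chainGain u v k b c p * π c) +
      ∑ L ∈ Finset.range (b + 1), G L p * selectionDev j u v (p.2 (L + 1)) := by
    rw [Finset.sum_eq_single_of_mem (chain k p.1 p.2 b).1
      (Finset.mem_range.2 (Nat.lt_succ_of_le (chain_version_le b)))]
    · simp only [G]
      rw [Set.indicator_of_mem (by rfl)]
      conv_lhs => rw [noise.eq_def u v π k b]
      rw [mul_add, Finset.mul_sum]
      congr 1
      · exact Finset.sum_congr rfl fun c _ => by ring
      · ring
    · intro L _ hL
      simp only [G]
      rw [Set.indicator_of_notMem (by exact hL.symm), zero_mul]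
  simp_rw [hsplit]
  have hint3 (c : Incoming j) : Integrable (fun p => noise u v π k a p * chainGain u v k b c p *
      bit c b p - noise u v π k a p * chainGain u v k b c p * π c) ν := (hint1 c).sub (hint2 c)
  rw [integral_add (integrable_finsetSum _ fun c _ => hint3 c)
    (integrable_finsetSum _ fun L _ => hGint L),
    integral_finsetSum _ fun c _ => hint3 c, integral_finsetSum _ fun L _ => hGint L]
  simp [h1, h2]

/-- Of the square of `∑ (bit + π)`, one factor is bounded by a constant and the other is kept, so
the bound is proportional to the tick probabilities. Summed over all steps it then grows like
elapsed time, not like the number of steps. -/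
theorem IsChainLaw.integral_noise_sq_le (h : IsChainLaw ν π φ n)
    (hu : IsMissProbability u k n (π none) π₁) (hv0 : 0 ≤ v) (hv1 : v ≤ 1) (i : ℕ) {B : ℝ}
    (hB : ∫ p, (chainAge k i p + 1) ^ 2 ∂ν ≤ B) :
    ∫ p, noise u v π k i p ^ 2 ∂ν ≤ 16 * Fintype.card (Incoming j) * B * ∑ c, π c := by
  set d : ℝ := (Fintype.card (Incoming j) : ℝ)
  have hym : Measurable fun p : ChainInput j => (chainAge k i p + 1) ^ 2 :=
    ((measurable_chainAge k i).add_const 1).pow_const 2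
  have hyb (p : ChainInput j) : |(chainAge k i p + 1) ^ 2| ≤ ((i : ℝ) + 1) ^ 2 := by
    rw [abs_of_nonneg (sq_nonneg _)]
    have := chainAge_nonneg (k := k) i p
    exact pow_le_pow_left₀ (by linarith) (by linarith [chainAge_le (k := k) i p]) 2
  have hint1 (c : Incoming j) : Integrable (fun p => (chainAge k i p + 1) ^ 2 * bit c i p) ν := by
    refine integrable_of_abs_le (C := ((i : ℝ) + 1) ^ 2 * 1) (hym.mul (measurable_bit _ _))
      fun p => ?_
    rw [abs_mul, abs_of_nonneg (bit_nonneg c i p)]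
    exact mul_le_mul (hyb p) (bit_le_one c i p) (bit_nonneg c i p) (by positivity)
  have hint2 (c : Incoming j) : Integrable (fun p => (chainAge k i p + 1) ^ 2 * π c) ν :=
    (integrable_of_abs_le hym hyb).mul_const _
  have h1 : ∫ p, noise u v π k i p ^ 2 ∂ν ≤
      ∫ p, 8 * d * ∑ c, ((chainAge k i p + 1) ^ 2 * bit c i p +
      (chainAge k i p + 1) ^ 2 * π c) ∂ν := by
    refine integral_mono ?_ ((integrable_finsetSum _ fun c _ =>
      (hint1 c).add (hint2 c)).const_mul _) fun p => ?_
    · refine integrable_of_abs_le (C := (2 * (i + 1) * (2 * d)) ^ 2)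
        ((measurable_noise i).pow_const 2) fun p => ?_
      rw [abs_of_nonneg (sq_nonneg _), ← sq_abs]
      exact pow_le_pow_left₀ (abs_nonneg _) (abs_noise_le_of_step hu hv0 hv1 h i p) 2
    · dsimp only
      have hle := abs_noise_le hu hv0 hv1 h.nonneg i p
      have hs0 : 0 ≤ ∑ c, (bit c i p + π c) :=
        Finset.sum_nonneg fun c _ => add_nonneg (bit_nonneg c i p) (h.nonneg c)
      have hs : ∑ c, (bit c i p + π c) ≤ 2 * d := by
        refine (Finset.sum_le_sum fun c _ => add_le_add (bit_le_one c i p) (h.le_one c)).trans ?_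
        rw [Finset.sum_const, nsmul_eq_mul, Finset.card_univ]
        linarith
      simp_rw [← mul_add]
      rw [← Finset.mul_sum, ← sq_abs]
      calc |noise u v π k i p| ^ 2 ≤ (2 * (chainAge k i p + 1) * ∑ c, (bit c i p + π c)) ^ 2 :=
            pow_le_pow_left₀ (abs_nonneg _) hle 2
        _ = 4 * (chainAge k i p + 1) ^ 2 * ((∑ c, (bit c i p + π c)) * ∑ c, (bit c i p + π c)) := by
            ring
        _ ≤ 4 * (chainAge k i p + 1) ^ 2 * (2 * d * ∑ c, (bit c i p + π c)) := by gcongr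
        _ = _ := by ring
  refine h1.trans ?_
  have hdep (κ : ℕ → Finset (Fin m)) :
      DependsOn (fun e : Incoming j × ℕ → ℕ => (chainAge k i (e, κ) + 1) ^ 2) (stepsBefore j i) :=
    fun e e' he => by
      have := dependsOn_chainAge (k := k) i κ he
      dsimp only at this ⊢
      rw [this]
  have hint3 (c : Incoming j) : Integrable (fun p => (chainAge k i p + 1) ^ 2 * bit c i p +
      (chainAge k i p + 1) ^ 2 * π c) ν := (hint1 c).add (hint2 c)
  rw [integral_const_mul, integral_finsetSum _ fun c _ => hint3 c]
  have h2 : ∀ c ∈ Finset.univ, ∫ p, ((chainAge k i p + 1) ^ 2 * bit c i p +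
      (chainAge k i p + 1) ^ 2 * π c) ∂ν ≤ 2 * B * π c := by
    intro c _
    rw [integral_add (hint1 c) (hint2 c), h.integral_mul_bit c i hym hdep, integral_mul_const]
    have := mul_le_mul_of_nonneg_right hB (h.nonneg c)
    linarith
  refine (mul_le_mul_of_nonneg_left (Finset.sum_le_sum h2) (by positivity)).trans (le_of_eq ?_)
  rw [← Finset.mul_sum]
  ring

theorem IsChainLaw.integral_sum_noise_sq_le (h : IsChainLaw ν π φ n)
    (hu : IsMissProbability u k n (π none) π₁) (hv0 : 0 ≤ v) (hv1 : v ≤ 1)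
    (hv : v = φ * u 1 + (1 - φ) * u 0) {B : ℝ}
    (hB : ∀ i, ∫ p, (chainAge k i p + 1) ^ 2 ∂ν ≤ B) (Q : ℕ) :
    ∫ p, (∑ i ∈ Finset.range Q, noise u v π k i p) ^ 2 ∂ν ≤
      Q * (16 * Fintype.card (Incoming j) * B * ∑ c, π c) := by
  rw [integral_sum_sq_eq_of_orthogonal Q ?_ fun a b hab _ =>
    h.integral_noise_mul_noise hu hv0 hv1 hv hab]
  · refine (Finset.sum_le_sum fun i _ => h.integral_noise_sq_le hu hv0 hv1 i (hB i)).trans ?_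
    simp
  · intro a b
    refine integrable_of_abs_le (C := 2 * (a + 1) * (2 * Fintype.card (Incoming j)) *
      (2 * (b + 1) * (2 * Fintype.card (Incoming j))))
      ((measurable_noise a).mul (measurable_noise b)) fun p => ?_
    rw [abs_mul]
    exact mul_le_mul (abs_noise_le_of_step hu hv0 hv1 h a p) (abs_noise_le_of_step hu hv0 hv1 h b p)
      (abs_nonneg _) (by positivity)

end Noise

/-! ### Discretising Poisson counters -/

section Grid

variable {Ω : Type*} [MeasurableSpace Ω] {μ : Measure Ω} {m : ℕ} {j : Fin m}

/-- The counters `C` that matter for node `j` are independent Poisson counters with rates `r`, and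
they are independent of the independent selections `κ`, which consist of `n` nodes and contain `j`
with probability `φ`. -/
structure IsIncomingNetwork (C : Incoming j → ℝ≥0 → Ω → ℕ) (κ : ℕ → Ω → Finset (Fin m))
    (r : Incoming j → ℝ≥0) (φ : ℝ) (n : ℕ) (μ : Measure Ω) : Prop where
  counter : ∀ c, IsPoissonCounter (C c) (r c) μ
  indep_counters : iIndepFun (fun c ω t => C c t ω) μ
  measurable_selection : ∀ ℓ, Measurable (κ ℓ)
  indep_selections : iIndepFun κ μ
  indep : IndepFun (fun ω c t => C c t ω) (fun ω ℓ => κ ℓ ω) μ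
  prob_selection : ∀ ℓ, μ.real {ω | j ∈ κ ℓ ω} = φ
  card_selection : ∀ᵐ ω ∂μ, ∀ ℓ, (κ ℓ ω).card = n

/-- The number of ticks of each counter in the time steps of length `1 / q`. -/
noncomputable def gridTicks (C : Incoming j → ℝ≥0 → Ω → ℕ) (q : ℕ) (p : Incoming j × ℕ)
    (ω : Ω) : ℕ :=
  C p.1 (((p.2 + 1 : ℕ) : ℝ≥0) / q) ω - C p.1 ((p.2 : ℝ≥0) / q) ω

/-- The chain input that is read off from the counters in time steps of length `1 / q`. -/
noncomputable def gridInput (C : Incoming j → ℝ≥0 → Ω → ℕ) (κ : ℕ → Ω → Finset (Fin m))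
    (q : ℕ) (ω : Ω) : ChainInput j :=
  (fun p => gridTicks C q p ω, fun ℓ => κ ℓ ω)

/-- The probability of a tick in a time step of length `1 / q`. -/
noncomputable def tickProb (r : Incoming j → ℝ≥0) (q : ℕ) (c : Incoming j) : ℝ :=
  1 - Real.exp (-(r c / q))

theorem tickProb_le (r : Incoming j → ℝ≥0) (q : ℕ) (c : Incoming j) :
    tickProb r q c ≤ r c / q := by
  have := Real.add_one_le_exp (-((r c : ℝ) / q))
  unfold tickProb
  linarith

variable {C : Incoming j → ℝ≥0 → Ω → ℕ} {κ : ℕ → Ω → Finset (Fin m)} {r : Incoming j → ℝ≥0}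
  {φ : ℝ} {n k : ℕ} [IsProbabilityMeasure μ]

omit [IsProbabilityMeasure μ] in
theorem measureReal_increment_eq_zero {N : ℝ≥0 → Ω → ℕ} {ρ : ℝ≥0} (h : IsPoissonCounter N ρ μ)
    {s t : ℝ≥0} (hst : s ≤ t) :
    μ.real {ω | N t ω - N s ω = 0} = Real.exp (-((ρ * (t - s) : ℝ≥0) : ℝ)) := by
  have h1 := (h.law s t hst).measureReal_eq (p := fun x => x = 0) MeasurableSet.of_discrete
  rw [h1]
  have := poissonMeasure_real_singleton (ρ * (t - s)) 0
  simpa using this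

theorem measureReal_increment_pos {N : ℝ≥0 → Ω → ℕ} {ρ : ℝ≥0} (h : IsPoissonCounter N ρ μ)
    {s t : ℝ≥0} (hst : s ≤ t) :
    μ.real {ω | 0 < N t ω - N s ω} = 1 - Real.exp (-((ρ * (t - s) : ℝ≥0) : ℝ)) := by
  have hm : MeasurableSet {ω | N t ω - N s ω = 0} :=
    ((h.measurable t).sub (h.measurable s)) (measurableSet_singleton 0)
  rw [← measureReal_increment_eq_zero h hst, ← probReal_compl_eq_one_sub hm]
  congr 1
  ext ω
  exact Nat.pos_iff_ne_zero

omit [IsProbabilityMeasure μ] in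
theorem measureReal_two_le_increment_le {N : ℝ≥0 → Ω → ℕ} {ρ : ℝ≥0} (h : IsPoissonCounter N ρ μ)
    {s t : ℝ≥0} (hst : s ≤ t) :
    μ.real {ω | 2 ≤ N t ω - N s ω} ≤ ((ρ * (t - s) : ℝ≥0) : ℝ) ^ 2 := by
  set x := ρ * (t - s) with hx
  rw [(h.law s t hst).measureReal_eq (p := fun x => 2 ≤ x) MeasurableSet.of_discrete, ← hx]
  have h01 : {y : ℕ | 2 ≤ y} = ({0, 1} : Set ℕ)ᶜ := by
    ext y; simp; omega
  rw [h01, probReal_compl_eq_one_sub MeasurableSet.of_discrete, Set.insert_eq,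
    measureReal_union (by simp) MeasurableSet.of_discrete, poissonMeasure_real_singleton,
    poissonMeasure_real_singleton]
  -- With `exp (-x) ≥ 1 - x`, the probability `1 - exp (-x) * (1 + x)` is at most `1 - (1 - x) * (1
  -- + x) = x ^ 2`.
  have h1 := Real.add_one_le_exp (-(x : ℝ))
  have h2 : (0 : ℝ) ≤ x := x.2
  simp
  nlinarith

theorem grid_sub (q i : ℕ) :
    ((i + 1 : ℕ) : ℝ≥0) / q - (i : ℝ≥0) / q = 1 / q := by
  rw [← NNReal.sub_div]; simp

theorem grid_mono (q : ℕ) : Monotone fun i : ℕ => (i : ℝ≥0) / q := fun i i' h => by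
  dsimp only; gcongr

omit [IsProbabilityMeasure μ] in
theorem IsIncomingNetwork.measurable_gridTicks (h : IsIncomingNetwork C κ r φ n μ) (q : ℕ)
    (p : Incoming j × ℕ) : Measurable (gridTicks C q p) :=
  ((h.counter p.1).measurable _).sub ((h.counter p.1).measurable _)

omit [IsProbabilityMeasure μ] in
theorem IsIncomingNetwork.measurable_gridInput (h : IsIncomingNetwork C κ r φ n μ) (q : ℕ) :
    Measurable (gridInput C κ q) :=
  (measurable_pi_iff.2 fun p => h.measurable_gridTicks q p).prodMk
    (measurable_pi_iff.2 h.measurable_selection)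

omit [IsProbabilityMeasure μ] in
-- Independence of the counters across `c` combines with independent increments of each counter
-- across the steps.
theorem IsIncomingNetwork.iIndepFun_gridTicks (h : IsIncomingNetwork C κ r φ n μ) (q : ℕ) :
    iIndepFun (gridTicks C q) μ := by
  refine iIndepFun_uncurry' (X := fun c i ω => gridTicks C q (c, i) ω)
    (fun c i => h.measurable_gridTicks q (c, i)) ?_ fun c => ?_
  · exact h.indep_counters.comp
      (fun _ (f : ℝ≥0 → ℕ) (i : ℕ) => f (((i + 1 : ℕ) : ℝ≥0) / q) - f ((i : ℝ≥0) / q))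
      fun c => measurable_pi_iff.2 fun i =>
        (measurable_pi_apply _).sub (measurable_pi_apply _)
  · exact (h.counter c).indepIncrements.nat (grid_mono q)

theorem IsIncomingNetwork.isChainLaw (h : IsIncomingNetwork C κ r φ n μ) (q : ℕ) :
    IsChainLaw (μ.map (gridInput C κ q)) (tickProb r q) φ n := by
  have hP := h.measurable_gridInput q
  have : IsProbabilityMeasure (μ.map (gridInput C κ q)) :=
    Measure.isProbabilityMeasure_map hP.aemeasurable
  have hm1 (p : Incoming j × ℕ) : Measurable fun x : ChainInput j => x.1 p :=
    (measurable_pi_apply p).comp measurable_fst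
  have hm2 (ℓ : ℕ) : Measurable fun x : ChainInput j => x.2 ℓ :=
    (measurable_pi_apply ℓ).comp measurable_snd
  refine ⟨?_, ?_, ?_, ?_, ?_, ?_⟩
  · rw [iIndepFun_iff_map_fun_eq_infinitePi_map hm1, Measure.map_map (by fun_prop) hP]
    have h1 := (iIndepFun_iff_map_fun_eq_infinitePi_map (h.measurable_gridTicks q)).1
      (h.iIndepFun_gridTicks q)
    refine h1.trans ?_
    congr 1
    ext1 p
    rw [Measure.map_map (by fun_prop) hP]
    rfl
  · rw [iIndepFun_iff_map_fun_eq_infinitePi_map hm2, Measure.map_map (by fun_prop) hP]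
    have h1 := (iIndepFun_iff_map_fun_eq_infinitePi_map h.measurable_selection).1
      h.indep_selections
    refine h1.trans ?_
    congr 1
    ext1 p
    rw [Measure.map_map (by fun_prop) hP]
    rfl
  · have h1 : IndepFun (fun ω p => gridTicks C q p ω) (fun ω ℓ => κ ℓ ω) μ :=
      h.indep.comp (φ := fun (f : Incoming j → ℝ≥0 → ℕ) (p : Incoming j × ℕ) =>
        f p.1 (((p.2 + 1 : ℕ) : ℝ≥0) / q) - f p.1 ((p.2 : ℝ≥0) / q)) (ψ := id)
        (measurable_pi_iff.2 fun p => Measurable.sub (by fun_prop) (by fun_prop)) measurable_id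
    have h2 := h1.map_prod_eq_prod_map_map (hP.fst).aemeasurable (hP.snd).aemeasurable
    rw [indepFun_iff_map_prod_eq_prod_map_map measurable_fst.aemeasurable
      measurable_snd.aemeasurable, Measure.map_map measurable_fst hP,
      Measure.map_map measurable_snd hP]
    simp only [Prod.mk.eta, Measure.map_id']
    exact h2
  · intro c i
    have hm : Measurable fun p : ChainInput j => (tick (p.1 (c, i)) : ℝ) := measurable_bit c i
    rw [integral_map hP.aemeasurable hm.aestronglyMeasurable]
    have h1 : ∀ ω, (tick ((gridInput C κ q ω).1 (c, i)) : ℝ) =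
        {ω | 0 < gridTicks C q (c, i) ω}.indicator 1 ω := by
      intro ω
      by_cases hx : 0 < gridTicks C q (c, i) ω <;> simp [gridInput, tick, hx, Set.indicator]
    have hS : MeasurableSet {ω | 0 < gridTicks C q (c, i) ω} :=
      h.measurable_gridTicks q (c, i) (MeasurableSet.of_discrete (s := Set.Ioi 0))
    simp_rw [h1]
    rw [integral_indicator_one hS]
    simp only [gridTicks]
    rw [measureReal_increment_pos (h.counter c) (grid_mono q (Nat.le_succ i)), grid_sub, tickProb]
    congr 3
    push_cast
    ring
  · intro ℓ
    have hm : Measurable fun p : ChainInput j => p.2 ℓ :=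
      (measurable_pi_apply ℓ).comp measurable_snd
    have hS : MeasurableSet {p : ChainInput j | j ∈ p.2 ℓ} :=
      hm (MeasurableSet.of_discrete (s := {A : Finset (Fin m) | j ∈ A}))
    rw [map_measureReal_apply hP hS]
    exact h.prob_selection ℓ
  · have hS : MeasurableSet {p : ChainInput j | ∀ ℓ, (p.2 ℓ).card = n} := by
      rw [Set.ofPred_forall]
      refine MeasurableSet.iInter fun ℓ => ?_
      have hm : Measurable fun p : ChainInput j => p.2 ℓ :=
        (measurable_pi_apply ℓ).comp measurable_snd
      exact hm (MeasurableSet.of_discrete (s := {A : Finset (Fin m) | A.card = n}))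
    rw [ae_map_iff hP.aemeasurable hS]
    exact h.card_selection

/-- A lower bound for the probability that all incoming edges but not the source tick during a
time interval of unit length. -/
noncomputable def allTickProb (r : Incoming j → ℝ≥0) : ℝ :=
  Real.exp (-r none) * ∏ a : {a : Fin m // a ≠ j}, (1 - Real.exp (-r (some a)))

theorem allTickProb_pos (hr : ∀ c, 0 < r c) : 0 < allTickProb r := by
  refine mul_pos (Real.exp_pos _) (Finset.prod_pos fun a _ => ?_)
  rw [sub_pos, Real.exp_lt_one_iff]
  exact neg_neg_of_pos (hr _)

omit [MeasurableSpace Ω] in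
theorem allTick_of_increments {q i : ℕ} {ω : Ω} (hC : ∀ c, Monotone fun t => C c t ω)
    (h0 : C none (((i + q : ℕ) : ℝ≥0) / q) ω - C none ((i : ℝ≥0) / q) ω = 0)
    (ha : ∀ a, 0 < C (some a) (((i + q : ℕ) : ℝ≥0) / q) ω - C (some a) ((i : ℝ≥0) / q) ω) :
    AllTick i q fun p => gridTicks C q p ω := by
  constructor
  · intro l hl
    have h1 : C none ((i : ℝ≥0) / q) ω ≤ C none (((i + l : ℕ) : ℝ≥0) / q) ω :=
      hC none (grid_mono q (by omega))
    have h2 : C none (((i + l + 1 : ℕ) : ℝ≥0) / q) ω ≤ C none (((i + q : ℕ) : ℝ≥0) / q) ω :=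
      hC none (grid_mono q (by omega))
    simp only [gridTicks]
    omega
  · intro a
    by_contra! hcon
    have h1 : ∀ l ≤ q, C (some a) (((i + l : ℕ) : ℝ≥0) / q) ω = C (some a) ((i : ℝ≥0) / q) ω := by
      intro l
      induction l with
      | zero => simp
      | succ l ih =>
        intro hl
        have h2 := hcon l (by omega)
        have h3 : C (some a) (((i + l : ℕ) : ℝ≥0) / q) ω ≤
            C (some a) (((i + l + 1 : ℕ) : ℝ≥0) / q) ω := hC (some a) (grid_mono q (by omega))
        simp only [gridTicks] at h2
        rw [← add_assoc]
        have := ih (by omega)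
        omega
    have := ha a
    rw [h1 q le_rfl] at this
    omega

/-- A window of `q` steps has unit length for every `q`, so the reset probability has a lower bound
that does not depend on the grid. -/
theorem IsIncomingNetwork.integral_missIndicator_le (h : IsIncomingNetwork C κ r φ n μ) {q : ℕ}
    (hq : 0 < q) (i : ℕ) :
    ∫ p, missIndicator i q p.1 ∂(μ.map (gridInput C κ q)) ≤ 1 - allTickProb r := by
  have hP := h.measurable_gridInput q
  have hA : MeasurableSet {ω | AllTick i q fun p => gridTicks C q p ω} :=
    hP.fst (measurableSet_allTick i q)
  have hm : Measurable fun p : ChainInput j => missIndicator i q p.1 :=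
    (measurable_missIndicator i q).comp measurable_fst
  rw [integral_map hP.aemeasurable hm.aestronglyMeasurable]
  have h1 : ∀ ω, missIndicator i q (gridInput C κ q ω).1 =
      {ω | AllTick i q fun p => gridTicks C q p ω}ᶜ.indicator 1 ω := fun ω => rfl
  simp_rw [h1]
  rw [integral_indicator_one hA.compl, probReal_compl_eq_one_sub hA]
  refine sub_le_sub_left ?_ 1
  let s (c : Incoming j) : Set ℕ := c.elim {0} fun _ => Set.Ioi 0
  have hle : (i : ℝ≥0) / q ≤ ((i + q : ℕ) : ℝ≥0) / q := grid_mono q (by omega)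
  have hlen : ((i + q : ℕ) : ℝ≥0) / q - (i : ℝ≥0) / q = 1 := by
    rw [← NNReal.sub_div]
    have : (q : ℝ≥0) ≠ 0 := by exact_mod_cast hq.ne'
    simp [this]
  have hind : iIndepFun (fun c ω => C c (((i + q : ℕ) : ℝ≥0) / q) ω - C c ((i : ℝ≥0) / q) ω) μ :=
    h.indep_counters.comp (fun _ f => f (((i + q : ℕ) : ℝ≥0) / q) - f ((i : ℝ≥0) / q))
      fun _ => (measurable_pi_apply _).sub (measurable_pi_apply _)
  have h2 := hind.meas_iInter (s := fun c =>
    (fun ω => C c (((i + q : ℕ) : ℝ≥0) / q) ω - C c ((i : ℝ≥0) / q) ω) ⁻¹' s c)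
    fun c => ⟨s c, MeasurableSet.of_discrete, rfl⟩
  have h3 : allTickProb r = μ.real (⋂ c,
      (fun ω => C c (((i + q : ℕ) : ℝ≥0) / q) ω - C c ((i : ℝ≥0) / q) ω) ⁻¹' s c) := by
    rw [measureReal_def, h2, ENNReal.toReal_prod, Fintype.prod_option, allTickProb]
    congr 1
    · have := measureReal_increment_eq_zero (h.counter none) hle
      rw [hlen, mul_one] at this
      exact this.symm
    · refine Finset.prod_congr rfl fun a _ => ?_
      have := measureReal_increment_pos (h.counter (some a)) hle
      rw [hlen, mul_one] at this
      exact this.symm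
  rw [h3]
  refine measureReal_mono fun ω hω => ?_
  rw [Set.mem_iInter] at hω
  exact allTick_of_increments (fun c => (h.counter c).mono ω) (hω none) fun a => hω (some a)

theorem IsIncomingNetwork.measureReal_two_le_sum_gridTicks_le (h : IsIncomingNetwork C κ r φ n μ)
    (q i : ℕ) :
    μ.real {ω | 2 ≤ ∑ c, gridTicks C q (c, i) ω} ≤ ((∑ c, (r c : ℝ)) / q) ^ 2 := by
  classical
  have hle := grid_mono q (Nat.le_succ i)
  have hx (c : Incoming j) : (((r c) * (((i + 1 : ℕ) : ℝ≥0) / q - (i : ℝ≥0) / q) : ℝ≥0) : ℝ) =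
      r c / q := by
    rw [grid_sub]; push_cast; ring
  have hpos (c : Incoming j) : μ.real {ω | 0 < gridTicks C q (c, i) ω} ≤ r c / q := by
    have h1 := measureReal_increment_pos (h.counter c) hle
    rw [hx] at h1
    exact h1.trans_le (tickProb_le r q c)
  have htwo (c : Incoming j) : μ.real {ω | 2 ≤ gridTicks C q (c, i) ω} ≤ (r c / q) ^ 2 := by
    have h1 := measureReal_two_le_increment_le (h.counter c) hle
    rw [hx] at h1
    exact h1
  -- Two ticks come from one counter twice or from two independent counters. Either way the pair
  -- costs at most `(r c / q) * (r c' / q)`, and summing over pairs gives a square.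
  let E (c c' : Incoming j) : Set Ω := if c = c' then {ω | 2 ≤ gridTicks C q (c, i) ω}
    else {ω | 0 < gridTicks C q (c, i) ω} ∩ {ω | 0 < gridTicks C q (c', i) ω}
  have hE (c c' : Incoming j) : μ.real (E c c') ≤ (r c / q) * (r c' / q) := by
    by_cases hc : c = c'
    · subst hc
      simp only [E, if_true]
      exact (htwo c).trans_eq (sq _)
    · simp only [E, if_neg hc]
      have hind := ((h.iIndepFun_gridTicks q).indepFun
        (i := (c, i)) (j := (c', i)) (by simpa using hc)).measure_inter_preimage_eq_mul
        (Set.Ioi 0) (Set.Ioi 0) MeasurableSet.of_discrete MeasurableSet.of_discrete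
      have h1 : μ.real ({ω | 0 < gridTicks C q (c, i) ω} ∩ {ω | 0 < gridTicks C q (c', i) ω}) =
          μ.real {ω | 0 < gridTicks C q (c, i) ω} * μ.real {ω | 0 < gridTicks C q (c', i) ω} := by
        rw [measureReal_def, measureReal_def, measureReal_def, ← ENNReal.toReal_mul]
        exact congrArg _ hind
      rw [h1]
      exact mul_le_mul (hpos c) (hpos c') measureReal_nonneg (by positivity)
  have hsub : {ω | 2 ≤ ∑ c, gridTicks C q (c, i) ω} ⊆ ⋃ c, ⋃ c', E c c' := by
    intro ω hω
    by_contra hcon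
    simp only [Set.mem_iUnion, not_exists] at hcon
    have h1 (c : Incoming j) : gridTicks C q (c, i) ω ≤ 1 := by
      have := hcon c c
      simp only [E, if_true, Set.mem_ofPred_eq] at this
      omega
    have h2 : ∑ c, gridTicks C q (c, i) ω ≤ 1 := by
      by_cases h0 : ∀ c, gridTicks C q (c, i) ω = 0
      · simp [h0]
      · push Not at h0
        obtain ⟨c, hc⟩ := h0
        rw [Finset.sum_eq_single c]
        · exact h1 c
        · intro c' _ hne
          have := hcon c c'
          simp only [E, if_neg hne.symm, Set.mem_inter_iff, Set.mem_ofPred_eq] at this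
          omega
        · simp
    have : 2 ≤ ∑ c, gridTicks C q (c, i) ω := hω
    omega
  calc μ.real {ω | 2 ≤ ∑ c, gridTicks C q (c, i) ω} ≤ μ.real (⋃ c, ⋃ c', E c c') :=
        measureReal_mono hsub
    _ ≤ ∑ c, μ.real (⋃ c', E c c') := measureReal_iUnion_fintype_le _
    _ ≤ ∑ c, ∑ c', μ.real (E c c') :=
        Finset.sum_le_sum fun c _ => measureReal_iUnion_fintype_le _
    _ ≤ ∑ c, ∑ c', (r c / q : ℝ) * (r c' / q) :=
        Finset.sum_le_sum fun c _ => Finset.sum_le_sum fun c' _ => hE c c'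
    _ = _ := by rw [sq, Finset.sum_div, Finset.sum_mul_sum]

end Grid

/-! ### Miss probabilities and deterministic limits -/

section Limits

/-- The probability that a node with `r` keys does not decrypt before the next update, where `θ` is
the ratio of the rates of an edge and of the source. -/
noncomputable def missProb (θ : ℝ) (k n r : ℕ) : ℝ :=
  1 - ∏ i ∈ Finset.Ico r (k + 1), (((n : ℝ) - i) * θ / (((n : ℝ) - i) * θ + 1))

theorem missProb_factor_mem {θ : ℝ} (hθ : 0 ≤ θ) {k n r i : ℕ} (hkn : k < n)
    (hi : i ∈ Finset.Ico r (k + 1)) :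
    0 ≤ ((n : ℝ) - i) * θ / (((n : ℝ) - i) * θ + 1) ∧
      ((n : ℝ) - i) * θ / (((n : ℝ) - i) * θ + 1) ≤ 1 := by
  rw [Finset.mem_Ico] at hi
  have h1 : (i : ℝ) ≤ n := by exact_mod_cast (by omega : i ≤ n)
  have h2 : 0 ≤ ((n : ℝ) - i) * θ := mul_nonneg (by linarith) hθ
  exact ⟨by positivity, (div_le_one (by positivity)).2 (by linarith)⟩

/-- Splitting off the first factor of the product relates the success probabilities from `r` and `r
+ 1` keys; clearing denominators gives the balance equation. It is exact for any ratio `π₁ / π₀`,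
hence on every grid. -/
theorem isMissProbability_missProb {π₀ π₁ : ℝ} (h0 : 0 < π₀) (h1 : 0 ≤ π₁) {k n : ℕ} (hkn : k < n) :
    IsMissProbability (missProb (π₁ / π₀) k n) k n π₀ π₁ := by
  have hθ : 0 ≤ π₁ / π₀ := by positivity
  have hstep (r : ℕ) (hr : r ≤ k) : 1 - missProb (π₁ / π₀) k n r =
      ((n : ℝ) - r) * (π₁ / π₀) / (((n : ℝ) - r) * (π₁ / π₀) + 1) *
        (1 - missProb (π₁ / π₀) k n (r + 1)) := by
    unfold missProb
    rw [sub_sub_cancel, sub_sub_cancel, Finset.prod_eq_prod_Ico_succ_bot (by omega)]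
  have hnn (r : ℕ) : 0 ≤ missProb (π₁ / π₀) k n r :=
    sub_nonneg.2 (Finset.prod_le_one (fun i hi => (missProb_factor_mem hθ hkn hi).1)
      fun i hi => (missProb_factor_mem hθ hkn hi).2)
  have hle (r : ℕ) : missProb (π₁ / π₀) k n r ≤ 1 :=
    sub_le_self _ (Finset.prod_nonneg fun i hi => (missProb_factor_mem hθ hkn hi).1)
  have hz (r : ℕ) (hr : k + 1 ≤ r) : missProb (π₁ / π₀) k n r = 0 := by
    rw [missProb, Finset.Ico_eq_empty (by omega), Finset.prod_empty, sub_self]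
  refine ⟨hnn, hle, fun r => ?_, hz, fun r hr => ?_⟩
  · rcases le_or_gt r k with hr | hr
    · have h2 := missProb_factor_mem (r := r) hθ hkn (i := r) (by simp; omega)
      have h3 := hstep r hr
      have h4 : 0 ≤ 1 - missProb (π₁ / π₀) k n (r + 1) := by linarith [hle (r + 1)]
      nlinarith
    · rw [hz r hr, hz (r + 1) (by omega)]
  · have h2 := hstep r hr
    have hnr : (0 : ℝ) ≤ (n : ℝ) - r := by
      rw [sub_nonneg]; exact_mod_cast (by omega : r ≤ n)
    have hpos : ((n : ℝ) - r) * (π₁ / π₀) + 1 ≠ 0 := by positivity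
    rw [div_mul_eq_mul_div, eq_div_iff hpos] at h2
    field_simp at h2
    linarith

theorem tendsto_missProb {θ : ℕ → ℝ} {θ' : ℝ} (hθ' : 0 ≤ θ') (h : Tendsto θ atTop (𝓝 θ')) {k n : ℕ}
    (hkn : k < n) (r : ℕ) :
    Tendsto (fun N => missProb (θ N) k n r) atTop (𝓝 (missProb θ' k n r)) := by
  refine tendsto_const_nhds.sub (tendsto_finsetProd _ fun i hi => ?_)
  rw [Finset.mem_Ico] at hi
  have h1 : (i : ℝ) ≤ n := by exact_mod_cast (by omega : i ≤ n)
  have h2 : 0 ≤ ((n : ℝ) - i) * θ' := mul_nonneg (by linarith) hθ'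
  exact (h.const_mul _).div ((h.const_mul _).add_const 1) (by positivity)

theorem missProb_lt_one {θ : ℝ} (hθ : 0 < θ) {k n : ℕ} (hkn : k < n) (r : ℕ) :
    missProb θ k n r < 1 := by
  refine sub_lt_self _ (Finset.prod_pos fun i hi => ?_)
  rw [Finset.mem_Ico] at hi
  have h1 : (i : ℝ) < n := by exact_mod_cast (by omega : i < n)
  have h2 : 0 < ((n : ℝ) - i) * θ := mul_pos (by linarith) hθ
  positivity

/-- A squeeze from `1 - x ≤ exp (-x) ≤ 1 / (1 + x)` at `x = ρ / q`. -/
theorem tendsto_mul_one_sub_exp_neg_div {q : ℕ → ℕ} (hq : Tendsto q atTop atTop) {ρ : ℝ}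
    (hρ : 0 ≤ ρ) :
    Tendsto (fun N => (q N : ℝ) * (1 - Real.exp (-(ρ / q N)))) atTop (𝓝 ρ) := by
  have hq' : Tendsto (fun N => (q N : ℝ)) atTop atTop := tendsto_natCast_atTop_atTop.comp hq
  have hdiv : Tendsto (fun N => ρ / (1 + ρ / q N)) atTop (𝓝 ρ) := by
    have h1 : Tendsto (fun N => 1 + ρ / (q N : ℝ)) atTop (𝓝 (1 + 0)) :=
      (hq'.const_div_atTop ρ).const_add 1
    have h2 := (tendsto_const_nhds (x := ρ)).div h1 (by norm_num)
    rw [add_zero, div_one] at h2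
    exact h2
  refine tendsto_of_tendsto_of_tendsto_of_le_of_le' hdiv tendsto_const_nhds ?_ ?_
  · filter_upwards [hq.eventually_gt_atTop 0] with N hN
    have hN' : (0 : ℝ) < q N := by exact_mod_cast hN
    have hx : 0 ≤ ρ / q N := by positivity
    have h1 : Real.exp (-(ρ / q N)) ≤ 1 / (1 + ρ / q N) := by
      rw [Real.exp_neg, ← one_div]
      exact one_div_le_one_div_of_le (by positivity) (by linarith [Real.add_one_le_exp (ρ / q N)])
    have h2 : ρ / (1 + ρ / q N) = q N * (1 - 1 / (1 + ρ / q N)) := by field_simp; ring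
    rw [h2]
    gcongr
  · filter_upwards [hq.eventually_gt_atTop 0] with N hN
    have hN' : (0 : ℝ) < q N := by exact_mod_cast hN
    have h1 := Real.add_one_le_exp (-(ρ / q N))
    calc (q N : ℝ) * (1 - Real.exp (-(ρ / q N))) ≤ q N * (ρ / q N) := by gcongr; linarith
      _ = ρ := by field_simp

theorem natFloor_sqrt_sq_bounds {t : ℝ} (ht : 1 ≤ t) :
    1 ≤ ⌊√t⌋₊ ∧ (⌊√t⌋₊ : ℝ) ^ 2 ≤ t ∧ t ≤ ((⌊√t⌋₊ + 1 : ℕ) : ℝ) ^ 2 := by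
  have h0 : 0 ≤ t := by linarith
  refine ⟨Nat.one_le_floor_iff _ |>.2 (Real.one_le_sqrt.2 ht), ?_, ?_⟩
  · exact (Real.le_sqrt (Nat.cast_nonneg _) h0).1 (Nat.floor_le (Real.sqrt_nonneg t))
  · refine (Real.sqrt_le_left (by positivity)).1 ?_
    push_cast
    exact (Nat.lt_floor_add_one _).le

/-- A monotone function grows linearly if it does so along the squares. -/
theorem tendsto_div_of_tendsto_sq {F : ℝ → ℝ} (hF : MonotoneOn F (Set.Ici 0))
    (hF0 : ∀ t, 0 ≤ t → 0 ≤ F t) {x : ℝ}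
    (h : Tendsto (fun N : ℕ => F (((N + 1 : ℕ) : ℝ) ^ 2) / ((N + 1 : ℕ) : ℝ) ^ 2) atTop (𝓝 x)) :
    Tendsto (fun t => F t / t) atTop (𝓝 x) := by
  have hg1 := h
  have hg : Tendsto (fun N : ℕ => F ((N : ℝ) ^ 2) / (N : ℝ) ^ 2) atTop (𝓝 x) :=
    (tendsto_add_atTop_iff_nat 1).1 h
  have hr : Tendsto (fun N : ℕ => (N : ℝ) / ((N + 1 : ℕ) : ℝ)) atTop (𝓝 1) := by
    have := tendsto_natCast_div_add_atTop (1 : ℝ)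
    simpa using this
  have hr' : Tendsto (fun N : ℕ => ((N + 1 : ℕ) : ℝ) / (N : ℝ)) atTop (𝓝 1) := by
    have := hr.inv₀ one_ne_zero
    simpa using this
  -- Consecutive squares have ratio tending to one, so comparing `t` with the squares around it
  -- costs nothing in the limit.
  have hlow := hg.mul (hr.pow 2)
  have hup := hg1.mul (hr'.pow 2)
  rw [one_pow, mul_one] at hlow hup
  have hM : Tendsto (fun t : ℝ => ⌊√t⌋₊) atTop atTop :=
    tendsto_nat_floor_atTop.comp Real.tendsto_sqrt_atTop
  refine tendsto_of_tendsto_of_tendsto_of_le_of_le' (hlow.comp hM) (hup.comp hM) ?_ ?_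
  · filter_upwards [eventually_ge_atTop (1 : ℝ)] with t ht
    obtain ⟨hM1, hle, hlt⟩ := natFloor_sqrt_sq_bounds ht
    simp only [Function.comp_apply]
    generalize ⌊√t⌋₊ = M at *
    have hM0 : (0 : ℝ) < M := by exact_mod_cast hM1
    have hF1 := hF (Set.mem_Ici.2 (sq_nonneg (M : ℝ))) (Set.mem_Ici.2 (by linarith)) hle
    have hF2 := hF0 _ (sq_nonneg (M : ℝ))
    have hM2 : ((M + 1 : ℕ) : ℝ) ≠ 0 := by positivity
    calc F ((M : ℝ) ^ 2) / (M : ℝ) ^ 2 * ((M : ℝ) / ((M + 1 : ℕ) : ℝ)) ^ 2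
        = F ((M : ℝ) ^ 2) / ((M + 1 : ℕ) : ℝ) ^ 2 := by field_simp
      _ ≤ F ((M : ℝ) ^ 2) / t := div_le_div_of_nonneg_left hF2 (by linarith) hlt
      _ ≤ F t / t := div_le_div_of_nonneg_right hF1 (by linarith)
  · filter_upwards [eventually_ge_atTop (1 : ℝ)] with t ht
    obtain ⟨hM1, hle, hlt⟩ := natFloor_sqrt_sq_bounds ht
    simp only [Function.comp_apply]
    generalize ⌊√t⌋₊ = M at *
    have hM0 : (0 : ℝ) < M := by exact_mod_cast hM1
    have hF1 := hF (Set.mem_Ici.2 (by linarith)) (Set.mem_Ici.2 (sq_nonneg _)) hlt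
    have hF2 := hF0 _ (sq_nonneg ((M + 1 : ℕ) : ℝ))
    have hM2 : ((M + 1 : ℕ) : ℝ) ≠ 0 := by positivity
    calc F t / t ≤ F (((M + 1 : ℕ) : ℝ) ^ 2) / t := div_le_div_of_nonneg_right hF1 (by linarith)
      _ ≤ F (((M + 1 : ℕ) : ℝ) ^ 2) / (M : ℝ) ^ 2 :=
          div_le_div_of_nonneg_left hF2 (by positivity) hle
      _ = F (((M + 1 : ℕ) : ℝ) ^ 2) / ((M + 1 : ℕ) : ℝ) ^ 2 *
          (((M + 1 : ℕ) : ℝ) / (M : ℝ)) ^ 2 := by field_simp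

end Limits

/-! ### Almost sure vanishing of the error terms -/

section AlmostSure

variable {Ω : Type*} [MeasurableSpace Ω] {μ : Measure Ω} [IsProbabilityMeasure μ] {m : ℕ}
  {j : Fin m}
  {C : Incoming j → ℝ≥0 → Ω → ℕ} {κ : ℕ → Ω → Finset (Fin m)} {r : Incoming j → ℝ≥0}
  {φ : ℝ} {n k : ℕ}

theorem summable_const_div_succ_sq (c : ℝ) : Summable fun N : ℕ => c / ((N : ℝ) + 1) ^ 2 := by
  have h1 := (summable_nat_add_iff 1).2 (Real.summable_one_div_nat_pow.2 one_lt_two)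
  refine (h1.mul_left c).congr fun N => ?_
  push_cast
  ring

theorem IsIncomingNetwork.ae_tendsto_zero (h : IsIncomingNetwork C κ r φ n μ) {q : ℕ → ℕ}
    {F : ℕ → ChainInput j → ℝ} (hFm : ∀ N, Measurable (F N)) (hF0 : ∀ N p, 0 ≤ F N p)
    {B : ℕ → ℝ} (hFB : ∀ N p, F N p ≤ B N) {c : ℝ}
    (hle : ∀ N, ∫ p, F N p ∂(μ.map (gridInput C κ (q N))) ≤ c / ((N : ℝ) + 1) ^ 2) :
    ∀ᵐ ω ∂μ, Tendsto (fun N => F N (gridInput C κ (q N) ω)) atTop (𝓝 0) := by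
  refine ae_tendsto_zero_of_summable_integral (fun N ω => hF0 N _) (fun N => ?_)
    (summable_const_div_succ_sq c) fun N => ?_
  · refine Integrable.of_bound (C := B N)
      ((hFm N).comp (h.measurable_gridInput (q N))).aestronglyMeasurable (ae_of_all _ fun ω => ?_)
    rw [Real.norm_eq_abs, abs_of_nonneg (hF0 N _)]
    exact hFB N _
  · rw [← integral_map (h.measurable_gridInput (q N)).aemeasurable (hFm N).aestronglyMeasurable]
    exact hle N

/-- The number of steps per unit of time used up to the time `(N + 1) ^ 2`. -/
def stepRate (N : ℕ) : ℕ := (N + 1) ^ 4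

/-- The number of steps up to the time `(N + 1) ^ 2`. -/
def stepCount (N : ℕ) : ℕ := (N + 1) ^ 6

theorem stepRate_pos (N : ℕ) : 0 < stepRate N := by unfold stepRate; positivity

/-- A bound on the second moment of the age. -/
noncomputable def ageMomentBound (r : Incoming j → ℝ≥0) : ℝ :=
  3 * (2 / allTickProb r * (2 / allTickProb r * (r none : ℝ) ^ 2 + r none + (r none : ℝ) ^ 2) +
    (r none + (r none : ℝ) ^ 2) + 1)

theorem IsIncomingNetwork.integral_age_add_one_sq_le (h : IsIncomingNetwork C κ r φ n μ)
    (hr : ∀ c, 0 < r c) (hkn : k < n) {q : ℕ} (hq : 0 < q) (i : ℕ) :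
    ∫ p, (chainAge k i p + 1) ^ 2 ∂(μ.map (gridInput C κ q)) ≤ ageMomentBound r := by
  have : IsProbabilityMeasure (μ.map (gridInput C κ q)) :=
    Measure.isProbabilityMeasure_map (h.measurable_gridInput q).aemeasurable
  refine (h.isChainLaw q).integral_chainAge_add_one_sq_le hkn hq ?_ (allTickProb_pos hr)
    (h.integral_missIndicator_le hq) i
  have hq' : (0 : ℝ) < q := by exact_mod_cast hq
  calc (q : ℝ) * tickProb r q none ≤ q * (r none / q) := by gcongr; exact tickProb_le r q none
    _ = r none := by field_simp

theorem sum_tickProb_le (r : Incoming j → ℝ≥0) (q : ℕ) :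
    ∑ c, tickProb r q c ≤ (∑ c, (r c : ℝ)) / q := by
  rw [Finset.sum_div]
  exact Finset.sum_le_sum fun c _ => tickProb_le r q c

/-- Almost surely there are eventually no steps with two or more ticks. -/
theorem IsIncomingNetwork.ae_eventually_sum_gridTicks_le_one (h : IsIncomingNetwork C κ r φ n μ) :
    ∀ᵐ ω ∂μ, ∀ᶠ N in atTop, ∀ i < stepCount N, ∑ c, gridTicks C (stepRate N) (c, i) ω ≤ 1 := by
  let E (i : ℕ) : Set (ChainInput j) := {p | 2 ≤ ∑ c, p.1 (c, i)}
  have hE (i : ℕ) : MeasurableSet (E i) := by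
    have hm : Measurable fun p : ChainInput j => ∑ c, p.1 (c, i) :=
      Finset.measurable_sum _ fun c _ => (measurable_pi_apply (c, i)).comp measurable_fst
    exact hm (MeasurableSet.of_discrete (s := Set.Ici 2))
  have h1 := h.ae_tendsto_zero (q := stepRate)
    (F := fun N p => ∑ i ∈ Finset.range (stepCount N), (E i).indicator 1 p)
    (B := fun N => stepCount N) (c := (∑ c, (r c : ℝ)) ^ 2)
    (fun N => Finset.measurable_sum _ fun i _ => measurable_one.indicator (hE i))
    (fun N p => Finset.sum_nonneg fun i _ => Set.indicator_nonneg (fun _ _ => zero_le_one) _)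
    (fun N p => (Finset.sum_le_sum fun i _ =>
      Set.indicator_le_self' (fun _ _ => zero_le_one) p).trans (by simp)) fun N => ?_
  · filter_upwards [h1] with ω hω
    filter_upwards [hω.eventually_lt_const zero_lt_one] with N hN i hi
    by_contra hcon
    have hle := Finset.single_le_sum (f := fun i => (E i).indicator (1 : ChainInput j → ℝ)
      (gridInput C κ (stepRate N) ω)) (fun i _ => Set.indicator_nonneg (fun _ _ => zero_le_one) _)
      (Finset.mem_range.2 hi)
    have hmem : gridInput C κ (stepRate N) ω ∈ E i := by
      change 2 ≤ ∑ c, gridTicks C (stepRate N) (c, i) ω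
      omega
    simp only [Set.indicator_of_mem hmem, Pi.one_apply] at hle
    linarith
  · have hP := h.measurable_gridInput (stepRate N)
    have : IsProbabilityMeasure (μ.map (gridInput C κ (stepRate N))) :=
      Measure.isProbabilityMeasure_map hP.aemeasurable
    have hint (i : ℕ) : Integrable ((E i).indicator (1 : ChainInput j → ℝ))
      (μ.map (gridInput C κ (stepRate N))) := (integrable_const (1 : ℝ)).indicator (hE i)
    rw [integral_finsetSum _ fun i _ => hint i]
    have h2 : ∀ i ∈ Finset.range (stepCount N),
        ∫ p, (E i).indicator 1 p ∂(μ.map (gridInput C κ (stepRate N))) ≤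
          ((∑ c, (r c : ℝ)) / stepRate N) ^ 2 := fun i _ => by
      rw [integral_indicator_one (hE i), map_measureReal_apply hP (hE i)]
      exact h.measureReal_two_le_sum_gridTicks_le (stepRate N) i
    -- There are `(N + 1) ^ 6` steps, each costing a constant times `(N + 1) ^ (-8)`.
    refine (Finset.sum_le_sum h2).trans (le_of_eq ?_)
    rw [Finset.sum_const, Finset.card_range, nsmul_eq_mul, stepCount, stepRate]
    push_cast
    field_simp

/-- By orthogonality the variance of the sum is at most a constant times the elapsed time `(N + 1) ^
2`. Dividing by the square of that time leaves a summable sequence. -/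
theorem IsIncomingNetwork.ae_tendsto_sum_noise (h : IsIncomingNetwork C κ r φ n μ)
    (hr : ∀ c, 0 < r c) (hkn : k < n) {u : ℕ → ℕ → ℝ} {π₁ : ℕ → ℝ} {v : ℕ → ℝ}
    (hu : ∀ N, IsMissProbability (u N) k n (tickProb r (stepRate N) none) (π₁ N))
    (hv0 : ∀ N, 0 ≤ v N) (hv1 : ∀ N, v N ≤ 1)
    (hv : ∀ N, v N = φ * u N 1 + (1 - φ) * u N 0) :
    ∀ᵐ ω ∂μ, Tendsto (fun N : ℕ => (∑ i ∈ Finset.range (stepCount N),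
      noise (u N) (v N) (tickProb r (stepRate N)) k i (gridInput C κ (stepRate N) ω)) /
        ((N : ℝ) + 1) ^ 2) atTop (𝓝 0) := by
  set c : ℝ := 16 * Fintype.card (Incoming j) * ageMomentBound r * ∑ c, (r c : ℝ) with hc
  have hprob (N : ℕ) : IsProbabilityMeasure (μ.map (gridInput C κ (stepRate N))) :=
    Measure.isProbabilityMeasure_map (h.measurable_gridInput _).aemeasurable
  have hB0 : 0 ≤ ageMomentBound r := le_trans (integral_nonneg fun p => sq_nonneg _)
    (h.integral_age_add_one_sq_le hr hkn (stepRate_pos 0) 0)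
  have h1 := h.ae_tendsto_zero (q := stepRate)
    (F := fun N p => ((∑ i ∈ Finset.range (stepCount N),
      noise (u N) (v N) (tickProb r (stepRate N)) k i p) / ((N : ℝ) + 1) ^ 2) ^ 2)
    (B := fun N => ((∑ i ∈ Finset.range (stepCount N),
      (2 * ((i : ℝ) + 1) * (2 * Fintype.card (Incoming j)))) / ((N : ℝ) + 1) ^ 2) ^ 2) (c := c)
    (fun N => ((Finset.measurable_sum _ fun i _ => measurable_noise i).div_const _).pow_const 2)
    (fun N p => sq_nonneg _) (fun N p => ?_) fun N => ?_
  · filter_upwards [h1] with ω hω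
    have h2 := (Real.continuous_sqrt.tendsto 0).comp hω
    rw [Real.sqrt_zero] at h2
    rw [tendsto_zero_iff_abs_tendsto_zero]
    refine h2.congr fun N => ?_
    simp only [Function.comp_apply, Real.sqrt_sq_eq_abs]
  · rw [← sq_abs]
    refine pow_le_pow_left₀ (abs_nonneg _) ?_ 2
    rw [abs_div, abs_of_nonneg (sq_nonneg ((N : ℝ) + 1))]
    refine div_le_div_of_nonneg_right ?_ (by positivity)
    exact (Finset.abs_sum_le_sum_abs _ _).trans (Finset.sum_le_sum fun i _ =>
      abs_noise_le_of_step (hu N) (hv0 N) (hv1 N) (h.isChainLaw (stepRate N)) i p)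
  · simp_rw [div_pow]
    rw [integral_div]
    have h2 := (h.isChainLaw (stepRate N)).integral_sum_noise_sq_le (hu N) (hv0 N) (hv1 N) (hv N)
      (h.integral_age_add_one_sq_le hr hkn (stepRate_pos N)) (stepCount N)
    have h3 : (stepCount N : ℝ) * (16 * Fintype.card (Incoming j) * ageMomentBound r *
        ∑ c, tickProb r (stepRate N) c) ≤ c * ((N : ℝ) + 1) ^ 2 := by
      calc _ ≤ (stepCount N : ℝ) * (16 * Fintype.card (Incoming j) * ageMomentBound r *
            ((∑ c, (r c : ℝ)) / stepRate N)) := by gcongr; exact sum_tickProb_le r _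
        _ = _ := by
          rw [hc, stepCount, stepRate]
          push_cast
          field_simp
    refine (div_le_div_of_nonneg_right (h2.trans h3) (by positivity)).trans (le_of_eq ?_)
    field_simp

/-- This disposes of the boundary term left by telescoping the potential. A bounded second moment
divided by `(N + 1) ^ 4` is summable. -/
theorem IsIncomingNetwork.ae_tendsto_age_div (h : IsIncomingNetwork C κ r φ n μ)
    (hr : ∀ c, 0 < r c) (hkn : k < n) :
    ∀ᵐ ω ∂μ, Tendsto (fun N : ℕ => chainAge k (stepCount N) (gridInput C κ (stepRate N) ω) /
      ((N : ℝ) + 1) ^ 2) atTop (𝓝 0) := by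
  have hB0 : 0 ≤ ageMomentBound r := le_trans (integral_nonneg fun p => sq_nonneg _)
    (h.integral_age_add_one_sq_le hr hkn (stepRate_pos 0) 0)
  have h1 := h.ae_tendsto_zero (q := stepRate)
    (F := fun N p => (chainAge k (stepCount N) p + 1) ^ 2 / ((N : ℝ) + 1) ^ 4)
    (B := fun N => ((stepCount N : ℝ) + 1) ^ 2 / ((N : ℝ) + 1) ^ 4) (c := ageMomentBound r)
    (fun N => (((measurable_chainAge k _).add_const 1).pow_const 2).div_const _)
    (fun N p => by positivity) (fun N p => ?_) fun N => ?_
  · filter_upwards [h1] with ω hω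
    have h2 := (Real.continuous_sqrt.tendsto 0).comp hω
    rw [Real.sqrt_zero] at h2
    refine squeeze_zero (fun N => div_nonneg (chainAge_nonneg _ _) (by positivity)) (fun N => ?_) h2
    have h0 := chainAge_nonneg (k := k) (stepCount N) (gridInput C κ (stepRate N) ω)
    rw [Function.comp_apply, show ((N : ℝ) + 1) ^ 4 = (((N : ℝ) + 1) ^ 2) ^ 2 by ring, ← div_pow,
      Real.sqrt_sq (by positivity)]
    gcongr
    linarith
  · have h0 := chainAge_nonneg (k := k) (stepCount N) p
    gcongr
    exact chainAge_le _ _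
  · rw [integral_div]
    refine (div_le_div_of_nonneg_right (h.integral_age_add_one_sq_le hr hkn (stepRate_pos N) _)
      (by positivity)).trans ?_
    refine div_le_div_of_nonneg_left hB0 (by positivity) ?_
    exact pow_le_pow_right₀ (by linarith [Nat.cast_nonneg (α := ℝ) N]) (by norm_num)

/-- The contribution of the steps with a tick to the average of the age vanishes. -/
theorem IsIncomingNetwork.ae_tendsto_sum_bit_mul (h : IsIncomingNetwork C κ r φ n μ)
    (hr : ∀ c, 0 < r c) (hkn : k < n) :
    ∀ᵐ ω ∂μ, Tendsto (fun N : ℕ => (∑ i ∈ Finset.range (stepCount N),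
      (∑ c, bit c i (gridInput C κ (stepRate N) ω)) *
        (chainAge k i (gridInput C κ (stepRate N) ω) + 1)) / stepCount N) atTop (𝓝 0) := by
  set R : ℝ := ∑ c, (r c : ℝ) with hR
  have hB0 : 0 ≤ ageMomentBound r := le_trans (integral_nonneg fun p => sq_nonneg _)
    (h.integral_age_add_one_sq_le hr hkn (stepRate_pos 0) 0)
  have hQ (N : ℕ) : (0 : ℝ) < stepCount N := by unfold stepCount; positivity
  have hbd (i : ℕ) (c : Incoming j) (p : ChainInput j) :
      0 ≤ (chainAge k i p + 1) * bit c i p ∧ (chainAge k i p + 1) * bit c i p ≤ (i + 1) * 1 := by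
    have h0 := chainAge_nonneg (k := k) i p
    have h1 := bit_nonneg c i p
    refine ⟨by positivity, mul_le_mul ?_ (bit_le_one c i p) h1 (by positivity)⟩
    linarith [chainAge_le (k := k) i p]
  have hm (i : ℕ) (c : Incoming j) : Measurable fun p => (chainAge k i p + 1) * bit c i p :=
    ((measurable_chainAge k i).add_const 1).mul (measurable_bit c i)
  have h1 := h.ae_tendsto_zero (q := stepRate)
    (F := fun N p => (∑ i ∈ Finset.range (stepCount N), ∑ c, (chainAge k i p + 1) * bit c i p) /
      stepCount N)
    (B := fun N => (∑ i ∈ Finset.range (stepCount N), ∑ _c : Incoming j, ((i : ℝ) + 1) * 1) /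
      stepCount N) (c := ageMomentBound r * R)
    (fun N => (Finset.measurable_sum _ fun i _ => Finset.measurable_sum _ fun c _ =>
      hm i c).div_const _)
    (fun N p => div_nonneg (Finset.sum_nonneg fun i _ => Finset.sum_nonneg fun c _ =>
      (hbd i c p).1) (hQ N).le)
    (fun N p => div_le_div_of_nonneg_right (Finset.sum_le_sum fun i _ =>
      Finset.sum_le_sum fun c _ =>
      (hbd i c p).2) (hQ N).le) fun N => ?_
  · filter_upwards [h1] with ω hω
    refine hω.congr fun N => ?_
    congr 1
    refine Finset.sum_congr rfl fun i _ => ?_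
    rw [← Finset.mul_sum, mul_comm]
  · have hprob : IsProbabilityMeasure (μ.map (gridInput C κ (stepRate N))) :=
      Measure.isProbabilityMeasure_map (h.measurable_gridInput _).aemeasurable
    have hlaw := h.isChainLaw (stepRate N)
    have hint (i : ℕ) (c : Incoming j) : Integrable (fun p => (chainAge k i p + 1) * bit c i p)
        (μ.map (gridInput C κ (stepRate N))) :=
      integrable_of_abs_le (hm i c) fun p => by
        rw [abs_of_nonneg (hbd i c p).1]; exact (hbd i c p).2
    have hage (i : ℕ) : ∫ p, (chainAge k i p + 1) ∂(μ.map (gridInput C κ (stepRate N))) ≤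
        ageMomentBound r := by
      refine le_trans ?_ (h.integral_age_add_one_sq_le hr hkn (stepRate_pos N) i)
      refine integral_mono ?_ ?_ fun p => ?_
      · refine integrable_of_abs_le (C := (i : ℝ) + 1) ((measurable_chainAge k i).add_const 1)
          fun p => ?_
        have h0 := chainAge_nonneg (k := k) i p
        rw [abs_of_nonneg (by linarith)]
        linarith [chainAge_le (k := k) i p]
      · refine integrable_of_abs_le (C := ((i : ℝ) + 1) ^ 2)
          (((measurable_chainAge k i).add_const 1).pow_const 2) fun p => ?_
        have h0 := chainAge_nonneg (k := k) i p
        rw [abs_of_nonneg (sq_nonneg _)]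
        exact pow_le_pow_left₀ (by linarith) (by linarith [chainAge_le (k := k) i p]) 2
      · have h0 := chainAge_nonneg (k := k) i p
        dsimp only
        nlinarith
    have hterm (i : ℕ) : ∑ c, ∫ p, (chainAge k i p + 1) * bit c i p
        ∂(μ.map (gridInput C κ (stepRate N))) ≤ ageMomentBound r * (R / stepRate N) := by
      calc _ = ∑ c, (∫ p, (chainAge k i p + 1) ∂(μ.map (gridInput C κ (stepRate N)))) *
            tickProb r (stepRate N) c := by
            refine Finset.sum_congr rfl fun c _ => ?_
            refine hlaw.integral_mul_bit c i ((measurable_chainAge k i).add_const 1) fun κ => ?_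
            intro e e' he
            have := dependsOn_chainAge (k := k) i κ he
            dsimp only at this ⊢
            rw [this]
        _ ≤ ∑ c, ageMomentBound r * tickProb r (stepRate N) c :=
            Finset.sum_le_sum fun c _ => mul_le_mul_of_nonneg_right (hage i) (hlaw.nonneg c)
        _ ≤ _ := by
            rw [← Finset.mul_sum]
            exact mul_le_mul_of_nonneg_left (sum_tickProb_le r _) hB0
    rw [integral_div, integral_finsetSum _ fun i _ => integrable_finsetSum _ fun c _ => hint i c]
    simp_rw [integral_finsetSum _ fun c _ => hint _ c]
    rw [div_le_iff₀ (hQ N)]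
    refine (Finset.sum_le_sum fun i _ => hterm i).trans ?_
    rw [Finset.sum_const, Finset.card_range, nsmul_eq_mul, mul_comm]
    refine mul_le_mul_of_nonneg_right ?_ (hQ N).le
    rw [← mul_div_assoc]
    refine div_le_div_of_nonneg_left (mul_nonneg hB0 (by positivity)) (by positivity) ?_
    rw [stepRate]
    push_cast
    exact pow_le_pow_right₀ (by linarith [Nat.cast_nonneg (α := ℝ) N]) (by norm_num)

end AlmostSure

/-! ### From the drift identity to the time average -/

section TimeAverage

variable {Ω : Type*} [MeasurableSpace Ω] {μ : Measure Ω} [IsProbabilityMeasure μ] {m : ℕ}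
  {j : Fin m}
  {φ : ℝ} {n k : ℕ}

theorem tendsto_stepRate : Tendsto stepRate atTop atTop :=
  (tendsto_pow_atTop (by norm_num : 4 ≠ 0)).comp (tendsto_add_atTop_nat 1)

/-- The averages of the age of the discrete chains converge. -/
theorem IsIncomingNetwork.ae_tendsto_average_chainAge {C : Incoming j → ℝ≥0 → Ω → ℕ}
    {κ : ℕ → Ω → Finset (Fin m)} {r : Incoming j → ℝ≥0} (h : IsIncomingNetwork C κ r φ n μ)
    (hr : ∀ c, 0 < r c) {ρ : ℝ≥0} (hρ : 0 < ρ) (hrρ : ∀ a, r (some a) = ρ) (hkn : k < n) {v : ℝ}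
    (hv : v = φ * missProb (ρ / r none) k n 1 + (1 - φ) * missProb (ρ / r none) k n 0) :
    ∀ᵐ ω ∂μ, Tendsto (fun N : ℕ => (∑ i ∈ Finset.range (stepCount N),
      chainAge k i (gridInput C κ (stepRate N) ω)) / stepCount N) atTop (𝓝 (v / (1 - v))) := by
  have hφ0 : 0 ≤ φ := by rw [← h.prob_selection 0]; exact measureReal_nonneg
  have hφ1 : φ ≤ 1 := by rw [← h.prob_selection 0]; exact measureReal_le_one
  let π₀ (N : ℕ) : ℝ := tickProb r (stepRate N) none
  let π₁ (N : ℕ) : ℝ := 1 - Real.exp (-((ρ : ℝ) / stepRate N))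
  have hq (N : ℕ) : (0 : ℝ) < stepRate N := by exact_mod_cast stepRate_pos N
  have hpos {x : ℝ≥0} (hx : 0 < x) (N : ℕ) : 0 < 1 - Real.exp (-((x : ℝ) / stepRate N)) := by
    rw [sub_pos, Real.exp_lt_one_iff]
    exact neg_neg_of_pos (div_pos hx (hq N))
  have hπ₀ (N : ℕ) : 0 < π₀ N := hpos (hr none) N
  have hπ₁ (N : ℕ) : 0 < π₁ N := hpos hρ N
  -- The miss probabilities belong to the tick probabilities of the grid, not to the limiting rates,
  -- so the drift identity has no discretisation error. Only their limit is needed afterwards.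
  let u (N : ℕ) : ℕ → ℝ := missProb (π₁ N / π₀ N) k n
  have hu (N : ℕ) : IsMissProbability (u N) k n (π₀ N) (π₁ N) :=
    isMissProbability_missProb (hπ₀ N) (hπ₁ N).le hkn
  let w (N : ℕ) : ℝ := φ * u N 1 + (1 - φ) * u N 0
  have hw0 (N : ℕ) : 0 ≤ w N := add_nonneg (mul_nonneg hφ0 ((hu N).nonneg 1))
    (mul_nonneg (by linarith) ((hu N).nonneg 0))
  have hw1 (N : ℕ) : w N ≤ 1 := by
    have h1 := mul_le_mul_of_nonneg_left ((hu N).le_one 1) hφ0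
    have h2 := mul_le_mul_of_nonneg_left ((hu N).le_one 0) (by linarith : 0 ≤ 1 - φ)
    simp only [w]
    linarith
  have ha : Tendsto (fun N => (stepRate N : ℝ) * π₀ N) atTop (𝓝 (r none)) :=
    tendsto_mul_one_sub_exp_neg_div tendsto_stepRate (r none).2
  have hb : Tendsto (fun N => (stepRate N : ℝ) * π₁ N) atTop (𝓝 ρ) :=
    tendsto_mul_one_sub_exp_neg_div tendsto_stepRate ρ.2
  have hr0 : (0 : ℝ) < r none := hr none
  have hθpos : (0 : ℝ) < ρ / r none := div_pos hρ hr0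
  have hθ : Tendsto (fun N => π₁ N / π₀ N) atTop (𝓝 (ρ / r none)) := by
    refine (hb.div ha hr0.ne').congr fun N => ?_
    exact mul_div_mul_left _ _ (hq N).ne'
  have hwv : Tendsto w atTop (𝓝 v) := by
    rw [hv]
    exact ((tendsto_missProb hθpos.le hθ hkn 1).const_mul φ).add
      ((tendsto_missProb hθpos.le hθ hkn 0).const_mul (1 - φ))
  have hv1 : 0 < 1 - v := by
    have h1 := missProb_lt_one hθpos hkn 1
    have h0 := missProb_lt_one hθpos hkn 0
    rw [hv]
    rcases hφ0.eq_or_lt with hφ | hφ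
    · rw [← hφ]; linarith
    · have h2 := mul_lt_mul_of_pos_left h1 hφ
      have h3 := mul_le_mul_of_nonneg_left h0.le (by linarith : 0 ≤ 1 - φ)
      linarith
  filter_upwards [h.ae_eventually_sum_gridTicks_le_one, h.ae_tendsto_age_div hr hkn,
    h.ae_tendsto_sum_noise hr hkn (π₁ := π₁) (v := w) hu hw0 hw1 fun N => rfl,
    h.card_selection] with ω hgood hage hnoise hcard
  set P : ℕ → ChainInput j := fun N => gridInput C κ (stepRate N) ω with hP
  set A : ℕ → ℝ := fun N => (∑ i ∈ Finset.range (stepCount N), chainAge k i (P N)) / stepCount N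
    with hA
  have hpot : Tendsto (fun N : ℕ => potential (u N) k (stepCount N) (P N) / ((N : ℝ) + 1) ^ 2)
      atTop (𝓝 0) := by
    refine squeeze_zero (fun N => div_nonneg (mul_nonneg ((hu N).nonneg _) (Nat.cast_nonneg _))
      (by positivity)) (fun N => ?_) hage
    refine div_le_div_of_nonneg_right ?_ (by positivity)
    exact mul_le_of_le_one_left (Nat.cast_nonneg _) ((hu N).le_one _)
  -- The one-step identity summed over all steps and divided by the elapsed time. The prefactor
  -- tends to the positive source rate, so the bracket must tend to zero.
  have hbal : ∀ᶠ N : ℕ in atTop, (stepRate N * π₀ N) * (w N - (1 - w N) * A N) =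
      potential (u N) k (stepCount N) (P N) / ((N : ℝ) + 1) ^ 2 -
      (∑ i ∈ Finset.range (stepCount N),
        noise (u N) (w N) (tickProb r (stepRate N)) k i (P N)) / ((N : ℝ) + 1) ^ 2 := by
    filter_upwards [hgood] with N hN
    have h1 := Finset.sum_range_sub (fun i => potential (u N) k i (P N)) (stepCount N)
    have h2 : ∀ i ∈ Finset.range (stepCount N),
        potential (u N) k (i + 1) (P N) - potential (u N) k i (P N) =
        noise (u N) (w N) (tickProb r (stepRate N)) k i (P N) +
          π₀ N * (w N - (1 - w N) * chainAge k i (P N)) := fun i hi =>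
      potential_succ_sub (hu N) (fun a => by simp only [tickProb, hrρ, π₁]) (P N) i (hcard _)
        (hN i (Finset.mem_range.1 hi))
    have h0 : potential (u N) k 0 (P N) = 0 := by simp [potential, chain]
    rw [Finset.sum_congr rfl h2, Finset.sum_add_distrib, ← Finset.mul_sum, Finset.sum_sub_distrib,
      ← Finset.mul_sum, Finset.sum_const, Finset.card_range, nsmul_eq_mul, h0, sub_zero] at h1
    have hQ : (stepCount N : ℝ) ≠ 0 := by unfold stepCount; positivity
    have h3 : ∑ i ∈ Finset.range (stepCount N), chainAge k i (P N) = stepCount N * A N := by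
      rw [hA]; field_simp
    have h4 : (stepCount N : ℝ) = stepRate N * ((N : ℝ) + 1) ^ 2 := by
      unfold stepCount stepRate; push_cast; ring
    rw [h3, h4] at h1
    rw [← h1]
    field_simp
    ring
  have hzero : Tendsto (fun N => w N - (1 - w N) * A N) atTop (𝓝 0) := by
    have h1 := ((hpot.sub hnoise).congr' (hbal.mono fun N hN => hN.symm)).div ha hr0.ne'
    rw [sub_zero, zero_div] at h1
    refine h1.congr fun N => ?_
    exact mul_div_cancel_left₀ _ (mul_pos (hq N) (hπ₀ N)).ne'
  have h1w : Tendsto (fun N => 1 - w N) atTop (𝓝 (1 - v)) := hwv.const_sub 1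
  have hfin := (hwv.sub hzero).div h1w hv1.ne'
  rw [sub_zero] at hfin
  refine hfin.congr' ?_
  filter_upwards [h1w.eventually_ne hv1.ne'] with N hN
  simp only [Pi.div_apply]
  rw [sub_sub_cancel, mul_div_cancel_left₀ _ hN]

omit [IsProbabilityMeasure μ] in
theorem isCounterPath_incomingCounter {N₀ : ℝ≥0 → Ω → ℕ} {N : Edge m → ℝ≥0 → Ω → ℕ}
    {r : Incoming j → ℝ≥0} (h : ∀ c, IsPoissonCounter (incomingCounter N₀ N j c) (r c) μ) (ω : Ω)
    (c : Incoming j) :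
    IsCounterPath (incomingCounter (fun t => N₀ t ω) (fun e t => N e t ω) j c) := by
  have h1 : incomingCounter (fun t => N₀ t ω) (fun e t => N e t ω) j c =
      fun t => incomingCounter N₀ N j c t ω := by
    rcases c with _ | a <;> rfl
  rw [h1]
  exact ⟨(h c).zero ω, (h c).mono ω, (h c).rightCts ω⟩

/-- The long-run average of the age exists and is the ratio of the probabilities that a version is
not decrypted and that it is decrypted. -/
theorem IsIncomingNetwork.ae_tendsto_timeAverageAge {N₀ : ℝ≥0 → Ω → ℕ} {N : Edge m → ℝ≥0 → Ω → ℕ}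
    {κ : ℕ → Ω → Finset (Fin m)} {r : Incoming j → ℝ≥0}
    (h : IsIncomingNetwork (incomingCounter N₀ N j) κ r φ n μ)
    (hr : ∀ c, 0 < r c) {ρ : ℝ≥0} (hρ : 0 < ρ) (hrρ : ∀ a, r (some a) = ρ) (hkn : k < n) {v : ℝ}
    (hv : v = φ * missProb (ρ / r none) k n 1 + (1 - φ) * missProb (ρ / r none) k n 0) :
    ∀ᵐ ω ∂μ, Tendsto (timeAverageAge (fun t => N₀ t ω) (fun e t => N e t ω) (fun ℓ => κ ℓ ω) k j)
      atTop (𝓝 (v / (1 - v))) := by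
  filter_upwards [h.ae_eventually_sum_gridTicks_le_one, h.ae_tendsto_sum_bit_mul hr hkn,
    h.ae_tendsto_average_chainAge hr hρ hrρ hkn hv] with ω hgood hbit hA
  have hC := isCounterPath_incomingCounter (N₀ := N₀) (N := N) (j := j) h.counter ω
  set f : ℝ → ℝ := fun u => versionAge (fun t => N₀ t ω) (fun e t => N e t ω) (fun ℓ => κ ℓ ω) k j
    u.toNNReal with hf
  have hf0 (u : ℝ) : 0 ≤ f u := versionAge_nonneg _
  have hfi (x y : ℝ) : IntervalIntegrable f volume x y := intervalIntegrable_versionAge hC x y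
  have hgoal : Tendsto (fun t : ℝ => (∫ u in (0 : ℝ)..t, f u) / t) atTop (𝓝 (v / (1 - v))) := by
    refine tendsto_div_of_tendsto_sq (F := fun t => ∫ u in (0 : ℝ)..t, f u) ?_
      (fun t ht => intervalIntegral.integral_nonneg_of_forall ht hf0) ?_
    · intro s _ t _ hst
      dsimp only
      rw [← intervalIntegral.integral_add_adjacent_intervals (hfi 0 s) (hfi s t)]
      exact le_add_of_nonneg_right (intervalIntegral.integral_nonneg_of_forall hst hf0)
    -- The Riemann sum error comes only from steps with a tick, and their contribution per step
    -- vanishes.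
    · have hdiff : Tendsto (fun N' : ℕ => (∫ u in (0 : ℝ)..(((N' + 1 : ℕ) : ℝ) ^ 2), f u) /
          ((N' + 1 : ℕ) : ℝ) ^ 2 - (∑ i ∈ Finset.range (stepCount N'), chainAge k i
            (gridInput (incomingCounter N₀ N j) κ (stepRate N') ω)) / stepCount N')
          atTop (𝓝 0) := by
        rw [tendsto_zero_iff_abs_tendsto_zero]
        refine squeeze_zero' (Eventually.of_forall fun _ => abs_nonneg _) ?_ hbit
        filter_upwards [hgood] with N' hN'
        have hticks (p : Incoming j × ℕ) :
            incomingCounter (fun t => N₀ t ω) (fun e t => N e t ω) j p.1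
              (((p.2 + 1 : ℕ) : ℝ≥0) / stepRate N') -
            incomingCounter (fun t => N₀ t ω) (fun e t => N e t ω) j p.1
              ((p.2 : ℝ≥0) / stepRate N') =
            gridTicks (incomingCounter N₀ N j) (stepRate N') p ω := by
          rcases p with ⟨_ | a, i⟩ <;> rfl
        have h1 := abs_integral_versionAge_sub_le (a₀ := fun t => N₀ t ω)
          (a := fun e t => N e t ω) (K := fun ℓ => κ ℓ ω) (k := k) hC (stepRate_pos N')
          (n := stepCount N') fun i hi => by
            refine le_of_eq_of_le ?_ (hN' i hi)
            exact Finset.sum_congr rfl fun c _ => hticks (c, i)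
        have hticks' (c : Incoming j) (i : ℕ) :
            incomingCounter (fun t => N₀ t ω) (fun e t => N e t ω) j c
              (((i + 1 : ℕ) : ℝ≥0) / stepRate N') -
            incomingCounter (fun t => N₀ t ω) (fun e t => N e t ω) j c
              ((i : ℝ≥0) / stepRate N') =
            gridTicks (incomingCounter N₀ N j) (stepRate N') (c, i) ω := hticks (c, i)
        simp only [hticks, hticks'] at h1
        simp only [Function.comp_apply]
        have hq : (0 : ℝ) < stepRate N' := by exact_mod_cast stepRate_pos N'
        have hT : (stepCount N' : ℝ) / stepRate N' = ((N' + 1 : ℕ) : ℝ) ^ 2 := by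
          unfold stepCount stepRate; push_cast; field_simp
        have hQ : (stepCount N' : ℝ) = stepRate N' * ((N' + 1 : ℕ) : ℝ) ^ 2 := by
          rw [← hT]; field_simp
        have hbits : ∀ i ∈ Finset.range (stepCount N'), (∑ c,
            (gridTicks (incomingCounter N₀ N j) (stepRate N') (c, i) ω : ℝ)) *
            (((chain k (fun p => gridTicks (incomingCounter N₀ N j) (stepRate N') p ω)
              (fun ℓ => κ ℓ ω) i).2.2 : ℝ) + 1) =
            (∑ c, bit c i (gridInput (incomingCounter N₀ N j) κ (stepRate N') ω)) *
              (chainAge k i (gridInput (incomingCounter N₀ N j) κ (stepRate N') ω) + 1) := by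
          intro i hi
          have h2 := hN' i (Finset.mem_range.1 hi)
          congr 1
          refine Finset.sum_congr rfl fun c _ => ?_
          have h3 := (Finset.single_le_sum
            (f := fun c => gridTicks (incomingCounter N₀ N j) (stepRate N') (c, i) ω)
            (fun _ _ => Nat.zero_le _) (Finset.mem_univ c)).trans h2
          have h4 : ∀ x : ℕ, x ≤ 1 → x = tick x := by
            intro x hx
            unfold tick
            split_ifs <;> omega
          simp only [bit, gridInput]
          exact_mod_cast h4 _ h3
        rw [Finset.sum_congr rfl hbits, hT] at h1
        have hT0 : (0 : ℝ) < ((N' + 1 : ℕ) : ℝ) ^ 2 := by positivity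
        rw [hQ]
        have h5 := div_le_div_of_nonneg_right h1 hT0.le
        rw [← abs_of_pos hT0, ← abs_div, abs_of_pos hT0] at h5
        refine le_of_eq_of_le ?_ (h5.trans (le_of_eq ?_))
        · congr 1
          rw [sub_div]
          congr 1
          simp only [chainAge, gridInput]
          field_simp
        · field_simp
      have := hdiff.add hA
      simpa using this
  refine hgoal.congr fun t => ?_
  simp only [timeAverageAge, hf]
  ring

end TimeAverage

/-! ### The closed form of the coefficients -/

section Coefficients

/-- The source's share of the rate is one minus the `i`-th factor of the product, so the summand is
the difference of the coefficients `A` at `i - 1` and `i`. -/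
theorem sum_telescope_coeffA {lamE lamS : ℝ} {n m K : ℕ}
    (h : ∀ i ∈ Finset.Icc 1 K, lamE * coeffB n m i + lamS ≠ 0) :
    ∑ i ∈ Finset.Icc 1 K, lamS * coeffA lamE lamS n m (i - 1) / (lamE * coeffB n m i + lamS) =
      1 - coeffA lamE lamS n m K := by
  induction K with
  | zero => simp [coeffA]
  | succ K ih =>
    have h1 : lamE * coeffB n m (K + 1) + lamS ≠ 0 := h _ (by simp)
    have h2 : coeffA lamE lamS n m (K + 1) = coeffA lamE lamS n m K *
        (lamE * coeffB n m (K + 1) / (lamE * coeffB n m (K + 1) + lamS)) := by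
      rw [coeffA, Finset.prod_Icc_succ_top (by omega), coeffA]
    rw [Finset.sum_Icc_succ_top (by omega),
      ih fun i hi => h i (by simp only [Finset.mem_Icc] at hi ⊢; omega), h2, add_tsub_cancel_right]
    field_simp
    ring

theorem mul_coeffB_div {lamE lamS : ℝ} (hS : lamS ≠ 0) (n m i : ℕ) :
    lamE * coeffB n m i / (lamE * coeffB n m i + lamS) =
      ((n : ℝ) - i) * (lamE / ((m : ℝ) - 1) / lamS) /
        (((n : ℝ) - i) * (lamE / ((m : ℝ) - 1) / lamS) + 1) := by
  have h1 : ((n : ℝ) - i) * (lamE / ((m : ℝ) - 1) / lamS) = lamE * coeffB n m i / lamS := by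
    unfold coeffB
    ring
  have h2 : lamE * coeffB n m i / lamS + 1 = (lamE * coeffB n m i + lamS) / lamS := by
    rw [add_div, div_self hS]
  rw [h1, h2, div_div_div_cancel_right₀ hS]

theorem one_sub_missProb_one {lamE lamS : ℝ} (hS : lamS ≠ 0) (n m k : ℕ) :
    1 - missProb (lamE / ((m : ℝ) - 1) / lamS) k n 1 = coeffA lamE lamS n m k := by
  rw [missProb, sub_sub_cancel, coeffA]
  refine Finset.prod_congr (by ext; simp) fun i _ => (mul_coeffB_div hS n m i).symm

/-- From no keys the factors have numerators `n - i` for `i = 0, …, k`. Starting the index at `1`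
instead explains both `n + 1` and `k + 1`. -/
theorem one_sub_missProb_zero {lamE lamS : ℝ} (hS : lamS ≠ 0) (n m k : ℕ) :
    1 - missProb (lamE / ((m : ℝ) - 1) / lamS) k n 0 = coeffA lamE lamS (n + 1) m (k + 1) := by
  rw [missProb, sub_sub_cancel, coeffA]
  have h1 : Finset.Icc 1 (k + 1) = Finset.Ico (0 + 1) (k + 1 + 1) := by ext; simp
  rw [h1, ← Finset.prod_Ico_add']
  refine Finset.prod_congr rfl fun i _ => ?_
  rw [mul_coeffB_div hS]
  push_cast
  rw [add_sub_add_right_eq_sub]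

theorem mul_coeffB_add_ne_zero {lamE lamS : ℝ} (hE : 0 ≤ lamE) (hS : 0 < lamS) {n m i : ℕ}
    (hm : 1 ≤ m) (hi : i ≤ n) : lamE * coeffB n m i + lamS ≠ 0 := by
  have h1 : (i : ℝ) ≤ n := by exact_mod_cast hi
  have h2 : (1 : ℝ) ≤ m := by exact_mod_cast hm
  have h3 : 0 ≤ coeffB n m i := div_nonneg (by linarith) (by linarith)
  positivity

end Coefficients

/-! ### Uniformly random selections -/

section Selection

variable {Ω : Type*} [MeasurableSpace Ω] {μ : Measure Ω} {m n : ℕ}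
  {S : Finset (Fin m)} {X : Ω → Finset (Fin m)}

theorem ae_mem_of_hasLaw_uniformOn {p : ℕ} (hp : p ≤ Sᶜ.card)
    (h : HasLaw X (uniformOn (Sᶜ.powersetCard p : Set (Finset (Fin m)))) μ) :
    ∀ᵐ ω ∂μ, X ω ∈ Sᶜ.powersetCard p := by
  have hne : (Sᶜ.powersetCard p).Nonempty := Finset.powersetCard_nonempty.2 hp
  refine (h.ae_iff (p := fun A => A ∈ Sᶜ.powersetCard p) Measurable.of_discrete).2 ?_
  have h1 := (uniformOn_eq_zero_iff (s := (Sᶜ.powersetCard p : Set (Finset (Fin m))))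
    (t := (Sᶜ.powersetCard p : Set (Finset (Fin m)))ᶜ) (Finset.finite_toSet _)).2 (by simp)
  exact h1

/-- The sets through `a` number `choose (t - 1) (p - 1)` for `p > 0`, and `t * choose (t - 1) (p -
1) = p * choose t p`. Multiplying out avoids division. -/
theorem card_filter_mem_powersetCard {α : Type*} [DecidableEq α] {T : Finset α} {a : α}
    (ha : a ∈ T) (p : ℕ) :
    T.card * ((T.powersetCard p).filter (a ∈ ·)).card = p * (T.powersetCard p).card := by
  rcases p with _ | p
  · simp
  have h1 := Finset.card_filter_powersetCard_subset {a} T (p + 1) (by simpa using ha) (by simp)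
  simp only [Finset.singleton_subset_iff, Finset.card_singleton, Nat.add_sub_cancel] at h1
  have h2 : 0 < T.card := Finset.card_pos.2 ⟨a, ha⟩
  obtain ⟨t, ht⟩ := Nat.exists_eq_succ_of_ne_zero h2.ne'
  rw [h1, Finset.card_powersetCard, ht]
  simpa [mul_comm] using Nat.add_one_mul_choose_eq t p

theorem measureReal_mem_of_hasLaw_uniformOn {p : ℕ} (hp : p ≤ Sᶜ.card) {j : Fin m} (hj : j ∉ S)
    (h : HasLaw X (uniformOn (Sᶜ.powersetCard p : Set (Finset (Fin m)))) μ) :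
    μ.real {ω | j ∈ X ω} = p / Sᶜ.card := by
  rw [h.measureReal_eq (p := fun A => j ∈ A) MeasurableSet.of_discrete]
  have h1 : {A : Finset (Fin m) | j ∈ A} =
      ((Finset.univ.filter (j ∈ ·) : Finset (Finset (Fin m))) : Set (Finset (Fin m))) := by
    ext; simp
  have h2 : (Sᶜ.powersetCard p) ∩ (Finset.univ.filter (j ∈ ·)) =
      (Sᶜ.powersetCard p).filter (j ∈ ·) := by
    ext; simp
  rw [h1, Measure.real, uniformOn_apply_finset, h2, ENNReal.toReal_div, ENNReal.toReal_natCast,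
    ENNReal.toReal_natCast]
  have hj' : j ∈ Sᶜ := Finset.mem_compl.2 hj
  have hpos : (0 : ℝ) < (Sᶜ.powersetCard p).card := by
    exact_mod_cast Finset.card_pos.2 (Finset.powersetCard_nonempty.2 hp)
  have hpos' : (0 : ℝ) < Sᶜ.card := by exact_mod_cast Finset.card_pos.2 ⟨j, hj'⟩
  rw [div_eq_div_iff hpos.ne' hpos'.ne', mul_comm]
  exact_mod_cast card_filter_mem_powersetCard hj' p

end Selection

/-! ### The network seen from one node, and the conclusion -/

section Network

variable {Ω : Type*} [MeasurableSpace Ω] {μ : Measure Ω} {m n : ℕ} {N₀ : ℝ≥0 → Ω → ℕ}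
  {N : Edge m → ℝ≥0 → Ω → ℕ} {M : ℕ → Ω → Finset (Fin m)} {S : Finset (Fin m)}
  {lamE lamS : ℝ≥0}

/-- `HasLaw` gives only almost everywhere measurable selections; this allows passing to measurable
modifications. -/
theorem CodedGossip.IsScalableHomogeneousNetwork.congr {M' : ℕ → Ω → Finset (Fin m)}
    (h : IsScalableHomogeneousNetwork N₀ N M S n lamE lamS μ) (hM : ∀ ℓ, M ℓ =ᵐ[μ] M' ℓ) :
    IsScalableHomogeneousNetwork N₀ N M' S n lamE lamS μ where
  source := h.source
  edge := h.edge
  selection ℓ := (h.selection ℓ).congr (hM ℓ).symm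
  indep_counters := h.indep_counters
  indep_selections := h.indep_selections.congr hM
  indep_counters_selections := by
    refine h.indep_counters_selections.congr ae_eq_rfl ?_
    filter_upwards [ae_all_iff.2 hM] with ω hω
    exact funext hω

/-- The counter of the edge into `j`, or of the source, that is indexed by `c`. -/
def incomingEdge (j : Fin m) (c : Incoming j) : Option (Edge m) :=
  c.map fun b => ⟨(b.1, j), b.2⟩

theorem incomingEdge_injective (j : Fin m) : Function.Injective (incomingEdge j) := by
  refine Option.map_injective fun a b hab => ?_
  simpa [Subtype.ext_iff] using hab

omit [MeasurableSpace Ω] in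
theorem incomingCounter_eq_elim (j : Fin m) (c : Incoming j) :
    incomingCounter N₀ N j c = (incomingEdge j c).elim N₀ N := by
  rcases c with _ | b <;> rfl

/-- The rates of the counters that matter for node `j`. -/
noncomputable def incomingRate (lamE lamS : ℝ≥0) (j : Fin m) (c : Incoming j) : ℝ≥0 :=
  c.elim lamS fun _ => lamE / ((m : ℝ≥0) - 1)

theorem CodedGossip.IsScalableHomogeneousNetwork.isIncomingNetwork
    (h : IsScalableHomogeneousNetwork N₀ N M S n lamE lamS μ) (hM : ∀ ℓ, Measurable (M ℓ))
    (hSn : S.card ≤ n) (hnm : n ≤ m) {j : Fin m} {φ : ℝ}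
    (hφ : ∀ ℓ, μ.real {ω | j ∈ S ∪ M ℓ ω} = φ) :
    IsIncomingNetwork (incomingCounter N₀ N j) (fun ℓ ω => S ∪ M ℓ ω)
      (incomingRate lamE lamS j) φ n μ where
  counter c := by
    rcases c with _ | b
    · exact h.source
    · exact h.edge _
  indep_counters := by
    simp only [incomingCounter_eq_elim]
    exact h.indep_counters.precomp (incomingEdge_injective j)
  measurable_selection ℓ := (Measurable.of_discrete (f := fun A => S ∪ A)).comp (hM ℓ)
  indep_selections :=
    h.indep_selections.comp (fun _ A => S ∪ A) fun _ => Measurable.of_discrete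
  indep := by
    have h1 := h.indep_counters_selections.comp
      (φ := fun x (c : Incoming j) (t : ℝ≥0) => x (incomingEdge j c) t)
      (ψ := fun (x : ℕ → Finset (Fin m)) ℓ => S ∪ x ℓ)
      (measurable_pi_lambda _ fun c => measurable_pi_lambda _ fun t =>
        (measurable_pi_apply t).comp (measurable_pi_apply (incomingEdge j c)))
      (measurable_pi_lambda _ fun ℓ =>
        (Measurable.of_discrete (f := fun A => S ∪ A)).comp (measurable_pi_apply ℓ))
    simp only [incomingCounter_eq_elim]
    exact h1
  prob_selection := hφ
  card_selection := by
    have hc : n - S.card ≤ Sᶜ.card := by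
      rw [Finset.card_compl, Fintype.card_fin]
      omega
    filter_upwards [ae_all_iff.2 fun ℓ => ae_mem_of_hasLaw_uniformOn hc (h.selection ℓ)] with ω hω ℓ
    obtain ⟨h1, h2⟩ := Finset.mem_powersetCard.1 (hω ℓ)
    rw [Finset.card_union_of_disjoint (Finset.disjoint_left.2 fun a ha ha' =>
      Finset.mem_compl.1 (h1 ha') ha), h2]
    omega

/-- The version age of keys of a node that gets a key of a given version from the source with
probability `φ`. -/
theorem CodedGossip.IsScalableHomogeneousNetwork.hasVersionAgeOfKeys [IsProbabilityMeasure μ]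
    (h : IsScalableHomogeneousNetwork N₀ N M S n lamE lamS μ) (hSn : S.card ≤ n) (hnm : n ≤ m)
    (hm : 2 ≤ m) (hlamE : 0 < lamE) (hlamS : 0 < lamS) {k : ℕ} (hkn : k < n) {j : Fin m} {φ : ℝ}
    (hφ : ∀ ℓ, μ.real {ω | j ∈ S ∪ M ℓ ω} = φ) {A x : ℝ}
    (hA : A = φ * coeffA lamE lamS n m k + (1 - φ) * coeffA lamE lamS (n + 1) m (k + 1))
    (hx : x = (1 - A) / A) :
    HasVersionAgeOfKeys N₀ N M S μ k j x := by
  set M' : ℕ → Ω → Finset (Fin m) := fun ℓ => (h.selection ℓ).aemeasurable.mk (M ℓ) with hM'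
  have hMM' (ℓ : ℕ) : M ℓ =ᵐ[μ] M' ℓ := (h.selection ℓ).aemeasurable.ae_eq_mk
  have hφ' (ℓ : ℕ) : μ.real {ω | j ∈ S ∪ M' ℓ ω} = φ := by
    rw [← hφ ℓ]
    refine measureReal_congr ?_
    filter_upwards [hMM' ℓ] with ω hω
    change (j ∈ S ∪ M' ℓ ω) = (j ∈ S ∪ M ℓ ω)
    rw [hω]
  have hnet := (h.congr hMM').isIncomingNetwork
    (fun ℓ => (h.selection ℓ).aemeasurable.measurable_mk) hSn hnm hφ'
  have h1m : (1 : ℝ≥0) < m := by exact_mod_cast hm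
  have hρ : 0 < lamE / ((m : ℝ≥0) - 1) := div_pos hlamE (tsub_pos_of_lt h1m)
  have hρ' : ((lamE / ((m : ℝ≥0) - 1) : ℝ≥0) : ℝ) = lamE / ((m : ℝ) - 1) := by
    rw [NNReal.coe_div, NNReal.coe_sub h1m.le]
    simp
  have hS0 : (lamS : ℝ) ≠ 0 := by exact_mod_cast hlamS.ne'
  have hv : 1 - A = φ * missProb ((lamE / ((m : ℝ≥0) - 1) : ℝ≥0) / incomingRate lamE lamS j none)
      k n 1 + (1 - φ) *
      missProb ((lamE / ((m : ℝ≥0) - 1) : ℝ≥0) / incomingRate lamE lamS j none) k n 0 := by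
    rw [hA, hρ']
    change _ = φ * missProb (lamE / ((m : ℝ) - 1) / lamS) k n 1 +
      (1 - φ) * missProb (lamE / ((m : ℝ) - 1) / lamS) k n 0
    rw [← one_sub_missProb_one hS0, ← one_sub_missProb_zero hS0]
    ring
  have key := hnet.ae_tendsto_timeAverageAge (r := incomingRate lamE lamS j)
    (by rintro (_ | b); exacts [hlamS, hρ]) hρ (fun _ => rfl) hkn hv
  filter_upwards [key, ae_all_iff.2 hMM'] with ω hω hM
  have h1 : (fun ℓ => S ∪ M ℓ ω) = fun ℓ => S ∪ M' ℓ ω := funext fun ℓ => by rw [hM ℓ]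
  rw [h1, hx]
  rwa [sub_sub_cancel] at hω

end Network

theorem mainTheorem3 {Ω : Type*} [MeasurableSpace Ω] (μ : Measure Ω) [IsProbabilityMeasure μ]
    (k n s m : ℕ) (hkn : k < n) (hsn : s ≤ n) (hnm : n ≤ m) (hm : 2 ≤ m)
    (lamE lamS : ℝ≥0) (hlamE : 0 < lamE) (hlamS : 0 < lamS)
    (S : Finset (Fin m)) (hS : S.card = s)
    (N₀ : ℝ≥0 → Ω → ℕ) (N : Edge m → ℝ≥0 → Ω → ℕ) (M : ℕ → Ω → Finset (Fin m))
    (hnet : IsScalableHomogeneousNetwork N₀ N M S n lamE lamS μ) :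
    (∀ j ∈ S, HasVersionAgeOfKeys N₀ N M S μ k j
      ((∑ i ∈ Finset.Icc 1 k, lamS * coeffA lamE lamS n m (i - 1) / (lamE * coeffB n m i + lamS)) /
        coeffA lamE lamS n m k)) ∧
    (∀ j ∉ S, HasVersionAgeOfKeys N₀ N M S μ k j
      (((n : ℝ) - s) *
          (∑ i ∈ Finset.Icc 1 k,
            lamS * coeffA lamE lamS n m (i - 1) / (lamE * coeffB n m i + lamS)) /
        (((n : ℝ) - s) * coeffA lamE lamS n m k +
          ((m : ℝ) - n) * coeffA lamE lamS (n + 1) m (k + 1)) +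
       ((m : ℝ) - n) *
          (∑ i ∈ Finset.Icc 1 (k + 1),
            lamS * coeffA lamE lamS (n + 1) m (i - 1) / (lamE * coeffB (n + 1) m i + lamS)) /
        (((n : ℝ) - s) * coeffA lamE lamS n m k +
          ((m : ℝ) - n) * coeffA lamE lamS (n + 1) m (k + 1)))) := by
  have hS0 : (0 : ℝ) < lamS := hlamS
  have hm1 : 1 ≤ m := by omega
  have hSn : S.card ≤ n := hS.trans_le hsn
  rw [sum_telescope_coeffA fun i hi => mul_coeffB_add_ne_zero lamE.coe_nonneg hS0 hm1
      ((Finset.mem_Icc.1 hi).2.trans hkn.le),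
    sum_telescope_coeffA fun i hi => mul_coeffB_add_ne_zero lamE.coe_nonneg hS0 hm1
      ((Finset.mem_Icc.1 hi).2.trans (by omega))]
  refine ⟨fun j hj => ?_, fun j hj => ?_⟩
  -- A subscriber always holds a source key, so the mixture reduces to its first term.
  · refine hnet.hasVersionAgeOfKeys hSn hnm hm hlamE hlamS hkn (φ := 1) (fun ℓ => ?_) ?_ rfl
    · simp [hj]
    · ring
  · have hc : Sᶜ.card = m - s := by rw [Finset.card_compl, Fintype.card_fin, hS]
    have hpos : 0 < Sᶜ.card := Finset.card_pos.2 ⟨j, Finset.mem_compl.2 hj⟩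
    have hms : (0 : ℝ) < (m : ℝ) - s := by
      rw [sub_pos]
      exact_mod_cast (by omega : s < m)
    -- `n - s` of the `m - s` nonsubscribers are selected, so `1 - φ = (m - n) / (m - s)`, and the
    -- common factor `m - s` cancels from the quotient.
    refine hnet.hasVersionAgeOfKeys hSn hnm hm hlamE hlamS hkn (φ := ((n : ℝ) - s) / (m - s))
      (fun ℓ => ?_) rfl ?_
    · have h1 := measureReal_mem_of_hasLaw_uniformOn (by omega) hj (hnet.selection ℓ)
      rw [hc, hS, Nat.cast_sub hsn, Nat.cast_sub (hsn.trans hnm)] at h1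
      simpa [hj] using h1
    · rw [← add_div]
      field_simp
      ring
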